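/- **Conventions.** A weak double category $\mathbb A$ has objects, horizontal arrows, vertical arrows and double cells; horizontal composition is strictly associative and unital, vertical composition (written $\bullet$, with vertical identities $\mathrm{id}$) is so up to coherent special isomorphisms. Write $\mathbf A_0$ for the category of objects and horizontal arrows, $\mathbf A_1$ for the category of vertical arrows and cells, and $\partial_0,\partial_1:\mathbf A_1\to\mathbf A_0$ for the vertical domain and codomain. A *lax choice of 1-dimensional pullbacks* in $\mathbb A$ is a choice of pullbacks in $\mathbf A_0$ and in $\mathbf A_1$ such that $\partial_0$ and $\partial_1$ preserve the chosen pullbacks; nothing is required of vertical identities and vertical composition. $\mathbf{LxDbl}$ is the 2-category of weak double categories, lax functors and horizontal transformations. A pseudocategory in $\mathbf{LxDbl}$ consists of weak double categories $\mathbb D_0$ (objects) and $\mathbb D_1$ (arrows), strict double functors $\partial_0,\partial_1:\mathbb D_1\to\mathbb D_0$, lax functors $\mathrm{id}:\mathbb D_0\to\mathbb D_1$ and $m:\mathbb D_1\times_{\mathbb D_0}\mathbb D_1\to\mathbb D_1$ that satisfy the usual equations with $\partial_0,\partial_1$ strictly, and invertible horizontal transformations for associativity and for the two unit laws, which $\partial_0$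 and $\partial_1$ send to identities and which satisfy the pentagon and the triangle axioms. An *intercategory* is a pseudocategory in $\mathbf{LxDbl}$; its interchangers are the comparison cells $\chi$ (of $m$ with vertical composites), $\delta$ (of $m$ with vertical identities), $\mu$ (of $\mathrm{id}$ with vertical composites) and $\tau$ (of $\mathrm{id}$ with vertical identities). **Construction.** Let $\mathbb A$ be a weak double category with a lax choice of 1-dimensional pullbacks. Let $\mathbb A^\Lambda$ be the weak double category whose objects are the spans $A_0\leftarrow A_2\to A_1$ of horizontal arrows of $\mathbb A$, whose horizontal arrows are the commutative diagrams of horizontal arrows between spans, whose vertical arrows are the spans $v_0\leftarrow v_2\to v_1$ of double cells (arrows of $\mathbf A_1$), lying over their domain and codomain spans, and whose cells are the commutative diagrams of double cells between such spans; vertical composition is componentwise. Let $\mathbb A^M$ be defined in the same way by diagrams of shape $0\leftarrow 3\to 1\leftarrow 4\to 2$. Let $\partial_0,\partial_1:\mathbb A^\Lambda\to\mathbb A$ be the evaluations at the feet $0$ and $1$, and let $\mathrm{id}:\mathbb A\to\mathbb A^\Lambda$ send everything to constant spans. Let $m:\mathbb A^M\to\mathbb A^\Lambda$ compose the two spans by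 the chosen pullbacks over the middle foot, in $\mathbf A_0$ for objects and in $\mathbf A_1$ for vertical arrows; its comparison cells are identities on the feet and, on the apices, the cells induced by the universal property of the pullbacks in $\mathbf A_1$. **Statement.** 1. The evaluations exhibit $\mathbb A^M$ as the pullback $\mathbb A^\Lambda\times_{\mathbb A}\mathbb A^\Lambda$ of $\partial_1$ and $\partial_0$: the comparison lax functor $\mathbb A^M\to\mathbb A^\Lambda\times_{\mathbb A}\mathbb A^\Lambda$ is an isomorphism. 2. $\partial_0$, $\partial_1$ and $\mathrm{id}$ are strict double functors and $m$ is a lax functor, and the data $$\mathbb A^M\rightrightarrows\mathbb A^\Lambda\rightrightarrows\mathbb A$$ form a pseudocategory in $\mathbf{LxDbl}$, that is, an intercategory $\mathbf{Span}(\mathbb A)$. Its constraints, on spans and on spans of double cells, are the canonical ones between iterated pullbacks: on apices, the associativity constraint is the unique arrow (cell) that commutes with the three projections, and the left and right unit constraints are the second and the first pullback projection. Thus the objects of $\mathbf{Span}(\mathbb A)$ are those of $\mathbb A$, its transversal arrows and its vertical arrows are the horizontal and the vertical arrows of $\mathbb A$, its horizontal arrows are the spans of horizontal arrows of $\mathbb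 A$, and its basic cells are the spans of double cells of $\mathbb A$. 3. For vertical arrows $x=(v,w)$ and $y=(v',w')$ of $\mathbb A^\Lambda\times_{\mathbb A}\mathbb A^\Lambda$ that are vertically composable, with middle feet $t$ of $x$ and $t'$ of $y$, the interchanger $\chi$ is the identity on the feet, and on apices it is the pullback comparison $$(v_2\times_t w_2)\bullet(v'_2\times_{t'}w'_2)\to(v_2\bullet v'_2)\times_{t\bullet t'}(w_2\bullet w'_2)$$ whose composites with the two projections are the vertical composites of the corresponding projections. 4. For a composable pair of spans with apices $B$, $C$ and middle foot $D$, the interchanger $\delta$ is the identity on the feet, and on apices it is the pullback comparison $$\mathrm{id}_{B\times_D C}\to\mathrm{id}_B\times_{\mathrm{id}_D}\mathrm{id}_C$$ whose composites with the two projections are the vertical identities of the pullback projections. 5. The interchangers $\mu$ and $\tau$ are identities. -/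

import Mathlib

open CategoryTheory

set_option linter.checkUnivs false

namespace SpanDbl

/-! ### Weak double categories -/

/-- A weak double category: strict horizontal composition, vertical composition which is
associative and unital up to coherent invertible special cells.

Objects with horizontal arrows form a category; `V A A'` is the type of vertical arrows;
`Cell v w` is the type of all double cells with left side `v` and right side `w`; the top and the
bottom of a cell are the horizontal arrows `top` and `bot`.  Cells are composed horizontally
by `comp`, and two cells with `bot α = top β` are composed vertically by `vcompCell`. -/
structure WeakDbl.{u, v, w, z} where
  Obj : Type u
  [cat : Category.{v} Obj]
  V : Obj → Obj → Type w
  Cell : ∀ {A A' B B' : Obj}, V A A' → V B B' → Type z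
  top : ∀ {A A' B B' : Obj} {x : V A A'} {y : V B B'}, Cell x y → (A ⟶ B)
  bot : ∀ {A A' B B' : Obj} {x : V A A'} {y : V B B'}, Cell x y → (A' ⟶ B')
  idc : ∀ {A A' : Obj} (x : V A A'), Cell x x
  comp : ∀ {A A' B B' C C' : Obj} {x : V A A'} {y : V B B'} {t : V C C'},
    Cell x y → Cell y t → Cell x t
  id_comp : ∀ {A A' B B' : Obj} {x : V A A'} {y : V B B'} (α : Cell x y),
    comp (idc x) α = α
  comp_id : ∀ {A A' B B' : Obj} {x : V A A'} {y : V B B'} (α : Cell x y),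
    comp α (idc y) = α
  assoc' : ∀ {A A' B B' C C' D D' : Obj} {x : V A A'} {y : V B B'} {t : V C C'} {s : V D D'}
    (α : Cell x y) (β : Cell y t) (γ : Cell t s),
    comp (comp α β) γ = comp α (comp β γ)
  top_idc : ∀ {A A' : Obj} (x : V A A'), top (idc x) = 𝟙 A
  bot_idc : ∀ {A A' : Obj} (x : V A A'), bot (idc x) = 𝟙 A'
  top_comp : ∀ {A A' B B' C C' : Obj} {x : V A A'} {y : V B B'} {t : V C C'}
    (α : Cell x y) (β : Cell y t), top (comp α β) = top α ≫ top β
  bot_comp : ∀ {A A' B B' C C' : Obj} {x : V A A'} {y : V B B'} {t : V C C'}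
    (α : Cell x y) (β : Cell y t), bot (comp α β) = bot α ≫ bot β
  vid : ∀ A : Obj, V A A
  vcomp : ∀ {A B C : Obj}, V A B → V B C → V A C
  vidCell : ∀ {A B : Obj}, (A ⟶ B) → Cell (vid A) (vid B)
  top_vidCell : ∀ {A B : Obj} (f : A ⟶ B), top (vidCell f) = f
  bot_vidCell : ∀ {A B : Obj} (f : A ⟶ B), bot (vidCell f) = f
  vidCell_id : ∀ A : Obj, vidCell (𝟙 A) = idc (vid A)
  vidCell_comp : ∀ {A B C : Obj} (f : A ⟶ B) (g : B ⟶ C),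
    vidCell (f ≫ g) = comp (vidCell f) (vidCell g)
  vcompCell : ∀ {A B C A' B' C' : Obj} {x : V A B} {y : V B C} {x' : V A' B'} {y' : V B' C'}
    (α : Cell x x') (β : Cell y y'), bot α = top β → Cell (vcomp x y) (vcomp x' y')
  top_vcompCell : ∀ {A B C A' B' C' : Obj} {x : V A B} {y : V B C} {x' : V A' B'} {y' : V B' C'}
    (α : Cell x x') (β : Cell y y') (h : bot α = top β), top (vcompCell α β h) = top α
  bot_vcompCell : ∀ {A B C A' B' C' : Obj} {x : V A B} {y : V B C} {x' : V A' B'} {y' : V B' C'}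
    (α : Cell x x') (β : Cell y y') (h : bot α = top β), bot (vcompCell α β h) = bot β
  vcompCell_id : ∀ {A B C : Obj} (x : V A B) (y : V B C) (h : bot (idc x) = top (idc y)),
    vcompCell (idc x) (idc y) h = idc (vcomp x y)
  vcompCell_comp : ∀ {A B C A' B' C' A'' B'' C'' : Obj} {x : V A B} {y : V B C}
    {x' : V A' B'} {y' : V B' C'} {x'' : V A'' B''} {y'' : V B'' C''}
    (α : Cell x x') (α' : Cell x' x'') (β : Cell y y') (β' : Cell y' y'')
    (h : bot α = top β) (h' : bot α' = top β') (h'' : bot (comp α α') = top (comp β β')),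
    vcompCell (comp α α') (comp β β') h'' = comp (vcompCell α β h) (vcompCell α' β' h')
  /-- associativity constraint -/
  ass : ∀ {A B C D : Obj} (x : V A B) (y : V B C) (t : V C D),
    Cell (vcomp (vcomp x y) t) (vcomp x (vcomp y t))
  assInv : ∀ {A B C D : Obj} (x : V A B) (y : V B C) (t : V C D),
    Cell (vcomp x (vcomp y t)) (vcomp (vcomp x y) t)
  ass_assInv : ∀ {A B C D : Obj} (x : V A B) (y : V B C) (t : V C D),
    comp (ass x y t) (assInv x y t) = idc _
  assInv_ass : ∀ {A B C D : Obj} (x : V A B) (y : V B C) (t : V C D),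
    comp (assInv x y t) (ass x y t) = idc _
  top_ass : ∀ {A B C D : Obj} (x : V A B) (y : V B C) (t : V C D), top (ass x y t) = 𝟙 A
  bot_ass : ∀ {A B C D : Obj} (x : V A B) (y : V B C) (t : V C D), bot (ass x y t) = 𝟙 D
  ass_nat : ∀ {A B C D A' B' C' D' : Obj} {x : V A B} {y : V B C} {t : V C D}
    {x' : V A' B'} {y' : V B' C'} {t' : V C' D'}
    (α : Cell x x') (β : Cell y y') (γ : Cell t t')
    (h₁ : bot α = top β) (h₂ : bot (vcompCell α β h₁) = top γ)
    (h₃ : bot β = top γ) (h₄ : bot α = top (vcompCell β γ h₃)),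
    comp (vcompCell (vcompCell α β h₁) γ h₂) (ass x' y' t') =
      comp (ass x y t) (vcompCell α (vcompCell β γ h₃) h₄)
  /-- left unit constraint -/
  lunit : ∀ {A B : Obj} (x : V A B), Cell (vcomp (vid A) x) x
  lunitInv : ∀ {A B : Obj} (x : V A B), Cell x (vcomp (vid A) x)
  lunit_lunitInv : ∀ {A B : Obj} (x : V A B), comp (lunit x) (lunitInv x) = idc _
  lunitInv_lunit : ∀ {A B : Obj} (x : V A B), comp (lunitInv x) (lunit x) = idc _
  top_lunit : ∀ {A B : Obj} (x : V A B), top (lunit x) = 𝟙 A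
  bot_lunit : ∀ {A B : Obj} (x : V A B), bot (lunit x) = 𝟙 B
  lunit_nat : ∀ {A B A' B' : Obj} {x : V A B} {x' : V A' B'} (α : Cell x x')
    (h : bot (vidCell (top α)) = top α),
    comp (vcompCell (vidCell (top α)) α h) (lunit x') = comp (lunit x) α
  /-- right unit constraint -/
  runit : ∀ {A B : Obj} (x : V A B), Cell (vcomp x (vid B)) x
  runitInv : ∀ {A B : Obj} (x : V A B), Cell x (vcomp x (vid B))
  runit_runitInv : ∀ {A B : Obj} (x : V A B), comp (runit x) (runitInv x) = idc _
  runitInv_runit : ∀ {A B : Obj} (x : V A B), comp (runitInv x) (runit x) = idc _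
  top_runit : ∀ {A B : Obj} (x : V A B), top (runit x) = 𝟙 A
  bot_runit : ∀ {A B : Obj} (x : V A B), bot (runit x) = 𝟙 B
  runit_nat : ∀ {A B A' B' : Obj} {x : V A B} {x' : V A' B'} (α : Cell x x')
    (h : bot α = top (vidCell (bot α))),
    comp (vcompCell α (vidCell (bot α)) h) (runit x') = comp (runit x) α
  pentagon : ∀ {A B C D E : Obj} (x : V A B) (y : V B C) (t : V C D) (s : V D E)
    (h : bot (ass x y t) = top (idc s)) (h' : bot (idc x) = top (ass y t s)),
    comp (vcompCell (ass x y t) (idc s) h)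
        (comp (ass x (vcomp y t) s) (vcompCell (idc x) (ass y t s) h')) =
      comp (ass (vcomp x y) t s) (ass x y (vcomp t s))
  triangle : ∀ {A B C : Obj} (x : V A B) (y : V B C)
    (h : bot (idc x) = top (lunit y)) (h' : bot (runit x) = top (idc y)),
    comp (ass x (vid B) y) (vcompCell (idc x) (lunit y) h) = vcompCell (runit x) (idc y) h'

attribute [instance] WeakDbl.cat

attribute [simp] WeakDbl.id_comp WeakDbl.comp_id WeakDbl.assoc' WeakDbl.top_idc WeakDbl.bot_idc
  WeakDbl.top_comp WeakDbl.bot_comp WeakDbl.top_vidCell WeakDbl.bot_vidCell WeakDbl.vidCell_id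
  WeakDbl.top_vcompCell WeakDbl.bot_vcompCell WeakDbl.vcompCell_id
  WeakDbl.ass_assInv WeakDbl.assInv_ass WeakDbl.top_ass WeakDbl.bot_ass WeakDbl.lunit_lunitInv
  WeakDbl.lunitInv_lunit WeakDbl.top_lunit WeakDbl.bot_lunit WeakDbl.runit_runitInv WeakDbl.runitInv_runit
  WeakDbl.top_runit WeakDbl.bot_runit

/-- horizontal composition of cells -/
infixr:80 " ⊚ " => WeakDbl.comp _

/-- vertical composition of vertical arrows -/
infixr:80 " ⊙ " => WeakDbl.vcomp _

section Basic

universe u v w z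

variable {D : WeakDbl.{u, v, w, z}}

namespace WeakDbl

@[simp] theorem top_assInv {A B C E : D.Obj} (x : D.V A B) (y : D.V B C) (t : D.V C E) :
    D.top (D.assInv x y t) = 𝟙 A := by
  have := congrArg D.top (D.ass_assInv x y t)
  rwa [D.top_comp, D.top_ass, D.top_idc, Category.id_comp] at this

@[simp] theorem bot_assInv {A B C E : D.Obj} (x : D.V A B) (y : D.V B C) (t : D.V C E) :
    D.bot (D.assInv x y t) = 𝟙 E := by
  have := congrArg D.bot (D.ass_assInv x y t)
  rwa [D.bot_comp, D.bot_ass, D.bot_idc, Category.id_comp] at this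

@[simp] theorem top_lunitInv {A B : D.Obj} (x : D.V A B) : D.top (D.lunitInv x) = 𝟙 A := by
  have := congrArg D.top (D.lunit_lunitInv x)
  rwa [D.top_comp, D.top_lunit, D.top_idc, Category.id_comp] at this

@[simp] theorem bot_lunitInv {A B : D.Obj} (x : D.V A B) : D.bot (D.lunitInv x) = 𝟙 B := by
  have := congrArg D.bot (D.lunit_lunitInv x)
  rwa [D.bot_comp, D.bot_lunit, D.bot_idc, Category.id_comp] at this

@[simp] theorem top_runitInv {A B : D.Obj} (x : D.V A B) : D.top (D.runitInv x) = 𝟙 A := by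
  have := congrArg D.top (D.runit_runitInv x)
  rwa [D.top_comp, D.top_runit, D.top_idc, Category.id_comp] at this

@[simp] theorem bot_runitInv {A B : D.Obj} (x : D.V A B) : D.bot (D.runitInv x) = 𝟙 B := by
  have := congrArg D.bot (D.runit_runitInv x)
  rwa [D.bot_comp, D.bot_runit, D.bot_idc, Category.id_comp] at this

theorem vcompCell_congr {A B C A' B' C' : D.Obj} {x : D.V A B} {y : D.V B C} {x' : D.V A' B'}
    {y' : D.V B' C'} {α α' : D.Cell x x'} {β β' : D.Cell y y'} (h : D.bot α = D.top β)
    (hα : α = α') (hβ : β = β') (h' : D.bot α' = D.top β') :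
    D.vcompCell α β h = D.vcompCell α' β' h' := by
  subst hα hβ; rfl

/-- The identity cell between two equal vertical arrows (the end points are equal as well). -/
def eqCell {A A' B B' : D.Obj} {x : D.V A A'} {y : D.V B B'} (hA : A = B) (hB : A' = B')
    (h : HEq x y) : D.Cell x y := by
  subst hA hB
  exact eq_of_heq h ▸ D.idc x

/-- A horizontal arrow which is an identity. -/
def IsIdHom {A B : D.Obj} (f : A ⟶ B) : Prop := ∃ h : A = B, f = eqToHom h

/-- A cell which is the (horizontal) identity of a vertical arrow. -/
def IsIdCell {A A' B B' : D.Obj} {x : D.V A A'} {y : D.V B B'} (α : D.Cell x y) : Prop :=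
  ∃ (hA : A = B) (hB : A' = B') (h : HEq x y), α = eqCell hA hB h

section
variable {A A' B B' C C' A₁ B₁ C₁ A₂ B₂ C₂ E₁ E₂ : D.Obj}
  {x : D.V A A'} {y : D.V B B'} {t : D.V C C'}

@[simp] theorem eqCell_rfl (hA : A = A) (hB : A' = A') (h : HEq x x) :
    eqCell hA hB h = D.idc x := rfl

@[simp] theorem top_eqCell (hA : A = B) (hB : A' = B') (h : HEq x y) :
    D.top (eqCell hA hB h) = eqToHom hA := by
  subst hA hB; cases h; simp

@[simp] theorem bot_eqCell (hA : A = B) (hB : A' = B') (h : HEq x y) :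
    D.bot (eqCell hA hB h) = eqToHom hB := by
  subst hA hB; cases h; simp

@[simp] theorem eqCell_trans (hA : A = B) (hB : A' = B') (h : HEq x y)
    (hA' : B = C) (hB' : B' = C') (h' : HEq y t) :
    eqCell hA hB h ⊚ eqCell hA' hB' h' =
      eqCell (hA.trans hA') (hB.trans hB') (h.trans h') := by
  subst hA hB hA' hB'; cases h; cases h'; simp

@[simp] theorem eqCell_trans_assoc {F F' : D.Obj} {s : D.V F F'} (hA : A = B) (hB : A' = B')
    (h : HEq x y) (hA' : B = C) (hB' : B' = C') (h' : HEq y t) (γ : D.Cell t s) :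
    eqCell hA hB h ⊚ eqCell hA' hB' h' ⊚ γ =
      eqCell (hA.trans hA') (hB.trans hB') (h.trans h') ⊚ γ := by
  rw [← D.assoc', eqCell_trans]

theorem vcomp_heq {x₁ : D.V A₁ B₁} {x₂ : D.V A₂ B₂} {y₁ : D.V B₁ C₁} {y₂ : D.V B₂ C₂}
    (hA : A₁ = A₂) (hB : B₁ = B₂) (hC : C₁ = C₂) (hx : HEq x₁ x₂) (hy : HEq y₁ y₂) :
    HEq (x₁ ⊙ y₁) (x₂ ⊙ y₂) := by
  subst hA hB hC; cases hx; cases hy; rfl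

theorem vid_heq (hA : A₁ = A₂) : HEq (D.vid A₁) (D.vid A₂) := by subst hA; rfl

@[simp] theorem vidCell_eqToHom (hA : A₁ = A₂) :
    D.vidCell (eqToHom hA) = eqCell hA hA (vid_heq hA) := by
  subst hA; simp

theorem vcompCell_eqCell {x₁ : D.V A₁ B₁} {x₂ : D.V A₂ B₂} {y₁ : D.V B₁ C₁} {y₂ : D.V B₂ C₂}
    (hA : A₁ = A₂) (hB : B₁ = B₂) (hB' : B₁ = B₂) (hC : C₁ = C₂) (hx : HEq x₁ x₂)
    (hy : HEq y₁ y₂) (h : D.bot (eqCell hA hB hx) = D.top (eqCell hB' hC hy)) :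
    D.vcompCell (eqCell hA hB hx) (eqCell hB' hC hy) h =
      eqCell hA hC (vcomp_heq hA hB hC hx hy) := by
  subst hA hB hC; cases hx; cases hy; simp

theorem eqCell_ass {x₁ : D.V A₁ B₁} {x₂ : D.V A₂ B₂} {y₁ : D.V B₁ C₁} {y₂ : D.V B₂ C₂}
    {t₁ : D.V C₁ E₁} {t₂ : D.V C₂ E₂} (hA : A₁ = A₂) (hB : B₁ = B₂) (hC : C₁ = C₂)
    (hE : E₁ = E₂) (hx : HEq x₁ x₂) (hy : HEq y₁ y₂) (ht : HEq t₁ t₂)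
    (h₁ : HEq ((x₁ ⊙ y₁) ⊙ t₁) ((x₂ ⊙ y₂) ⊙ t₂)) (h₂ : HEq (x₁ ⊙ (y₁ ⊙ t₁)) (x₂ ⊙ (y₂ ⊙ t₂))) :
    eqCell hA hE h₁ ⊚ D.ass x₂ y₂ t₂ = D.ass x₁ y₁ t₁ ⊚ eqCell hA hE h₂ := by
  subst hA hB hC hE; cases hx; cases hy; cases ht; simp

theorem eqCell_lunit {x₁ : D.V A₁ B₁} {x₂ : D.V A₂ B₂} (hA : A₁ = A₂) (hB : B₁ = B₂)
    (hx : HEq x₁ x₂) (h₁ : HEq (D.vid A₁ ⊙ x₁) (D.vid A₂ ⊙ x₂)) :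
    eqCell hA hB h₁ ⊚ D.lunit x₂ = D.lunit x₁ ⊚ eqCell hA hB hx := by
  subst hA hB; cases hx; simp

theorem eqCell_runit {x₁ : D.V A₁ B₁} {x₂ : D.V A₂ B₂} (hA : A₁ = A₂) (hB : B₁ = B₂)
    (hx : HEq x₁ x₂) (h₁ : HEq (x₁ ⊙ D.vid B₁) (x₂ ⊙ D.vid B₂)) :
    eqCell hA hB h₁ ⊚ D.runit x₂ = D.runit x₁ ⊚ eqCell hA hB hx := by
  subst hA hB; cases hx; simp

end

end WeakDbl

end Basic

/-! ### Lax functors and horizontal transformations -/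

section Functors

/-- The data of a lax functor without its comparison cells: a functor on objects and horizontal
arrows and a compatible functor on vertical arrows and cells. -/
structure PreFunctor.{u₁, v₁, w₁, z₁, u₂, v₂, w₂, z₂} (D : WeakDbl.{u₁, v₁, w₁, z₁})
    (E : WeakDbl.{u₂, v₂, w₂, z₂}) where
  obj : D.Obj → E.Obj
  map : ∀ {A B : D.Obj}, (A ⟶ B) → (obj A ⟶ obj B)
  map_id : ∀ A : D.Obj, map (𝟙 A) = 𝟙 (obj A)
  map_comp : ∀ {A B C : D.Obj} (f : A ⟶ B) (g : B ⟶ C), map (f ≫ g) = map f ≫ map g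
  mapV : ∀ {A B : D.Obj}, D.V A B → E.V (obj A) (obj B)
  mapCell : ∀ {A A' B B' : D.Obj} {x : D.V A A'} {y : D.V B B'},
    D.Cell x y → E.Cell (mapV x) (mapV y)
  top_mapCell : ∀ {A A' B B' : D.Obj} {x : D.V A A'} {y : D.V B B'} (α : D.Cell x y),
    E.top (mapCell α) = map (D.top α)
  bot_mapCell : ∀ {A A' B B' : D.Obj} {x : D.V A A'} {y : D.V B B'} (α : D.Cell x y),
    E.bot (mapCell α) = map (D.bot α)
  mapCell_id : ∀ {A A' : D.Obj} (x : D.V A A'), mapCell (D.idc x) = E.idc (mapV x)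
  mapCell_comp : ∀ {A A' B B' C C' : D.Obj} {x : D.V A A'} {y : D.V B B'} {t : D.V C C'}
    (α : D.Cell x y) (β : D.Cell y t), mapCell (α ⊚ β) = mapCell α ⊚ mapCell β

/-- A lax functor between weak double categories; `eta` and `mu` are its comparison cells
for vertical identities and vertical composites. -/
structure LaxFunctor.{u₁, v₁, w₁, z₁, u₂, v₂, w₂, z₂} (D : WeakDbl.{u₁, v₁, w₁, z₁})
    (E : WeakDbl.{u₂, v₂, w₂, z₂}) extends PreFunctor D E where
  eta : ∀ A : D.Obj, E.Cell (E.vid (obj A)) (mapV (D.vid A))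
  mu : ∀ {A B C : D.Obj} (x : D.V A B) (y : D.V B C), E.Cell (mapV x ⊙ mapV y) (mapV (x ⊙ y))
  top_eta : ∀ A : D.Obj, E.top (eta A) = 𝟙 (obj A)
  bot_eta : ∀ A : D.Obj, E.bot (eta A) = 𝟙 (obj A)
  top_mu : ∀ {A B C : D.Obj} (x : D.V A B) (y : D.V B C), E.top (mu x y) = 𝟙 (obj A)
  bot_mu : ∀ {A B C : D.Obj} (x : D.V A B) (y : D.V B C), E.bot (mu x y) = 𝟙 (obj C)
  eta_nat : ∀ {A B : D.Obj} (f : A ⟶ B),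
    E.vidCell (map f) ⊚ eta B = eta A ⊚ mapCell (D.vidCell f)
  mu_nat : ∀ {A B C A' B' C' : D.Obj} {x : D.V A B} {y : D.V B C} {x' : D.V A' B'}
    {y' : D.V B' C'} (α : D.Cell x x') (β : D.Cell y y') (h : D.bot α = D.top β)
    (h' : E.bot (mapCell α) = E.top (mapCell β)),
    E.vcompCell (mapCell α) (mapCell β) h' ⊚ mu x' y' = mu x y ⊚ mapCell (D.vcompCell α β h)
  mu_ass : ∀ {A B C F : D.Obj} (x : D.V A B) (y : D.V B C) (t : D.V C F)
    (h : E.bot (mu x y) = E.top (E.idc (mapV t))) (h' : E.bot (E.idc (mapV x)) = E.top (mu y t)),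
    E.vcompCell (mu x y) (E.idc (mapV t)) h ⊚ mu (x ⊙ y) t ⊚ mapCell (D.ass x y t) =
      E.ass (mapV x) (mapV y) (mapV t) ⊚ E.vcompCell (E.idc (mapV x)) (mu y t) h' ⊚ mu x (y ⊙ t)
  mu_lunit : ∀ {A B : D.Obj} (x : D.V A B) (h : E.bot (eta A) = E.top (E.idc (mapV x))),
    E.vcompCell (eta A) (E.idc (mapV x)) h ⊚ mu (D.vid A) x ⊚ mapCell (D.lunit x) =
      E.lunit (mapV x)
  mu_runit : ∀ {A B : D.Obj} (x : D.V A B) (h : E.bot (E.idc (mapV x)) = E.top (eta B)),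
    E.vcompCell (E.idc (mapV x)) (eta B) h ⊚ mu x (D.vid B) ⊚ mapCell (D.runit x) =
      E.runit (mapV x)

attribute [simp] PreFunctor.map_id PreFunctor.map_comp PreFunctor.top_mapCell
  PreFunctor.bot_mapCell PreFunctor.mapCell_id PreFunctor.mapCell_comp
  LaxFunctor.top_eta LaxFunctor.bot_eta LaxFunctor.top_mu LaxFunctor.bot_mu

/-- A strict double functor: a lax functor whose comparison cells are identities. -/
structure StrictFunctor.{u₁, v₁, w₁, z₁, u₂, v₂, w₂, z₂} (D : WeakDbl.{u₁, v₁, w₁, z₁})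
    (E : WeakDbl.{u₂, v₂, w₂, z₂}) extends LaxFunctor D E where
  eta_id : ∀ A : D.Obj, WeakDbl.IsIdCell (eta A)
  mu_id : ∀ {A B C : D.Obj} (x : D.V A B) (y : D.V B C), WeakDbl.IsIdCell (mu x y)

universe u₁ v₁ w₁ z₁ u₂ v₂ w₂ z₂ u₃ v₃ w₃ z₃ u₄ v₄ w₄ z₄

variable {D : WeakDbl.{u₁, v₁, w₁, z₁}} {E : WeakDbl.{u₂, v₂, w₂, z₂}}
  {F : WeakDbl.{u₃, v₃, w₃, z₃}} {K : WeakDbl.{u₄, v₄, w₄, z₄}}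

theorem PreFunctor.map_eqToHom (G : PreFunctor D E) {A B : D.Obj} (h : A = B) :
    G.map (eqToHom h) = eqToHom (congrArg G.obj h) := by
  subst h; simp

theorem PreFunctor.mapV_heq (G : PreFunctor D E) {A B A' B' : D.Obj} {x : D.V A B}
    {y : D.V A' B'} (hA : A = A') (hB : B = B') (h : HEq x y) : HEq (G.mapV x) (G.mapV y) := by
  subst hA hB; cases h; rfl

theorem PreFunctor.mapCell_eqCell (G : PreFunctor D E) {A B A' B' : D.Obj} {x : D.V A B}
    {y : D.V A' B'} (hA : A = A') (hB : B = B') (h : HEq x y) :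
    G.mapCell (WeakDbl.eqCell hA hB h) =
      WeakDbl.eqCell (congrArg G.obj hA) (congrArg G.obj hB) (G.mapV_heq hA hB h) := by
  subst hA hB; cases h; simp

theorem IsIdCell_comp {A A' B B' C C' : D.Obj} {x : D.V A A'} {y : D.V B B'} {t : D.V C C'}
    {α : D.Cell x y} {β : D.Cell y t} (hα : WeakDbl.IsIdCell α) (hβ : WeakDbl.IsIdCell β) :
    WeakDbl.IsIdCell (α ⊚ β) := by
  obtain ⟨h₁, h₂, h₃, rfl⟩ := hα
  obtain ⟨h₄, h₅, h₆, rfl⟩ := hβ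
  exact ⟨h₁.trans h₄, h₂.trans h₅, h₃.trans h₆, by simp⟩

theorem PreFunctor.map_isIdCell (G : PreFunctor D E) {A A' B B' : D.Obj} {x : D.V A A'}
    {y : D.V B B'} {α : D.Cell x y} (hα : WeakDbl.IsIdCell α) :
    WeakDbl.IsIdCell (G.mapCell α) := by
  obtain ⟨h₁, h₂, h₃, rfl⟩ := hα
  exact ⟨_, _, _, G.mapCell_eqCell h₁ h₂ h₃⟩

theorem LaxFunctor.ext_of {G H : LaxFunctor D E} (h : G.toPreFunctor = H.toPreFunctor)
    (he : HEq G.eta H.eta) (hm : HEq (@LaxFunctor.mu _ _ G) (@LaxFunctor.mu _ _ H)) : G = H := by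
  cases G; cases H
  dsimp only at h
  subst h
  cases he
  cases hm
  rfl

/-- The identity lax functor. -/
@[reducible] def LaxFunctor.id (D : WeakDbl.{u₁, v₁, w₁, z₁}) : LaxFunctor D D where
  obj A := A
  map f := f
  map_id _ := rfl
  map_comp _ _ := rfl
  mapV x := x
  mapCell α := α
  top_mapCell _ := rfl
  bot_mapCell _ := rfl
  mapCell_id _ := rfl
  mapCell_comp _ _ := rfl
  eta A := D.idc _
  mu x y := D.idc _
  top_eta _ := by simp
  bot_eta _ := by simp
  top_mu _ _ := by simp
  bot_mu _ _ := by simp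
  eta_nat _ := by simp
  mu_nat _ _ _ _ := by simp
  mu_ass _ _ _ _ _ := by simp
  mu_lunit _ _ := by simp
  mu_runit _ _ := by simp

theorem vcompCell_comp_idc {A B C A' B' A'' B'' : D.Obj} {x : D.V A B} {y : D.V B C}
    {x' : D.V A' B'} {x'' : D.V A'' B''} {C' C'' : D.Obj} {y' : D.V B' C'} {y'' : D.V B'' C''}
    (α : D.Cell x x') (α' : D.Cell x' x'') (β : D.Cell y y') (β' : D.Cell y' y'')
    (h : D.bot α = D.top β) (h' : D.bot α' = D.top β') :
    D.vcompCell α β h ⊚ D.vcompCell α' β' h' =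
      D.vcompCell (α ⊚ α') (β ⊚ β') (by simp [h, h']) :=
  (D.vcompCell_comp α α' β β' h h' _).symm

theorem comp_cong_left {A A' B B' C C' : D.Obj} {x : D.V A A'} {y : D.V B B'} {t : D.V C C'}
    {α β : D.Cell x y} (h : α = β) (γ : D.Cell y t) : α ⊚ γ = β ⊚ γ := by rw [h]

/-- Composition of lax functors, in diagrammatic order. -/
@[reducible] def LaxFunctor.comp (G : LaxFunctor D E) (H : LaxFunctor E F) : LaxFunctor D F where
  obj A := H.obj (G.obj A)
  map f := H.map (G.map f)
  map_id _ := by simp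
  map_comp _ _ := by simp
  mapV x := H.mapV (G.mapV x)
  mapCell α := H.mapCell (G.mapCell α)
  top_mapCell _ := by simp
  bot_mapCell _ := by simp
  mapCell_id _ := by simp
  mapCell_comp _ _ := by simp
  eta A := H.eta (G.obj A) ⊚ H.mapCell (G.eta A)
  mu x y := H.mu (G.mapV x) (G.mapV y) ⊚ H.mapCell (G.mu x y)
  top_eta _ := by simp
  bot_eta _ := by simp
  top_mu _ _ := by simp
  bot_mu _ _ := by simp
  eta_nat f := by
    rw [← F.assoc', H.eta_nat, F.assoc', ← H.mapCell_comp, G.eta_nat, H.mapCell_comp, F.assoc']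
  mu_nat α β h h' := by
    rw [← F.assoc', H.mu_nat _ _ (by simpa using congrArg G.map h), F.assoc', ← H.mapCell_comp,
      G.mu_nat _ _ h, H.mapCell_comp, F.assoc']
  mu_ass x y t h h' := by
    have e₁ := comp_cong_left (H.mu_ass (G.mapV x) (G.mapV y) (G.mapV t) (by simp) (by simp))
      (H.mapCell (E.vcompCell (E.idc _) (G.mu y t) (by simp) ⊚ G.mu x (y ⊙ t)))
    have e₂ := congrArg H.mapCell (G.mu_ass x y t (by simp) (by simp))
    have n₁ := H.mu_nat (G.mu x y) (E.idc (G.mapV t)) (by simp) (by simp)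
    have n₂ := H.mu_nat (E.idc (G.mapV x)) (G.mu y t) (by simp) (by simp)
    have d₁ : F.vcompCell (H.mu (G.mapV x) (G.mapV y) ⊚ H.mapCell (G.mu x y))
        (F.idc (H.mapV (G.mapV t))) h =
        F.vcompCell (H.mu (G.mapV x) (G.mapV y)) (F.idc _) (by simp) ⊚
          F.vcompCell (H.mapCell (G.mu x y)) (H.mapCell (E.idc (G.mapV t))) (by simp) := by
      rw [vcompCell_comp_idc]
      exact WeakDbl.vcompCell_congr _ rfl (by simp) _
    have d₂ : F.vcompCell (F.idc (H.mapV (G.mapV x)))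
        (H.mu (G.mapV y) (G.mapV t) ⊚ H.mapCell (G.mu y t)) h' =
        F.vcompCell (F.idc _) (H.mu (G.mapV y) (G.mapV t)) (by simp) ⊚
          F.vcompCell (H.mapCell (E.idc (G.mapV x))) (H.mapCell (G.mu y t)) (by simp) := by
      rw [vcompCell_comp_idc]
      exact WeakDbl.vcompCell_congr _ (by simp) rfl _
    simp only [H.mapCell_comp] at e₁ e₂
    rw [d₁, d₂]
    simp only [F.assoc'] at e₁ ⊢
    rw [← F.assoc' (F.vcompCell (H.mapCell (G.mu x y)) _ _), n₁]
    rw [← F.assoc' (F.vcompCell _ (H.mapCell (G.mu y t)) _), n₂]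
    simp only [F.assoc']
    rw [e₂, ← e₁]
  mu_lunit x h := by
    have e₂ := congrArg H.mapCell (G.mu_lunit x (by simp))
    have n₁ := H.mu_nat (G.eta _) (E.idc (G.mapV x)) (by simp) (by simp)
    have d₁ : F.vcompCell (H.eta _ ⊚ H.mapCell (G.eta _)) (F.idc (H.mapV (G.mapV x))) h =
        F.vcompCell (H.eta _) (F.idc _) (by simp) ⊚
          F.vcompCell (H.mapCell (G.eta _)) (H.mapCell (E.idc (G.mapV x))) (by simp) := by
      rw [vcompCell_comp_idc]
      exact WeakDbl.vcompCell_congr _ rfl (by simp) _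
    simp only [H.mapCell_comp] at e₂
    rw [d₁]
    simp only [F.assoc']
    rw [← F.assoc' (F.vcompCell (H.mapCell (G.eta _)) _ _), n₁]
    simp only [F.assoc']
    rw [e₂, H.mu_lunit _ (by simp)]
  mu_runit x h := by
    have e₂ := congrArg H.mapCell (G.mu_runit x (by simp))
    have n₁ := H.mu_nat (E.idc (G.mapV x)) (G.eta _) (by simp) (by simp)
    have d₁ : F.vcompCell (F.idc (H.mapV (G.mapV x))) (H.eta _ ⊚ H.mapCell (G.eta _)) h =
        F.vcompCell (F.idc _) (H.eta _) (by simp) ⊚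
          F.vcompCell (H.mapCell (E.idc (G.mapV x))) (H.mapCell (G.eta _)) (by simp) := by
      rw [vcompCell_comp_idc]
      exact WeakDbl.vcompCell_congr _ (by simp) rfl _
    simp only [H.mapCell_comp] at e₂
    rw [d₁]
    simp only [F.assoc']
    rw [← F.assoc' (F.vcompCell _ (H.mapCell (G.eta _)) _), n₁]
    simp only [F.assoc']
    rw [e₂, H.mu_runit _ (by simp)]

/-- Composition of strict double functors. -/
def StrictFunctor.comp (G : StrictFunctor D E) (H : StrictFunctor E F) : StrictFunctor D F where
  toLaxFunctor := G.toLaxFunctor.comp H.toLaxFunctor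
  eta_id _ := IsIdCell_comp (H.eta_id _) (H.toPreFunctor.map_isIdCell (G.eta_id _))
  mu_id _ _ := IsIdCell_comp (H.mu_id _ _) (H.toPreFunctor.map_isIdCell (G.mu_id _ _))

theorem LaxFunctor.comp_assoc (G : LaxFunctor D E) (H : LaxFunctor E F) (L : LaxFunctor F K) :
    (G.comp H).comp L = G.comp (H.comp L) := by
  refine LaxFunctor.ext_of rfl (heq_of_eq ?_) (heq_of_eq ?_)
  · funext A
    simp [LaxFunctor.comp]
  · funext A B C x y
    simp [LaxFunctor.comp]

theorem LaxFunctor.id_comp (G : LaxFunctor D E) : (LaxFunctor.id D).comp G = G := by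
  refine LaxFunctor.ext_of rfl (heq_of_eq ?_) (heq_of_eq ?_)
  · funext A
    simp [LaxFunctor.comp, LaxFunctor.id]
  · funext A B C x y
    simp [LaxFunctor.comp, LaxFunctor.id]

theorem LaxFunctor.comp_id (G : LaxFunctor D E) : G.comp (LaxFunctor.id E) = G := by
  refine LaxFunctor.ext_of rfl (heq_of_eq ?_) (heq_of_eq ?_)
  · funext A
    simp [LaxFunctor.comp, LaxFunctor.id]
  · funext A B C x y
    simp [LaxFunctor.comp, LaxFunctor.id]

/-- A horizontal transformation between lax functors. -/
structure HTrans (G H : LaxFunctor D E) where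
  app : ∀ A : D.Obj, G.obj A ⟶ H.obj A
  cell : ∀ {A B : D.Obj} (x : D.V A B), E.Cell (G.mapV x) (H.mapV x)
  top_cell : ∀ {A B : D.Obj} (x : D.V A B), E.top (cell x) = app A
  bot_cell : ∀ {A B : D.Obj} (x : D.V A B), E.bot (cell x) = app B
  app_nat : ∀ {A B : D.Obj} (f : A ⟶ B), G.map f ≫ app B = app A ≫ H.map f
  cell_nat : ∀ {A A' B B' : D.Obj} {x : D.V A A'} {y : D.V B B'} (α : D.Cell x y),
    G.mapCell α ⊚ cell y = cell x ⊚ H.mapCell α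
  cell_eta : ∀ A : D.Obj, G.eta A ⊚ cell (D.vid A) = E.vidCell (app A) ⊚ H.eta A
  cell_mu : ∀ {A B C : D.Obj} (x : D.V A B) (y : D.V B C) (h : E.bot (cell x) = E.top (cell y)),
    G.mu x y ⊚ cell (x ⊙ y) = E.vcompCell (cell x) (cell y) h ⊚ H.mu x y

/-- A horizontal transformation is invertible if it has a two-sided inverse transformation. -/
def HTrans.Invertible {G H : LaxFunctor D E} (φ : HTrans G H) : Prop :=
  ∃ ψ : HTrans H G, (∀ A, φ.app A ≫ ψ.app A = 𝟙 _) ∧ (∀ A, ψ.app A ≫ φ.app A = 𝟙 _) ∧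
    (∀ {A B : D.Obj} (x : D.V A B), φ.cell x ⊚ ψ.cell x = E.idc _) ∧
    (∀ {A B : D.Obj} (x : D.V A B), ψ.cell x ⊚ φ.cell x = E.idc _)

end Functors

/-! ### Pullbacks of strict double functors -/

section Pullback

universe u₁ v₁ w₁ z₁ u₂ v₂ w₂ z₂ u₃ v₃ w₃ z₃ u₄ v₄ w₄ z₄

variable {B : WeakDbl.{u₁, v₁, w₁, z₁}} {C : WeakDbl.{u₂, v₂, w₂, z₂}}
  {D : WeakDbl.{u₃, v₃, w₃, z₃}} {X : WeakDbl.{u₄, v₄, w₄, z₄}}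

open WeakDbl

theorem StrictFunctor.mapV_vid (F : StrictFunctor B D) (A : B.Obj) :
    F.mapV (B.vid A) = D.vid (F.obj A) := by
  obtain ⟨_, _, h, _⟩ := F.eta_id A
  exact (eq_of_heq h).symm

theorem StrictFunctor.mapV_vcomp (F : StrictFunctor B D) {A₀ A₁ A₂ : B.Obj} (x : B.V A₀ A₁)
    (y : B.V A₁ A₂) : F.mapV (x ⊙ y) = F.mapV x ⊙ F.mapV y := by
  obtain ⟨_, _, h, _⟩ := F.mu_id x y
  exact (eq_of_heq h).symm

theorem StrictFunctor.eta_eq (F : StrictFunctor B D) (A : B.Obj) :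
    F.eta A = eqCell rfl rfl (heq_of_eq (F.mapV_vid A).symm) := by
  obtain ⟨_, _, h, e⟩ := F.eta_id A
  exact e

theorem StrictFunctor.mu_eq (F : StrictFunctor B D) {A₀ A₁ A₂ : B.Obj} (x : B.V A₀ A₁)
    (y : B.V A₁ A₂) : F.mu x y = eqCell rfl rfl (heq_of_eq (F.mapV_vcomp x y).symm) := by
  obtain ⟨_, _, h, e⟩ := F.mu_id x y
  exact e

theorem eqCell_cancel_left {A A' A₁ A₁' A₂ A₂' : D.Obj} {x : D.V A A'} {y : D.V A₁ A₁'}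
    {t : D.V A₂ A₂'} (hA : A = A₁) (hA' : A' = A₁') (h : HEq x y) {α β : D.Cell y t}
    (e : eqCell hA hA' h ⊚ α = eqCell hA hA' h ⊚ β) : α = β := by
  subst hA hA'; cases h; simpa using e

theorem eqCell_comp_eq_iff {A A' A₁ A₁' A₂ A₂' : D.Obj} {x : D.V A A'} {y : D.V A₁ A₁'}
    {t : D.V A₂ A₂'} (hA : A = A₁) (hA' : A' = A₁') (h : HEq x y) (α : D.Cell y t)
    (β : D.Cell x t) :
    eqCell hA hA' h ⊚ α = β ↔ α = eqCell hA.symm hA'.symm h.symm ⊚ β := by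
  subst hA hA'; cases h; simp

theorem comp_eqCell_eq_iff {A A' A₁ A₁' A₂ A₂' : D.Obj} {x : D.V A A'} {y : D.V A₁ A₁'}
    {t : D.V A₂ A₂'} (hA : A = A₁) (hA' : A' = A₁') (h : HEq x y) (α : D.Cell t x)
    (β : D.Cell t y) :
    α ⊚ eqCell hA hA' h = β ↔ α = β ⊚ eqCell hA.symm hA'.symm h.symm := by
  subst hA hA'; cases h; simp

theorem StrictFunctor.mapCell_vidCell (F : StrictFunctor B D) {A A' : B.Obj} (f : A ⟶ A') :
    F.mapCell (B.vidCell f) = eqCell rfl rfl (heq_of_eq (F.mapV_vid A)) ⊚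
      D.vidCell (F.map f) ⊚ eqCell rfl rfl (heq_of_eq (F.mapV_vid A').symm) := by
  have := F.eta_nat f
  rw [F.eta_eq, F.eta_eq] at this
  rw [this]; simp

theorem StrictFunctor.mapCell_vcompCell (F : StrictFunctor B D) {A₀ A₁ A₂ A₀' A₁' A₂' : B.Obj}
    {x : B.V A₀ A₁} {y : B.V A₁ A₂} {x' : B.V A₀' A₁'} {y' : B.V A₁' A₂'} (α : B.Cell x x')
    (β : B.Cell y y') (h : B.bot α = B.top β) :
    F.mapCell (B.vcompCell α β h) = eqCell rfl rfl (heq_of_eq (F.mapV_vcomp x y)) ⊚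
      D.vcompCell (F.mapCell α) (F.mapCell β) (by simp [h]) ⊚
        eqCell rfl rfl (heq_of_eq (F.mapV_vcomp x' y').symm) := by
  have := F.mu_nat α β h (by simp [h])
  rw [F.mu_eq, F.mu_eq] at this
  rw [this]; simp

theorem idc_eq_eqCell {A A' : D.Obj} (x : D.V A A') : D.idc x = eqCell rfl rfl HEq.rfl := rfl

theorem StrictFunctor.mapCell_ass (F : StrictFunctor B D) {A₀ A₁ A₂ A₃ : B.Obj}
    (x : B.V A₀ A₁) (y : B.V A₁ A₂) (t : B.V A₂ A₃) :
    F.mapCell (B.ass x y t) =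
      eqCell rfl rfl (heq_of_eq (by rw [F.mapV_vcomp, F.mapV_vcomp])) ⊚
        D.ass (F.mapV x) (F.mapV y) (F.mapV t) ⊚
          eqCell rfl rfl (heq_of_eq (by rw [F.mapV_vcomp, F.mapV_vcomp])) := by
  have := F.mu_ass x y t (by simp) (by simp)
  simp only [F.mu_eq, idc_eq_eqCell, vcompCell_eqCell, eqCell_trans, eqCell_trans_assoc] at this
  rw [eqCell_comp_eq_iff] at this
  exact this

theorem StrictFunctor.mapCell_lunit (F : StrictFunctor B D) {A₀ A₁ : B.Obj} (x : B.V A₀ A₁) :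
    F.mapCell (B.lunit x) =
      eqCell rfl rfl (heq_of_eq (by rw [F.mapV_vcomp, F.mapV_vid])) ⊚ D.lunit (F.mapV x) := by
  have := F.mu_lunit x (by simp)
  simp only [F.mu_eq, F.eta_eq, idc_eq_eqCell, vcompCell_eqCell, eqCell_trans_assoc] at this
  rw [eqCell_comp_eq_iff] at this
  exact this

theorem StrictFunctor.mapCell_runit (F : StrictFunctor B D) {A₀ A₁ : B.Obj} (x : B.V A₀ A₁) :
    F.mapCell (B.runit x) =
      eqCell rfl rfl (heq_of_eq (by rw [F.mapV_vcomp, F.mapV_vid])) ⊚ D.runit (F.mapV x) := by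
  have := F.mu_runit x (by simp)
  simp only [F.mu_eq, F.eta_eq, idc_eq_eqCell, vcompCell_eqCell, eqCell_trans_assoc] at this
  rw [eqCell_comp_eq_iff] at this
  exact this

variable (F : StrictFunctor B D) (G : StrictFunctor C D)

/-- Objects of the pullback of `F` and `G`. -/
@[ext] structure PbObj where
  fst : B.Obj
  snd : C.Obj
  w : F.obj fst = G.obj snd

variable {F G}

/-- Horizontal arrows of the pullback: pairs of arrows with equal images
(compared along the equalities of the images of their end points). -/
@[ext] structure PbHom (p q : PbObj F G) where
  fst : p.fst ⟶ q.fst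
  snd : p.snd ⟶ q.snd
  w : F.map fst ≫ eqToHom q.w = eqToHom p.w ≫ G.map snd

/-- Vertical arrows of the pullback: pairs of vertical arrows with equal images. -/
@[ext] structure PbV (p q : PbObj F G) where
  fst : B.V p.fst q.fst
  snd : C.V p.snd q.snd
  w : HEq (F.mapV fst) (G.mapV snd)

/-- Cells of the pullback: pairs of cells with equal images
(compared along the equalities of the images of their sides). -/
@[ext] structure PbCell {p p' q q' : PbObj F G} (x : PbV p p') (y : PbV q q') where
  fst : B.Cell x.fst y.fst
  snd : C.Cell x.snd y.snd
  w : F.mapCell fst ⊚ eqCell q.w q'.w y.w = eqCell p.w p'.w x.w ⊚ G.mapCell snd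

instance : Category (PbObj F G) where
  Hom := PbHom
  id p := ⟨𝟙 _, 𝟙 _, by simp⟩
  comp f g := ⟨f.fst ≫ g.fst, f.snd ≫ g.snd, by
    rw [F.map_comp, G.map_comp, Category.assoc, g.w, ← Category.assoc, f.w, Category.assoc]⟩
  id_comp f := by apply PbHom.ext <;> simp
  comp_id f := by apply PbHom.ext <;> simp
  assoc f g h := by apply PbHom.ext <;> simp

@[ext] theorem PbHom.hom_ext {p q : PbObj F G} {f g : p ⟶ q} (h₁ : f.fst = g.fst)
    (h₂ : f.snd = g.snd) : f = g := PbHom.ext h₁ h₂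

@[simp] theorem PbHom.id_fst (p : PbObj F G) : PbHom.fst (𝟙 p) = 𝟙 p.fst := rfl
@[simp] theorem PbHom.id_snd (p : PbObj F G) : PbHom.snd (𝟙 p) = 𝟙 p.snd := rfl
@[simp] theorem PbHom.comp_fst {p q r : PbObj F G} (f : p ⟶ q) (g : q ⟶ r) :
    (f ≫ g).fst = f.fst ≫ g.fst := rfl
@[simp] theorem PbHom.comp_snd {p q r : PbObj F G} (f : p ⟶ q) (g : q ⟶ r) :
    (f ≫ g).snd = f.snd ≫ g.snd := rfl

theorem PbCell.top_w {p p' q q' : PbObj F G} {x : PbV p p'} {y : PbV q q'} (α : PbCell x y) :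
    F.map (B.top α.fst) ≫ eqToHom q.w = eqToHom p.w ≫ G.map (C.top α.snd) := by
  have := congrArg D.top α.w
  simpa using this

theorem PbCell.bot_w {p p' q q' : PbObj F G} {x : PbV p p'} {y : PbV q q'} (α : PbCell x y) :
    F.map (B.bot α.fst) ≫ eqToHom q'.w = eqToHom p'.w ≫ G.map (C.bot α.snd) := by
  have := congrArg D.bot α.w
  simpa using this

/-- The condition on cells, solved for one side. -/
theorem PbCell.w' {p p' q q' : PbObj F G} {x : PbV p p'} {y : PbV q q'} (α : PbCell x y) :
    F.mapCell α.fst = eqCell p.w p'.w x.w ⊚ G.mapCell α.snd ⊚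
      eqCell q.w.symm q'.w.symm y.w.symm := by
  have := α.w
  rw [comp_eqCell_eq_iff] at this
  rw [this, D.assoc']

theorem PbV.vcomp_w {p q r : PbObj F G} (x : PbV p q) (y : PbV q r) :
    HEq (F.mapV (x.fst ⊙ y.fst)) (G.mapV (x.snd ⊙ y.snd)) := by
  rw [F.mapV_vcomp, G.mapV_vcomp]
  exact vcomp_heq p.w q.w r.w x.w y.w

theorem PbV.vid_w (p : PbObj F G) :
    HEq (F.mapV (B.vid p.fst)) (G.mapV (C.vid p.snd)) := by
  rw [F.mapV_vid, G.mapV_vid]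
  exact vid_heq p.w

theorem vcompCell_conj {A₀ A₁ A₂ A₀' A₁' A₂' E₀ E₁ E₂ E₀' E₁' E₂' : D.Obj}
    {x : D.V A₀ A₁} {y : D.V A₁ A₂} {x' : D.V A₀' A₁'} {y' : D.V A₁' A₂'}
    {s : D.V E₀ E₁} {t : D.V E₁ E₂} {s' : D.V E₀' E₁'} {t' : D.V E₁' E₂'}
    (e₀ : A₀ = E₀) (e₁ : A₁ = E₁) (e₂ : A₂ = E₂) (e₀' : E₀' = A₀') (e₁' : E₁' = A₁')
    (e₂' : E₂' = A₂') (hx : HEq x s) (hy : HEq y t) (hx' : HEq s' x') (hy' : HEq t' y')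
    (α : D.Cell s s') (β : D.Cell t t') (h : D.bot α = D.top β)
    (h' : D.bot (eqCell e₀ e₁ hx ⊚ α ⊚ eqCell e₀' e₁' hx') =
      D.top (eqCell e₁ e₂ hy ⊚ β ⊚ eqCell e₁' e₂' hy')) :
    D.vcompCell (eqCell e₀ e₁ hx ⊚ α ⊚ eqCell e₀' e₁' hx')
        (eqCell e₁ e₂ hy ⊚ β ⊚ eqCell e₁' e₂' hy') h' =
      eqCell e₀ e₂ (vcomp_heq e₀ e₁ e₂ hx hy) ⊚ D.vcompCell α β h ⊚
        eqCell e₀' e₂' (vcomp_heq e₀' e₁' e₂' hx' hy') := by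
  subst e₀ e₁ e₂ e₀' e₁' e₂'
  cases hx; cases hy; cases hx'; cases hy'
  simp

theorem vidCell_conj {A A' E E' : D.Obj} (e : A = E) (e' : E' = A') (f : E ⟶ E') :
    D.vidCell (eqToHom e ≫ f ≫ eqToHom e') =
      eqCell e e (vid_heq e) ⊚ D.vidCell f ⊚ eqCell e' e' (vid_heq e') := by
  subst e e'; simp

theorem ass_conj {A₁ B₁ C₁ E₁ A₂ B₂ C₂ E₂ : D.Obj} {x₁ : D.V A₁ B₁} {x₂ : D.V A₂ B₂}
    {y₁ : D.V B₁ C₁} {y₂ : D.V B₂ C₂} {t₁ : D.V C₁ E₁} {t₂ : D.V C₂ E₂} (hA : A₁ = A₂)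
    (hB : B₁ = B₂) (hC : C₁ = C₂) (hE : E₁ = E₂) (hx : HEq x₁ x₂) (hy : HEq y₁ y₂)
    (ht : HEq t₁ t₂) :
    D.ass x₁ y₁ t₁ =
      eqCell hA hE (vcomp_heq hA hC hE (vcomp_heq hA hB hC hx hy) ht) ⊚ D.ass x₂ y₂ t₂ ⊚
        eqCell hA.symm hE.symm (vcomp_heq hA hB hE hx (vcomp_heq hB hC hE hy ht)).symm := by
  subst hA hB hC hE; cases hx; cases hy; cases ht; simp

theorem inv_w {A A' A₁ A₁' : B.Obj} {x : B.V A A'} {x₁ : B.V A₁ A₁'} {α : B.Cell x x₁}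
    {αi : B.Cell x₁ x} {E E' E₁ E₁' : C.Obj} {y : C.V E E'} {y₁ : C.V E₁ E₁'} {β : C.Cell y y₁}
    {βi : C.Cell y₁ y} {e : D.Cell (F.mapV x) (G.mapV y)} {e' : D.Cell (F.mapV x₁) (G.mapV y₁)}
    (hα : αi ⊚ α = B.idc _) (hβ : β ⊚ βi = C.idc _)
    (h : F.mapCell α ⊚ e' = e ⊚ G.mapCell β) : F.mapCell αi ⊚ e = e' ⊚ G.mapCell βi := by
  have h₁ : e = e ⊚ G.mapCell β ⊚ G.mapCell βi := by
    rw [← G.mapCell_comp, hβ]; simp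
  rw [h₁, ← D.assoc' e, ← h, D.assoc', ← D.assoc' (F.mapCell αi), ← F.mapCell_comp, hα]
  simp

theorem PbV.ass_w {p q r s : PbObj F G} (x : PbV p q) (y : PbV q r) (t : PbV r s)
    (h₁ : HEq (F.mapV ((x.fst ⊙ y.fst) ⊙ t.fst)) (G.mapV ((x.snd ⊙ y.snd) ⊙ t.snd)))
    (h₂ : HEq (F.mapV (x.fst ⊙ y.fst ⊙ t.fst)) (G.mapV (x.snd ⊙ y.snd ⊙ t.snd))) :
    F.mapCell (B.ass x.fst y.fst t.fst) ⊚ eqCell p.w s.w h₂ =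
      eqCell p.w s.w h₁ ⊚ G.mapCell (C.ass x.snd y.snd t.snd) := by
  rw [F.mapCell_ass, G.mapCell_ass, ass_conj p.w q.w r.w s.w x.w y.w t.w]
  simp

theorem PbV.lunit_w {p q : PbObj F G} (x : PbV p q)
    (h₁ : HEq (F.mapV (B.vid p.fst ⊙ x.fst)) (G.mapV (C.vid p.snd ⊙ x.snd))) :
    F.mapCell (B.lunit x.fst) ⊚ eqCell p.w q.w x.w =
      eqCell p.w q.w h₁ ⊚ G.mapCell (C.lunit x.snd) := by
  rw [F.mapCell_lunit, G.mapCell_lunit, D.assoc',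
    ← eqCell_lunit p.w q.w x.w (vcomp_heq p.w p.w q.w (vid_heq p.w) x.w)]
  simp

theorem PbV.runit_w {p q : PbObj F G} (x : PbV p q)
    (h₁ : HEq (F.mapV (x.fst ⊙ B.vid q.fst)) (G.mapV (x.snd ⊙ C.vid q.snd))) :
    F.mapCell (B.runit x.fst) ⊚ eqCell p.w q.w x.w =
      eqCell p.w q.w h₁ ⊚ G.mapCell (C.runit x.snd) := by
  rw [F.mapCell_runit, G.mapCell_runit, D.assoc',
    ← eqCell_runit p.w q.w x.w (vcomp_heq p.w q.w q.w x.w (vid_heq q.w))]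
  simp

variable (F G)

/-- The pullback of two strict double functors, computed componentwise.  It is the pullback also
among weak double categories with lax functors. -/
@[reducible] def Pb : WeakDbl where
  Obj := PbObj F G
  V := PbV
  Cell := PbCell
  top α := (⟨B.top α.fst, C.top α.snd, α.top_w⟩ : PbHom _ _)
  bot α := (⟨B.bot α.fst, C.bot α.snd, α.bot_w⟩ : PbHom _ _)
  idc x := ⟨B.idc _, C.idc _, by simp⟩
  comp α β := ⟨α.fst ⊚ β.fst, α.snd ⊚ β.snd, by
    rw [F.mapCell_comp, G.mapCell_comp, D.assoc', β.w, ← D.assoc', α.w, D.assoc']⟩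
  id_comp α := by ext <;> simp
  comp_id α := by ext <;> simp
  assoc' α β γ := by ext <;> simp
  top_idc x := by ext <;> simp
  bot_idc x := by ext <;> simp
  top_comp α β := by ext <;> simp
  bot_comp α β := by ext <;> simp
  vid p := ⟨B.vid _, C.vid _, PbV.vid_w p⟩
  vcomp x y := ⟨x.fst ⊙ y.fst, x.snd ⊙ y.snd, x.vcomp_w y⟩
  vidCell {p q} f := ⟨B.vidCell (PbHom.fst f), C.vidCell (PbHom.snd f), by
    have : F.map (PbHom.fst f) = eqToHom p.w ≫ G.map (PbHom.snd f) ≫ eqToHom q.w.symm := by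
      rw [← Category.assoc, ← PbHom.w f]; simp
    rw [F.mapCell_vidCell, G.mapCell_vidCell, this, vidCell_conj]
    simp⟩
  top_vidCell f := by ext <;> simp
  bot_vidCell f := by ext <;> simp
  vidCell_id p := by ext <;> simp
  vidCell_comp f g := by ext <;> simp [WeakDbl.vidCell_comp]
  vcompCell {_ _ _ _ _ _ x y x' y'} α β h :=
    ⟨B.vcompCell α.fst β.fst (congrArg PbHom.fst h),
      C.vcompCell α.snd β.snd (congrArg PbHom.snd h), by
        have h₁ := congrArg PbHom.fst h
        have h₂ := congrArg PbHom.snd h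
        dsimp only at h₁ h₂
        rw [F.mapCell_vcompCell, G.mapCell_vcompCell]
        have := vcompCell_congr (by simp [h₁]) α.w' β.w' (by
          rw [← α.w', ← β.w']; simp [h₁])
        rw [this, vcompCell_conj (h := by simp [h₂])]
        simp⟩
  top_vcompCell α β h := by ext <;> simp
  bot_vcompCell α β h := by ext <;> simp
  vcompCell_id x y h := by ext <;> simp
  vcompCell_comp α α' β β' h h' h'' := by
    ext
    · exact B.vcompCell_comp _ _ _ _ (congrArg PbHom.fst h) (congrArg PbHom.fst h') _
    · exact C.vcompCell_comp _ _ _ _ (congrArg PbHom.snd h) (congrArg PbHom.snd h') _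
  ass x y t := ⟨B.ass _ _ _, C.ass _ _ _, PbV.ass_w x y t _ _⟩
  assInv x y t := ⟨B.assInv _ _ _, C.assInv _ _ _,
    inv_w (B.assInv_ass _ _ _) (C.ass_assInv _ _ _) (PbV.ass_w x y t _ _)⟩
  ass_assInv x y t := by ext <;> simp
  assInv_ass x y t := by ext <;> simp
  top_ass x y t := by ext <;> simp
  bot_ass x y t := by ext <;> simp
  ass_nat α β γ h₁ h₂ h₃ h₄ := by
    ext
    · exact B.ass_nat _ _ _ (congrArg PbHom.fst h₁) (congrArg PbHom.fst h₂)
        (congrArg PbHom.fst h₃) (congrArg PbHom.fst h₄)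
    · exact C.ass_nat _ _ _ (congrArg PbHom.snd h₁) (congrArg PbHom.snd h₂)
        (congrArg PbHom.snd h₃) (congrArg PbHom.snd h₄)
  lunit x := ⟨B.lunit _, C.lunit _, PbV.lunit_w x _⟩
  lunitInv x := ⟨B.lunitInv _, C.lunitInv _,
    inv_w (B.lunitInv_lunit _) (C.lunit_lunitInv _) (PbV.lunit_w x _)⟩
  lunit_lunitInv x := by ext <;> simp
  lunitInv_lunit x := by ext <;> simp
  top_lunit x := by ext <;> simp
  bot_lunit x := by ext <;> simp
  lunit_nat α h := by
    ext
    · exact B.lunit_nat _ (congrArg PbHom.fst h)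
    · exact C.lunit_nat _ (congrArg PbHom.snd h)
  runit x := ⟨B.runit _, C.runit _, PbV.runit_w x _⟩
  runitInv x := ⟨B.runitInv _, C.runitInv _,
    inv_w (B.runitInv_runit _) (C.runit_runitInv _) (PbV.runit_w x _)⟩
  runit_runitInv x := by ext <;> simp
  runitInv_runit x := by ext <;> simp
  top_runit x := by ext <;> simp
  bot_runit x := by ext <;> simp
  runit_nat α h := by
    ext
    · exact B.runit_nat _ (congrArg PbHom.fst h)
    · exact C.runit_nat _ (congrArg PbHom.snd h)
  pentagon x y t s h h' := by
    ext
    · exact B.pentagon _ _ _ _ (congrArg PbHom.fst h) (congrArg PbHom.fst h')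
    · exact C.pentagon _ _ _ _ (congrArg PbHom.snd h) (congrArg PbHom.snd h')
  triangle x y h h' := by
    ext
    · exact B.triangle _ _ (congrArg PbHom.fst h) (congrArg PbHom.fst h')
    · exact C.triangle _ _ (congrArg PbHom.snd h) (congrArg PbHom.snd h')

/-- The first projection of the pullback. -/
@[reducible] def Pb.fst : StrictFunctor (Pb F G) B where
  obj p := PbObj.fst p
  map f := PbHom.fst f
  map_id _ := rfl
  map_comp _ _ := rfl
  mapV x := PbV.fst x
  mapCell α := PbCell.fst α
  top_mapCell _ := rfl
  bot_mapCell _ := rfl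
  mapCell_id _ := rfl
  mapCell_comp _ _ := rfl
  eta _ := B.idc _
  mu _ _ := B.idc _
  top_eta _ := by simp
  bot_eta _ := by simp
  top_mu _ _ := by simp
  bot_mu _ _ := by simp
  eta_nat _ := by simp
  mu_nat _ _ _ _ := by simp
  mu_ass _ _ _ _ _ := by simp
  mu_lunit _ _ := by simp
  mu_runit _ _ := by simp
  eta_id _ := ⟨rfl, rfl, HEq.rfl, rfl⟩
  mu_id _ _ := ⟨rfl, rfl, HEq.rfl, rfl⟩

/-- The second projection of the pullback. -/
@[reducible] def Pb.snd : StrictFunctor (Pb F G) C where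
  obj p := PbObj.snd p
  map f := PbHom.snd f
  map_id _ := rfl
  map_comp _ _ := rfl
  mapV x := PbV.snd x
  mapCell α := PbCell.snd α
  top_mapCell _ := rfl
  bot_mapCell _ := rfl
  mapCell_id _ := rfl
  mapCell_comp _ _ := rfl
  eta _ := C.idc _
  mu _ _ := C.idc _
  top_eta _ := by simp
  bot_eta _ := by simp
  top_mu _ _ := by simp
  bot_mu _ _ := by simp
  eta_nat _ := by simp
  mu_nat _ _ _ _ := by simp
  mu_ass _ _ _ _ _ := by simp
  mu_lunit _ _ := by simp
  mu_runit _ _ := by simp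
  eta_id _ := ⟨rfl, rfl, HEq.rfl, rfl⟩
  mu_id _ _ := ⟨rfl, rfl, HEq.rfl, rfl⟩

variable {F G}

theorem LaxFunctor.obj_eq {H L : LaxFunctor X D} (h : H = L) (A : X.Obj) : H.obj A = L.obj A := by
  rw [h]

theorem LaxFunctor.map_eq {H L : LaxFunctor X D} (h : H = L) {A A' : X.Obj} (f : A ⟶ A') :
    H.map f ≫ eqToHom (LaxFunctor.obj_eq h A') =
      eqToHom (LaxFunctor.obj_eq h A) ≫ L.map f := by
  subst h; simp

theorem LaxFunctor.mapV_heq_of_eq {H L : LaxFunctor X D} (h : H = L) {A A' : X.Obj}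
    (x : X.V A A') : HEq (H.mapV x) (L.mapV x) := by
  rw [h]

theorem LaxFunctor.mapCell_eq {H L : LaxFunctor X D} (h : H = L) {A A' A₁ A₁' : X.Obj}
    {x : X.V A A'} {y : X.V A₁ A₁'} (α : X.Cell x y) :
    H.mapCell α ⊚ eqCell (LaxFunctor.obj_eq h A₁) (LaxFunctor.obj_eq h A₁')
        (LaxFunctor.mapV_heq_of_eq h y) =
      eqCell (LaxFunctor.obj_eq h A) (LaxFunctor.obj_eq h A') (LaxFunctor.mapV_heq_of_eq h x) ⊚
        L.mapCell α := by
  subst h; simp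

theorem LaxFunctor.eta_eq_of_eq {H L : LaxFunctor X D} (h : H = L) (A : X.Obj) :
    H.eta A ⊚ eqCell (LaxFunctor.obj_eq h A) (LaxFunctor.obj_eq h A)
        (LaxFunctor.mapV_heq_of_eq h _) =
      eqCell (LaxFunctor.obj_eq h A) (LaxFunctor.obj_eq h A)
        (vid_heq (LaxFunctor.obj_eq h A)) ⊚ L.eta A := by
  subst h; simp

theorem LaxFunctor.mu_eq_of_eq {H L : LaxFunctor X D} (h : H = L) {A₀ A₁ A₂ : X.Obj}
    (x : X.V A₀ A₁) (y : X.V A₁ A₂) :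
    H.mu x y ⊚ eqCell (LaxFunctor.obj_eq h A₀) (LaxFunctor.obj_eq h A₂)
        (LaxFunctor.mapV_heq_of_eq h _) =
      eqCell (LaxFunctor.obj_eq h A₀) (LaxFunctor.obj_eq h A₂)
        (vcomp_heq (LaxFunctor.obj_eq h A₀) (LaxFunctor.obj_eq h A₁) (LaxFunctor.obj_eq h A₂)
          (LaxFunctor.mapV_heq_of_eq h x) (LaxFunctor.mapV_heq_of_eq h y)) ⊚ L.mu x y := by
  subst h; simp

/-- The lax functor into a pullback with given components. -/
@[reducible] def Pb.lift (H : LaxFunctor X B) (L : LaxFunctor X C)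
    (h : H.comp F.toLaxFunctor = L.comp G.toLaxFunctor) : LaxFunctor X (Pb F G) where
  obj A := (⟨H.obj A, L.obj A, LaxFunctor.obj_eq h A⟩ : PbObj F G)
  map f := (⟨H.map f, L.map f, LaxFunctor.map_eq h f⟩ : PbHom _ _)
  map_id _ := by ext <;> simp
  map_comp _ _ := by ext <;> simp
  mapV x := (⟨H.mapV x, L.mapV x, LaxFunctor.mapV_heq_of_eq h x⟩ : PbV _ _)
  mapCell α := (⟨H.mapCell α, L.mapCell α, LaxFunctor.mapCell_eq h α⟩ : PbCell _ _)
  top_mapCell _ := by apply PbHom.ext <;> simp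
  bot_mapCell _ := by apply PbHom.ext <;> simp
  mapCell_id _ := by apply PbCell.ext <;> simp
  mapCell_comp _ _ := by apply PbCell.ext <;> simp
  eta A := (⟨H.eta A, L.eta A, by
    have := LaxFunctor.eta_eq_of_eq h A
    simp only [LaxFunctor.comp, F.eta_eq, G.eta_eq, D.assoc', eqCell_trans_assoc] at this
    rw [eqCell_comp_eq_iff] at this
    rw [this]
    simp⟩ : PbCell _ _)
  mu x y := (⟨H.mu x y, L.mu x y, by
    have := LaxFunctor.mu_eq_of_eq h x y
    simp only [LaxFunctor.comp, F.mu_eq, G.mu_eq, D.assoc', eqCell_trans_assoc] at this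
    rw [eqCell_comp_eq_iff] at this
    rw [this]
    simp⟩ : PbCell _ _)
  top_eta _ := by apply PbHom.ext <;> simp
  bot_eta _ := by apply PbHom.ext <;> simp
  top_mu _ _ := by apply PbHom.ext <;> simp
  bot_mu _ _ := by apply PbHom.ext <;> simp
  eta_nat f := by
    apply PbCell.ext
    · exact H.eta_nat f
    · exact L.eta_nat f
  mu_nat α β e e' := by
    apply PbCell.ext
    · exact H.mu_nat α β e _
    · exact L.mu_nat α β e _
  mu_ass x y t e e' := by
    apply PbCell.ext
    · exact H.mu_ass x y t _ _
    · exact L.mu_ass x y t _ _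
  mu_lunit x e := by
    apply PbCell.ext
    · exact H.mu_lunit x _
    · exact L.mu_lunit x _
  mu_runit x e := by
    apply PbCell.ext
    · exact H.mu_runit x _
    · exact L.mu_runit x _

theorem Pb.lift_fst (H : LaxFunctor X B) (L : LaxFunctor X C)
    (h : H.comp F.toLaxFunctor = L.comp G.toLaxFunctor) :
    (Pb.lift H L h).comp (Pb.fst F G).toLaxFunctor = H := by
  refine LaxFunctor.ext_of rfl (heq_of_eq ?_) (heq_of_eq ?_)
  · funext A
    exact B.id_comp _
  · funext A₀ A₁ A₂ x y
    exact B.id_comp _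

theorem Pb.lift_snd (H : LaxFunctor X B) (L : LaxFunctor X C)
    (h : H.comp F.toLaxFunctor = L.comp G.toLaxFunctor) :
    (Pb.lift H L h).comp (Pb.snd F G).toLaxFunctor = L := by
  refine LaxFunctor.ext_of rfl (heq_of_eq ?_) (heq_of_eq ?_)
  · funext A
    exact C.id_comp _
  · funext A₀ A₁ A₂ x y
    exact C.id_comp _

theorem LaxFunctor.ext_full {H L : LaxFunctor X D} (ho : ∀ A, H.obj A = L.obj A)
    (hm : ∀ {A A' : X.Obj} (f : A ⟶ A'), H.map f ≫ eqToHom (ho A') = eqToHom (ho A) ≫ L.map f)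
    (hV : ∀ {A A' : X.Obj} (x : X.V A A'), HEq (H.mapV x) (L.mapV x))
    (hc : ∀ {A A' A₁ A₁' : X.Obj} {x : X.V A A'} {y : X.V A₁ A₁'} (α : X.Cell x y),
      H.mapCell α ⊚ eqCell (ho _) (ho _) (hV y) = eqCell (ho _) (ho _) (hV x) ⊚ L.mapCell α)
    (he : ∀ A, H.eta A ⊚ eqCell (ho _) (ho _) (hV _) =
      eqCell (ho _) (ho _) (vid_heq (ho A)) ⊚ L.eta A)
    (hu : ∀ {A₀ A₁ A₂ : X.Obj} (x : X.V A₀ A₁) (y : X.V A₁ A₂),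
      H.mu x y ⊚ eqCell (ho _) (ho _) (hV _) =
        eqCell (ho _) (ho _) (vcomp_heq (ho _) (ho _) (ho _) (hV x) (hV y)) ⊚ L.mu x y) :
    H = L := by
  obtain ⟨⟨obj, map, map_id, map_comp, mapV, mapCell, _, _, _, _⟩, eta, mu, _, _, _, _, _, _, _,
    _, _⟩ := H
  obtain ⟨⟨obj', map', map_id', map_comp', mapV', mapCell', _, _, _, _⟩, eta', mu', _, _, _, _,
    _, _, _, _, _⟩ := L
  dsimp only at ho hm hV hc he hu
  obtain rfl : obj = obj' := funext ho
  obtain rfl : @map = @map' := by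
    funext A A' f
    simpa using hm f
  obtain rfl : @mapV = @mapV' := by
    funext A A' x
    exact eq_of_heq (hV x)
  obtain rfl : @mapCell = @mapCell' := by
    funext A A' A₁ A₁' x y α
    simpa using hc α
  obtain rfl : eta = eta' := by
    funext A
    simpa using he A
  obtain rfl : @mu = @mu' := by
    funext A₀ A₁ A₂ x y
    simpa using hu x y
  rfl

theorem Pb.condition :
    (Pb.fst F G).toLaxFunctor.comp F.toLaxFunctor =
      (Pb.snd F G).toLaxFunctor.comp G.toLaxFunctor := by
  refine LaxFunctor.ext_full (fun p => PbObj.w p) (fun f => PbHom.w f) (fun x => PbV.w x)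
    (fun α => PbCell.w α) (fun p => ?_) (fun x y => ?_)
  · simp [F.eta_eq, G.eta_eq]
  · simp [F.mu_eq, G.mu_eq]

end Pullback

/-! ### Pseudocategories in the 2-category of weak double categories and lax functors -/

section Pseudocategory

universe u₁ v₁ w₁ z₁ u₀ v₀ w₀ z₀ u v w z

open WeakDbl

/-- The underlying diagram of a pseudocategory in the 2-category of weak double categories, lax
functors and horizontal transformations:  strict double functors `src`, `tgt` from `D₁`
(the arrows) to `D₀` (the objects), a lax functor `unit` giving identities, and a lax functor `mul`
giving composites of the pairs in the pullback of `tgt` and `src`,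
with the strict equations for the domains and codomains of identities and composites. -/
structure LxPrecategory (D₁ : WeakDbl.{u₁, v₁, w₁, z₁}) (D₀ : WeakDbl.{u₀, v₀, w₀, z₀}) where
  src : StrictFunctor D₁ D₀
  tgt : StrictFunctor D₁ D₀
  unit : LaxFunctor D₀ D₁
  mul : LaxFunctor (Pb tgt src) D₁
  unit_src : unit.comp src.toLaxFunctor = LaxFunctor.id D₀
  unit_tgt : unit.comp tgt.toLaxFunctor = LaxFunctor.id D₀
  mul_src : mul.comp src.toLaxFunctor = (Pb.fst tgt src).toLaxFunctor.comp src.toLaxFunctor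
  mul_tgt : mul.comp tgt.toLaxFunctor = (Pb.snd tgt src).toLaxFunctor.comp tgt.toLaxFunctor

namespace LxPrecategory

variable {D₁ : WeakDbl.{u₁, v₁, w₁, z₁}} {D₀ : WeakDbl.{u₀, v₀, w₀, z₀}}
  (X : LxPrecategory D₁ D₀)

/-- composable pairs `(x, y)` -/
abbrev C₂ : WeakDbl := Pb X.tgt X.src

/-- composable triples `((x, y), z)` -/
abbrev C₃ : WeakDbl := Pb ((Pb.snd X.tgt X.src).comp X.tgt) X.src

/-- composable quadruples `(((x, y), z), w)` -/
abbrev C₄ : WeakDbl :=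
  Pb ((Pb.snd ((Pb.snd X.tgt X.src).comp X.tgt) X.src).comp X.tgt) X.src

/-- `(x, y) ↦ x` -/
abbrev fst₂ : LaxFunctor X.C₂ D₁ := (Pb.fst X.tgt X.src).toLaxFunctor
/-- `(x, y) ↦ y` -/
abbrev snd₂ : LaxFunctor X.C₂ D₁ := (Pb.snd X.tgt X.src).toLaxFunctor
/-- `((x, y), z) ↦ (x, y)` -/
abbrev init₃ : LaxFunctor X.C₃ X.C₂ := (Pb.fst _ X.src).toLaxFunctor
/-- `((x, y), z) ↦ z` -/
abbrev last₃ : LaxFunctor X.C₃ D₁ := (Pb.snd _ X.src).toLaxFunctor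
/-- `(((x, y), z), w) ↦ ((x, y), z)` -/
abbrev init₄ : LaxFunctor X.C₄ X.C₃ := (Pb.fst _ X.src).toLaxFunctor
/-- `(((x, y), z), w) ↦ w` -/
abbrev last₄ : LaxFunctor X.C₄ D₁ := (Pb.snd _ X.src).toLaxFunctor

theorem comp_mul_src {K : WeakDbl.{u, v, w, z}} (L : LaxFunctor K X.C₂) :
    (L.comp X.mul).comp X.src.toLaxFunctor = (L.comp X.fst₂).comp X.src.toLaxFunctor := by
  rw [LaxFunctor.comp_assoc, X.mul_src, LaxFunctor.comp_assoc]

theorem comp_mul_tgt {K : WeakDbl.{u, v, w, z}} (L : LaxFunctor K X.C₂) :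
    (L.comp X.mul).comp X.tgt.toLaxFunctor = (L.comp X.snd₂).comp X.tgt.toLaxFunctor := by
  rw [LaxFunctor.comp_assoc, X.mul_tgt, LaxFunctor.comp_assoc]

theorem condition₂ : X.fst₂.comp X.tgt.toLaxFunctor = X.snd₂.comp X.src.toLaxFunctor :=
  Pb.condition

theorem comp_snd_tgt {K : WeakDbl.{u, v, w, z}} {L : LaxFunctor K X.C₂} {M : LaxFunctor K D₁}
    (h : L.comp X.snd₂ = M) :
    L.comp ((Pb.snd X.tgt X.src).comp X.tgt).toLaxFunctor = M.comp X.tgt.toLaxFunctor := by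
  rw [← h, LaxFunctor.comp_assoc]
  rfl

theorem comp_last_tgt {K : WeakDbl.{u, v, w, z}} {L : LaxFunctor K X.C₃} {M : LaxFunctor K D₁}
    (h : L.comp X.last₃ = M) :
    L.comp ((Pb.snd ((Pb.snd X.tgt X.src).comp X.tgt) X.src).comp X.tgt).toLaxFunctor =
      M.comp X.tgt.toLaxFunctor := by
  rw [← h, LaxFunctor.comp_assoc]
  rfl

theorem condition₃ : (X.init₃.comp X.snd₂).comp X.tgt.toLaxFunctor =
    X.last₃.comp X.src.toLaxFunctor :=
  (LaxFunctor.comp_assoc _ _ _).trans Pb.condition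

theorem condition₄ : (X.init₄.comp X.last₃).comp X.tgt.toLaxFunctor =
    X.last₄.comp X.src.toLaxFunctor :=
  (LaxFunctor.comp_assoc _ _ _).trans Pb.condition

/-- `((x, y), z) ↦ (y, z)` -/
@[reducible] def tail₃ : LaxFunctor X.C₃ X.C₂ :=
  Pb.lift (X.init₃.comp X.snd₂) X.last₃ X.condition₃

/-- `((x, y), z) ↦ (x ∘ y, z)` -/
@[reducible] def mulL : LaxFunctor X.C₃ X.C₂ :=
  Pb.lift (X.init₃.comp X.mul) X.last₃ (by rw [X.comp_mul_tgt]; exact X.condition₃)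

/-- `((x, y), z) ↦ (x, y ∘ z)` -/
@[reducible] def mulR : LaxFunctor X.C₃ X.C₂ :=
  Pb.lift (X.init₃.comp X.fst₂) (X.tail₃.comp X.mul) (by
    rw [X.comp_mul_src, Pb.lift_fst, LaxFunctor.comp_assoc, X.condition₂,
      LaxFunctor.comp_assoc])

/-- `x ↦ (id, x)` -/
@[reducible] def unitL : LaxFunctor D₁ X.C₂ :=
  Pb.lift (X.src.toLaxFunctor.comp X.unit) (LaxFunctor.id D₁) (by
    rw [LaxFunctor.comp_assoc, X.unit_tgt, LaxFunctor.comp_id, LaxFunctor.id_comp])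

/-- `x ↦ (x, id)` -/
@[reducible] def unitR : LaxFunctor D₁ X.C₂ :=
  Pb.lift (LaxFunctor.id D₁) (X.tgt.toLaxFunctor.comp X.unit) (by
    rw [LaxFunctor.comp_assoc, X.unit_src, LaxFunctor.comp_id, LaxFunctor.id_comp])

/-- `(((x, y), z), w) ↦ ((y, z), w)` -/
@[reducible] def tail₄ : LaxFunctor X.C₄ X.C₃ :=
  Pb.lift (X.init₄.comp X.tail₃) X.last₄ (
    (X.comp_snd_tgt (by rw [LaxFunctor.comp_assoc, Pb.lift_snd])).trans X.condition₄)

/-- `(((x, y), z), w) ↦ ((x ∘ y, z), w)` -/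
@[reducible] def mul₁₂ : LaxFunctor X.C₄ X.C₃ :=
  Pb.lift (X.init₄.comp X.mulL) X.last₄ (
    (X.comp_snd_tgt (by rw [LaxFunctor.comp_assoc, Pb.lift_snd])).trans X.condition₄)

/-- `(((x, y), z), w) ↦ ((x, y ∘ z), w)` -/
@[reducible] def mul₂₃ : LaxFunctor X.C₄ X.C₃ :=
  Pb.lift (X.init₄.comp X.mulR) X.last₄ (by
    rw [X.comp_snd_tgt (M := (X.init₄.comp X.tail₃).comp X.mul)
      (by rw [LaxFunctor.comp_assoc, Pb.lift_snd, LaxFunctor.comp_assoc]), X.comp_mul_tgt,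
      LaxFunctor.comp_assoc _ X.tail₃, Pb.lift_snd]
    exact X.condition₄)

/-- `(((x, y), z), w) ↦ ((x, y), z ∘ w)` -/
@[reducible] def mul₃₄ : LaxFunctor X.C₄ X.C₃ :=
  Pb.lift (X.init₄.comp X.init₃)
    ((Pb.lift (X.init₄.comp X.last₃) X.last₄ X.condition₄ : LaxFunctor X.C₄ X.C₂).comp X.mul) (by
    rw [X.comp_mul_src, Pb.lift_fst, X.comp_snd_tgt rfl, LaxFunctor.comp_assoc X.init₄,
      LaxFunctor.comp_assoc X.init₄, LaxFunctor.comp_assoc X.init₄, X.condition₃])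

/-- `(x, y) ↦ ((x, id), y)` -/
@[reducible] def ins : LaxFunctor X.C₂ X.C₃ :=
  Pb.lift (Pb.lift X.fst₂ (X.snd₂.comp (X.src.toLaxFunctor.comp X.unit)) (by
    rw [LaxFunctor.comp_assoc, LaxFunctor.comp_assoc, X.unit_src, LaxFunctor.comp_id,
      X.condition₂])) X.snd₂ (by
    rw [X.comp_snd_tgt (Pb.lift_snd _ _ _), LaxFunctor.comp_assoc, LaxFunctor.comp_assoc,
      X.unit_tgt, LaxFunctor.comp_id])

end LxPrecategory

variable {D₁ : WeakDbl.{u₁, v₁, w₁, z₁}} {D₀ : WeakDbl.{u₀, v₀, w₀, z₀}}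

theorem IsIdHom_w {A B A' B' : D₀.Obj} {f : A ⟶ B} {g : A' ⟶ B'} (hf : IsIdHom f)
    (hg : IsIdHom g) (h : A = A') (h' : B = B') : f ≫ eqToHom h' = eqToHom h ≫ g := by
  obtain ⟨_, rfl⟩ := hf
  obtain ⟨_, rfl⟩ := hg
  simp

theorem IsIdCell_w {A A' B B' E E' F F' : D₀.Obj} {x : D₀.V A A'} {y : D₀.V B B'}
    {s : D₀.V E E'} {t : D₀.V F F'} {α : D₀.Cell x y} {β : D₀.Cell s t} (hα : IsIdCell α)
    (hβ : IsIdCell β) (hA : A = E) (hA' : A' = E') (h : HEq x s) (hB : B = F) (hB' : B' = F')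
    (h' : HEq y t) : α ⊚ eqCell hB hB' h' = eqCell hA hA' h ⊚ β := by
  obtain ⟨_, _, _, rfl⟩ := hα
  obtain ⟨_, _, _, rfl⟩ := hβ
  simp

theorem IsIdHom_id (A : D₀.Obj) : IsIdHom (𝟙 A) := ⟨rfl, rfl⟩

theorem IsIdCell_id {A A' : D₀.Obj} (x : D₀.V A A') : IsIdCell (D₀.idc x) :=
  ⟨rfl, rfl, HEq.rfl, rfl⟩

theorem IsIdHom_eqToHom {A B : D₀.Obj} (h : A = B) : IsIdHom (eqToHom h) := ⟨h, rfl⟩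

theorem IsIdHom_comp {A B C : D₀.Obj} {f : A ⟶ B} {g : B ⟶ C} (hf : IsIdHom f)
    (hg : IsIdHom g) : IsIdHom (f ≫ g) := by
  obtain ⟨h, rfl⟩ := hf
  obtain ⟨h', rfl⟩ := hg
  exact ⟨h.trans h', by simp⟩

theorem PreFunctor.map_isIdHom (G : PreFunctor D₁ D₀) {A B : D₁.Obj} {f : A ⟶ B}
    (hf : IsIdHom f) : IsIdHom (G.map f) := by
  obtain ⟨h, rfl⟩ := hf
  exact ⟨_, G.map_eqToHom h⟩

theorem LaxFunctor.isIdHom_of_eq {H L : LaxFunctor D₁ D₀} (h : H = L) {A A' : D₁.Obj}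
    {f : A ⟶ A'} (hf : IsIdHom (L.map f)) : IsIdHom (H.map f) := by
  rw [h]; exact hf

theorem LaxFunctor.isIdCell_of_eq {H L : LaxFunctor D₁ D₀} (h : H = L) {A A' B B' : D₁.Obj}
    {x : D₁.V A A'} {y : D₁.V B B'} {α : D₁.Cell x y} (hα : IsIdCell (L.mapCell α)) :
    IsIdCell (H.mapCell α) := by
  rw [h]; exact hα

namespace LxPrecategory

/-- An arrow of composable pairs from two arrows lying over identities. -/
@[reducible] def pairHom (X : LxPrecategory D₁ D₀) {p q : X.C₂.Obj} (f : X.fst₂.obj p ⟶ X.fst₂.obj q)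
    (g : X.snd₂.obj p ⟶ X.snd₂.obj q) (hf : IsIdHom (X.tgt.map f))
    (hg : IsIdHom (X.src.map g)) : p ⟶ q :=
  (⟨f, g, IsIdHom_w hf hg _ _⟩ : PbHom p q)

/-- A cell of composable pairs from two cells lying over identities. -/
@[reducible] def pairCell (X : LxPrecategory D₁ D₀) {p p' q q' : X.C₂.Obj} {x : X.C₂.V p p'}
    {y : X.C₂.V q q'} (α : D₁.Cell (X.fst₂.mapV x) (X.fst₂.mapV y))
    (β : D₁.Cell (X.snd₂.mapV x) (X.snd₂.mapV y)) (hα : IsIdCell (X.tgt.mapCell α))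
    (hβ : IsIdCell (X.src.mapCell β)) : X.C₂.Cell x y :=
  (⟨α, β, IsIdCell_w hα hβ _ _ _ _ _ _⟩ : PbCell x y)

end LxPrecategory

/-- The constraint transformations of a pseudocategory, over identities of `D₀`. -/
structure LxConstraints (X : LxPrecategory D₁ D₀) where
  /-- `(x ∘ y) ∘ z ⟶ x ∘ (y ∘ z)` -/
  assoc : HTrans (X.mulL.comp X.mul) (X.mulR.comp X.mul)
  /-- `id ∘ x ⟶ x` -/
  left : HTrans (X.unitL.comp X.mul) (LaxFunctor.id D₁)
  /-- `x ∘ id ⟶ x` -/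
  right : HTrans (X.unitR.comp X.mul) (LaxFunctor.id D₁)
  assoc_inv : assoc.Invertible
  left_inv : left.Invertible
  right_inv : right.Invertible
  src_assoc : ∀ p, IsIdHom (X.src.map (assoc.app p))
  tgt_assoc : ∀ p, IsIdHom (X.tgt.map (assoc.app p))
  src_assoc_cell : ∀ {p q} (x : X.C₃.V p q), IsIdCell (X.src.mapCell (assoc.cell x))
  tgt_assoc_cell : ∀ {p q} (x : X.C₃.V p q), IsIdCell (X.tgt.mapCell (assoc.cell x))
  src_left : ∀ p, IsIdHom (X.src.map (left.app p))
  tgt_left : ∀ p, IsIdHom (X.tgt.map (left.app p))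
  src_left_cell : ∀ {p q} (x : D₁.V p q), IsIdCell (X.src.mapCell (left.cell x))
  tgt_left_cell : ∀ {p q} (x : D₁.V p q), IsIdCell (X.tgt.mapCell (left.cell x))
  src_right : ∀ p, IsIdHom (X.src.map (right.app p))
  tgt_right : ∀ p, IsIdHom (X.tgt.map (right.app p))
  src_right_cell : ∀ {p q} (x : D₁.V p q), IsIdCell (X.src.mapCell (right.cell x))
  tgt_right_cell : ∀ {p q} (x : D₁.V p q), IsIdCell (X.tgt.mapCell (right.cell x))

namespace LxConstraints

variable {X : LxPrecategory D₁ D₀} (c : LxConstraints X)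

/-- the arrow `(assoc, 1) : ((x ∘ y) ∘ z, w) ⟶ (x ∘ (y ∘ z), w)` of composable pairs -/
@[reducible] def assocOne (p : X.C₄.Obj) :
    (X.mul₁₂.comp X.mulL).obj p ⟶ (X.mul₂₃.comp X.mulL).obj p :=
  X.pairHom (c.assoc.app (X.init₄.obj p)) (𝟙 (X.last₄.obj p)) (c.tgt_assoc _)
    (X.src.map_isIdHom (IsIdHom_id _))

/-- the arrow `(1, assoc) : (x, (y ∘ z) ∘ w) ⟶ (x, y ∘ (z ∘ w))` of composable pairs -/
@[reducible] def oneAssoc (p : X.C₄.Obj) :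
    (X.mul₂₃.comp X.mulR).obj p ⟶ (X.mul₃₄.comp X.mulR).obj p :=
  X.pairHom (𝟙 (X.fst₂.obj (X.init₃.obj (X.init₄.obj p)))) (c.assoc.app (X.tail₄.obj p))
    (X.tgt.map_isIdHom (IsIdHom_id _)) (c.src_assoc _)

/-- the cell `(assoc, 1)` -/
@[reducible] def assocOneCell {p q : X.C₄.Obj} (x : X.C₄.V p q) :
    X.C₂.Cell ((X.mul₁₂.comp X.mulL).mapV x) ((X.mul₂₃.comp X.mulL).mapV x) :=
  X.pairCell (c.assoc.cell (X.init₄.mapV x)) (D₁.idc (X.last₄.mapV x)) (c.tgt_assoc_cell _)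
    (X.src.map_isIdCell (IsIdCell_id _))

/-- the cell `(1, assoc)` -/
@[reducible] def oneAssocCell {p q : X.C₄.Obj} (x : X.C₄.V p q) :
    X.C₂.Cell ((X.mul₂₃.comp X.mulR).mapV x) ((X.mul₃₄.comp X.mulR).mapV x) :=
  X.pairCell (D₁.idc (X.fst₂.mapV (X.init₃.mapV (X.init₄.mapV x))))
    (c.assoc.cell (X.tail₄.mapV x)) (X.tgt.map_isIdCell (IsIdCell_id _)) (c.src_assoc_cell _)

/-- the arrow `(1, left) : (x, id ∘ y) ⟶ (x, y)` of composable pairs -/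
@[reducible] def oneLeft (p : X.C₂.Obj) : (X.ins.comp X.mulR).obj p ⟶ p :=
  X.pairHom (𝟙 (X.fst₂.obj p)) (c.left.app (X.snd₂.obj p)) (X.tgt.map_isIdHom (IsIdHom_id _))
    (c.src_left _)

/-- the cell `(1, left)` -/
@[reducible] def oneLeftCell {p q : X.C₂.Obj} (x : X.C₂.V p q) :
    X.C₂.Cell ((X.ins.comp X.mulR).mapV x) x :=
  X.pairCell (D₁.idc (X.fst₂.mapV x)) (c.left.cell (X.snd₂.mapV x))
    (X.tgt.map_isIdCell (IsIdCell_id _)) (c.src_left_cell _)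

end LxConstraints

/-- For a composable pair `(x, y)`, the identity arrow `(x, id_(src y)) = (x, id_(tgt x))`. -/
@[reducible] def LxPrecategory.swapUnit (X : LxPrecategory D₁ D₀) (p : X.C₂.Obj) :
    (X.ins.comp X.init₃).obj p ⟶ (X.fst₂.comp X.unitR).obj p :=
  X.pairHom (𝟙 (X.fst₂.obj p)) (X.unit.map (eqToHom p.w.symm))
    (X.tgt.map_isIdHom (IsIdHom_id _))
    (X.src.map_isIdHom (X.unit.map_isIdHom (IsIdHom_eqToHom _)))

/-- The identity cell corresponding to `swapUnit`. -/
@[reducible] def LxPrecategory.swapUnitCell (X : LxPrecategory D₁ D₀) {p q : X.C₂.Obj}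
    (x : X.C₂.V p q) :
    X.C₂.Cell ((X.ins.comp X.init₃).mapV x) ((X.fst₂.comp X.unitR).mapV x) :=
  X.pairCell (D₁.idc (X.fst₂.mapV x)) (X.unit.mapCell (eqCell p.w.symm q.w.symm x.w.symm))
    (X.tgt.map_isIdCell (IsIdCell_id _))
    (X.src.map_isIdCell (X.unit.map_isIdCell ⟨_, _, _, rfl⟩))

namespace LxConstraints

variable {X : LxPrecategory D₁ D₀} (c : LxConstraints X)

/-- the arrow `(right, 1) : (x ∘ id, y) ⟶ (x, y)` of composable pairs -/
@[reducible] def rightOne (p : X.C₂.Obj) : (X.ins.comp X.mulL).obj p ⟶ p :=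
  X.pairHom (p := (X.ins.comp X.mulL).obj p) (q := p)
    (X.mul.map (X.swapUnit p) ≫ c.right.app (X.fst₂.obj p)) (𝟙 (X.snd₂.obj p)) (by
      rw [X.tgt.map_comp]
      exact IsIdHom_comp (LaxFunctor.isIdHom_of_eq X.mul_tgt
        (X.tgt.map_isIdHom (X.unit.map_isIdHom (IsIdHom_eqToHom _)))) (c.tgt_right _))
    (X.src.map_isIdHom (IsIdHom_id _))

/-- the cell `(right, 1)` -/
@[reducible] def rightOneCell {p q : X.C₂.Obj} (x : X.C₂.V p q) :
    X.C₂.Cell ((X.ins.comp X.mulL).mapV x) x :=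
  X.pairCell (x := (X.ins.comp X.mulL).mapV x) (y := x)
    (X.mul.mapCell (X.swapUnitCell x) ⊚ c.right.cell (X.fst₂.mapV x))
    (D₁.idc (X.snd₂.mapV x)) (by
      rw [X.tgt.mapCell_comp]
      exact IsIdCell_comp (LaxFunctor.isIdCell_of_eq X.mul_tgt
        (X.tgt.map_isIdCell (X.unit.map_isIdCell ⟨_, _, _, rfl⟩))) (c.tgt_right_cell _))
    (X.src.map_isIdCell (IsIdCell_id _))

end LxConstraints

/-- A pseudocategory structure on `X` in the 2-category of weak double categories, lax functors
and horizontal transformations: constraints satisfying the pentagon and the triangle equation,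
both on arrows and on cells. -/
structure LxPseudocategory (X : LxPrecategory D₁ D₀) extends LxConstraints X where
  pentagon : ∀ p : X.C₄.Obj,
    X.mul.map (toLxConstraints.assocOne p) ≫ assoc.app (X.mul₂₃.obj p) ≫
        X.mul.map (toLxConstraints.oneAssoc p) =
      assoc.app (X.mul₁₂.obj p) ≫ assoc.app (X.mul₃₄.obj p)
  pentagon_cell : ∀ {p q : X.C₄.Obj} (x : X.C₄.V p q),
    X.mul.mapCell (toLxConstraints.assocOneCell x) ⊚ assoc.cell (X.mul₂₃.mapV x) ⊚
        X.mul.mapCell (toLxConstraints.oneAssocCell x) =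
      assoc.cell (X.mul₁₂.mapV x) ⊚ assoc.cell (X.mul₃₄.mapV x)
  triangle : ∀ p : X.C₂.Obj,
    assoc.app (X.ins.obj p) ≫ X.mul.map (toLxConstraints.oneLeft p) =
      X.mul.map (toLxConstraints.rightOne p)
  triangle_cell : ∀ {p q : X.C₂.Obj} (x : X.C₂.V p q),
    assoc.cell (X.ins.mapV x) ⊚ X.mul.mapCell (toLxConstraints.oneLeftCell x) =
      X.mul.mapCell (toLxConstraints.rightOneCell x)

end Pseudocategory

/-! ### Lax choices of 1-dimensional pullbacks -/

section Pullbacks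

universe u v w z

/-- The category `A₁` of vertical arrows and cells (with horizontal composition). -/
structure VArr (A : WeakDbl.{u, v, w, z}) where
  {dom : A.Obj}
  {cod : A.Obj}
  arr : A.V dom cod

instance (A : WeakDbl.{u, v, w, z}) : Category (VArr A) where
  Hom x y := A.Cell x.arr y.arr
  id x := A.idc x.arr
  comp α β := α ⊚ β
  id_comp _ := by simp
  comp_id _ := by simp
  assoc _ _ _ := by simp

/-- A cell as an arrow of the category `A₁`. -/
def VArr.hom {A : WeakDbl.{u, v, w, z}} {B B' C C' : A.Obj} {x : A.V B B'} {y : A.V C C'}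
    (α : A.Cell x y) : VArr.mk x ⟶ VArr.mk y := α

/-- A lax choice of 1-dimensional pullbacks in a weak double category `A`: chosen pullbacks
in the category `A₀` of objects and horizontal arrows and in the category `A₁` of vertical
arrows and cells, such that the domain and codomain functors `A₁ ⟶ A₀` preserve the choices.
Nothing is required about vertical identities and vertical composition.

The pullback of cells `α`, `β` whose tops are `f`, `g` and whose bottoms are `f'`, `g'` goes from
the chosen pullback of `f`, `g` to that of `f'`, `g'`. -/
structure LaxPullbackChoice (A : WeakDbl.{u, v, w, z}) where
  pb : ∀ {B C D : A.Obj} (_ : B ⟶ D) (_ : C ⟶ D), A.Obj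
  fst : ∀ {B C D : A.Obj} (f : B ⟶ D) (g : C ⟶ D), pb f g ⟶ B
  snd : ∀ {B C D : A.Obj} (f : B ⟶ D) (g : C ⟶ D), pb f g ⟶ C
  isPullback : ∀ {B C D : A.Obj} (f : B ⟶ D) (g : C ⟶ D), IsPullback (fst f g) (snd f g) f g
  pbV : ∀ {B C D B' C' D' : A.Obj} {x : A.V B B'} {y : A.V C C'} {t : A.V D D'}
    {f : B ⟶ D} {g : C ⟶ D} {f' : B' ⟶ D'} {g' : C' ⟶ D'} (α : A.Cell x t) (β : A.Cell y t)
    (_ : A.top α = f) (_ : A.top β = g) (_ : A.bot α = f') (_ : A.bot β = g'),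
    A.V (pb f g) (pb f' g')
  fstC : ∀ {B C D B' C' D' : A.Obj} {x : A.V B B'} {y : A.V C C'} {t : A.V D D'}
    {f : B ⟶ D} {g : C ⟶ D} {f' : B' ⟶ D'} {g' : C' ⟶ D'} (α : A.Cell x t) (β : A.Cell y t)
    (h₁ : A.top α = f) (h₂ : A.top β = g) (h₃ : A.bot α = f') (h₄ : A.bot β = g'),
    A.Cell (pbV α β h₁ h₂ h₃ h₄) x
  sndC : ∀ {B C D B' C' D' : A.Obj} {x : A.V B B'} {y : A.V C C'} {t : A.V D D'}
    {f : B ⟶ D} {g : C ⟶ D} {f' : B' ⟶ D'} {g' : C' ⟶ D'} (α : A.Cell x t) (β : A.Cell y t)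
    (h₁ : A.top α = f) (h₂ : A.top β = g) (h₃ : A.bot α = f') (h₄ : A.bot β = g'),
    A.Cell (pbV α β h₁ h₂ h₃ h₄) y
  top_fstC : ∀ {B C D B' C' D' : A.Obj} {x : A.V B B'} {y : A.V C C'} {t : A.V D D'}
    {f : B ⟶ D} {g : C ⟶ D} {f' : B' ⟶ D'} {g' : C' ⟶ D'} (α : A.Cell x t) (β : A.Cell y t)
    (h₁ : A.top α = f) (h₂ : A.top β = g) (h₃ : A.bot α = f') (h₄ : A.bot β = g'),
    A.top (fstC α β h₁ h₂ h₃ h₄) = fst f g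
  bot_fstC : ∀ {B C D B' C' D' : A.Obj} {x : A.V B B'} {y : A.V C C'} {t : A.V D D'}
    {f : B ⟶ D} {g : C ⟶ D} {f' : B' ⟶ D'} {g' : C' ⟶ D'} (α : A.Cell x t) (β : A.Cell y t)
    (h₁ : A.top α = f) (h₂ : A.top β = g) (h₃ : A.bot α = f') (h₄ : A.bot β = g'),
    A.bot (fstC α β h₁ h₂ h₃ h₄) = fst f' g'
  top_sndC : ∀ {B C D B' C' D' : A.Obj} {x : A.V B B'} {y : A.V C C'} {t : A.V D D'}
    {f : B ⟶ D} {g : C ⟶ D} {f' : B' ⟶ D'} {g' : C' ⟶ D'} (α : A.Cell x t) (β : A.Cell y t)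
    (h₁ : A.top α = f) (h₂ : A.top β = g) (h₃ : A.bot α = f') (h₄ : A.bot β = g'),
    A.top (sndC α β h₁ h₂ h₃ h₄) = snd f g
  bot_sndC : ∀ {B C D B' C' D' : A.Obj} {x : A.V B B'} {y : A.V C C'} {t : A.V D D'}
    {f : B ⟶ D} {g : C ⟶ D} {f' : B' ⟶ D'} {g' : C' ⟶ D'} (α : A.Cell x t) (β : A.Cell y t)
    (h₁ : A.top α = f) (h₂ : A.top β = g) (h₃ : A.bot α = f') (h₄ : A.bot β = g'),
    A.bot (sndC α β h₁ h₂ h₃ h₄) = snd f' g'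
  isPullbackV : ∀ {B C D B' C' D' : A.Obj} {x : A.V B B'} {y : A.V C C'} {t : A.V D D'}
    {f : B ⟶ D} {g : C ⟶ D} {f' : B' ⟶ D'} {g' : C' ⟶ D'} (α : A.Cell x t) (β : A.Cell y t)
    (h₁ : A.top α = f) (h₂ : A.top β = g) (h₃ : A.bot α = f') (h₄ : A.bot β = g'),
    IsPullback (VArr.hom (fstC α β h₁ h₂ h₃ h₄)) (VArr.hom (sndC α β h₁ h₂ h₃ h₄))
      (VArr.hom α) (VArr.hom β)

namespace LaxPullbackChoice

variable {A : WeakDbl.{u, v, w, z}} (P : LaxPullbackChoice A)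

attribute [simp] top_fstC bot_fstC top_sndC bot_sndC

theorem w {B C D : A.Obj} (f : B ⟶ D) (g : C ⟶ D) : P.fst f g ≫ f = P.snd f g ≫ g :=
  (P.isPullback f g).w

/-- The arrow into a chosen pullback in `A₀` given by its universal property. -/
noncomputable def lift {B C D E : A.Obj} (f : B ⟶ D) (g : C ⟶ D) (a : E ⟶ B) (b : E ⟶ C)
    (h : a ≫ f = b ≫ g) : E ⟶ P.pb f g :=
  (P.isPullback f g).lift a b h

@[simp] theorem lift_fst {B C D E : A.Obj} (f : B ⟶ D) (g : C ⟶ D) (a : E ⟶ B) (b : E ⟶ C)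
    (h : a ≫ f = b ≫ g) : P.lift f g a b h ≫ P.fst f g = a :=
  (P.isPullback f g).lift_fst a b h

@[simp] theorem lift_snd {B C D E : A.Obj} (f : B ⟶ D) (g : C ⟶ D) (a : E ⟶ B) (b : E ⟶ C)
    (h : a ≫ f = b ≫ g) : P.lift f g a b h ≫ P.snd f g = b :=
  (P.isPullback f g).lift_snd a b h

theorem hom_ext {B C D E : A.Obj} {f : B ⟶ D} {g : C ⟶ D} {a b : E ⟶ P.pb f g}
    (h₁ : a ≫ P.fst f g = b ≫ P.fst f g) (h₂ : a ≫ P.snd f g = b ≫ P.snd f g) : a = b :=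
  (P.isPullback f g).hom_ext h₁ h₂

section
variable {B C D B' C' D' E E' : A.Obj} {x : A.V B B'} {y : A.V C C'} {t : A.V D D'} {s : A.V E E'}
    {f : B ⟶ D} {g : C ⟶ D} {f' : B' ⟶ D'} {g' : C' ⟶ D'} (α : A.Cell x t) (β : A.Cell y t)
    (h₁ : A.top α = f) (h₂ : A.top β = g) (h₃ : A.bot α = f') (h₄ : A.bot β = g')

theorem wC : P.fstC α β h₁ h₂ h₃ h₄ ⊚ α = P.sndC α β h₁ h₂ h₃ h₄ ⊚ β :=
  (P.isPullbackV α β h₁ h₂ h₃ h₄).w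

/-- The cell into a chosen pullback in `A₁` given by its universal property. -/
noncomputable def liftC (γ : A.Cell s x) (δ : A.Cell s y) (h : γ ⊚ α = δ ⊚ β) :
    A.Cell s (P.pbV α β h₁ h₂ h₃ h₄) :=
  (P.isPullbackV α β h₁ h₂ h₃ h₄).lift (VArr.hom γ) (VArr.hom δ) h

@[simp] theorem liftC_fstC (γ : A.Cell s x) (δ : A.Cell s y) (h : γ ⊚ α = δ ⊚ β) :
    P.liftC α β h₁ h₂ h₃ h₄ γ δ h ⊚ P.fstC α β h₁ h₂ h₃ h₄ = γ :=
  (P.isPullbackV α β h₁ h₂ h₃ h₄).lift_fst (VArr.hom γ) (VArr.hom δ) h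

@[simp] theorem liftC_sndC (γ : A.Cell s x) (δ : A.Cell s y) (h : γ ⊚ α = δ ⊚ β) :
    P.liftC α β h₁ h₂ h₃ h₄ γ δ h ⊚ P.sndC α β h₁ h₂ h₃ h₄ = δ :=
  (P.isPullbackV α β h₁ h₂ h₃ h₄).lift_snd (VArr.hom γ) (VArr.hom δ) h

variable {α β h₁ h₂ h₃ h₄}

theorem cell_ext {γ δ : A.Cell s (P.pbV α β h₁ h₂ h₃ h₄)}
    (e₁ : γ ⊚ P.fstC α β h₁ h₂ h₃ h₄ = δ ⊚ P.fstC α β h₁ h₂ h₃ h₄)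
    (e₂ : γ ⊚ P.sndC α β h₁ h₂ h₃ h₄ = δ ⊚ P.sndC α β h₁ h₂ h₃ h₄) : γ = δ :=
  (P.isPullbackV α β h₁ h₂ h₃ h₄).hom_ext (W := VArr.mk s) (k := γ) (l := δ) e₁ e₂

end

end LaxPullbackChoice

end Pullbacks

/-! ### The double categories of spans and of composable pairs of spans -/

section Span

universe u v w z

variable {A : WeakDbl.{u, v, w, z}}

/-- A span of horizontal arrows `l ← m → r`. -/
@[ext] structure SpanObj (A : WeakDbl.{u, v, w, z}) where
  l : A.Obj
  m : A.Obj
  r : A.Obj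
  f : m ⟶ l
  g : m ⟶ r

/-- A morphism of spans (a commutative diagram of horizontal arrows). -/
@[ext] structure SpanHom (X Y : SpanObj A) where
  l : X.l ⟶ Y.l
  m : X.m ⟶ Y.m
  r : X.r ⟶ Y.r
  wl : X.f ≫ l = m ≫ Y.f
  wr : X.g ≫ r = m ≫ Y.g

/-- A span of cells between vertical arrows, `l ← m → r`. -/
@[ext] structure SpanV (X Y : SpanObj A) where
  l : A.V X.l Y.l
  m : A.V X.m Y.m
  r : A.V X.r Y.r
  f : A.Cell m l
  g : A.Cell m r
  top_f : A.top f = X.f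
  bot_f : A.bot f = Y.f
  top_g : A.top g = X.g
  bot_g : A.bot g = Y.g

/-- A morphism of spans of cells (a commutative diagram of cells). -/
@[ext] structure SpanCell {X Y X' Y' : SpanObj A} (x : SpanV X Y) (y : SpanV X' Y') where
  l : A.Cell x.l y.l
  m : A.Cell x.m y.m
  r : A.Cell x.r y.r
  wl : x.f ⊚ l = m ⊚ y.f
  wr : x.g ⊚ r = m ⊚ y.g

attribute [simp] SpanV.top_f SpanV.bot_f SpanV.top_g SpanV.bot_g

instance : Category (SpanObj A) where
  Hom := SpanHom
  id X := ⟨𝟙 _, 𝟙 _, 𝟙 _, by simp, by simp⟩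
  comp a b := ⟨a.l ≫ b.l, a.m ≫ b.m, a.r ≫ b.r,
    by rw [← Category.assoc, a.wl, Category.assoc, b.wl, Category.assoc],
    by rw [← Category.assoc, a.wr, Category.assoc, b.wr, Category.assoc]⟩
  id_comp a := by apply SpanHom.ext <;> simp
  comp_id a := by apply SpanHom.ext <;> simp
  assoc a b c := by apply SpanHom.ext <;> simp

@[ext] theorem SpanHom.hom_ext {X Y : SpanObj A} {a b : X ⟶ Y} (h₁ : a.l = b.l) (h₂ : a.m = b.m)
    (h₃ : a.r = b.r) : a = b := SpanHom.ext h₁ h₂ h₃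

@[simp] theorem SpanHom.id_l (X : SpanObj A) : SpanHom.l (𝟙 X) = 𝟙 X.l := rfl
@[simp] theorem SpanHom.id_m (X : SpanObj A) : SpanHom.m (𝟙 X) = 𝟙 X.m := rfl
@[simp] theorem SpanHom.id_r (X : SpanObj A) : SpanHom.r (𝟙 X) = 𝟙 X.r := rfl
@[simp] theorem SpanHom.comp_l {X Y Z : SpanObj A} (a : X ⟶ Y) (b : Y ⟶ Z) :
    (a ≫ b).l = a.l ≫ b.l := rfl
@[simp] theorem SpanHom.comp_m {X Y Z : SpanObj A} (a : X ⟶ Y) (b : Y ⟶ Z) :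
    (a ≫ b).m = a.m ≫ b.m := rfl
@[simp] theorem SpanHom.comp_r {X Y Z : SpanObj A} (a : X ⟶ Y) (b : Y ⟶ Z) :
    (a ≫ b).r = a.r ≫ b.r := rfl

theorem inv_cell_w {B B' C C' D D' E E' : A.Obj} {x : A.V B B'} {y : A.V C C'} {s : A.V D D'}
    {t : A.V E E'} {f : A.Cell x y} {g : A.Cell s t} {α : A.Cell x s} {αi : A.Cell s x}
    {β : A.Cell y t} {βi : A.Cell t y} (hα : αi ⊚ α = A.idc _) (hβ : β ⊚ βi = A.idc _)
    (h : f ⊚ β = α ⊚ g) : g ⊚ βi = αi ⊚ f := by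
  have : f = α ⊚ g ⊚ βi := by
    rw [← A.assoc', ← h, A.assoc', hβ, A.comp_id]
  rw [this, ← A.assoc', hα, A.id_comp]

theorem vcompCell_square {B₀ B₁ B₂ C₀ C₁ C₂ D₀ D₁ D₂ E₀ E₁ E₂ : A.Obj}
    {b : A.V B₀ B₁} {b' : A.V B₁ B₂} {c : A.V C₀ C₁} {c' : A.V C₁ C₂} {d : A.V D₀ D₁}
    {d' : A.V D₁ D₂} {e : A.V E₀ E₁} {e' : A.V E₁ E₂}
    {α : A.Cell b c} {α' : A.Cell b' c'} {β : A.Cell c e} {β' : A.Cell c' e'}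
    {γ : A.Cell b d} {γ' : A.Cell b' d'} {δ : A.Cell d e} {δ' : A.Cell d' e'}
    (h : α ⊚ β = γ ⊚ δ) (h' : α' ⊚ β' = γ' ⊚ δ') (hα : A.bot α = A.top α')
    (hβ : A.bot β = A.top β') (hγ : A.bot γ = A.top γ') (hδ : A.bot δ = A.top δ') :
    A.vcompCell α α' hα ⊚ A.vcompCell β β' hβ = A.vcompCell γ γ' hγ ⊚ A.vcompCell δ δ' hδ := by
  rw [vcompCell_comp_idc, vcompCell_comp_idc]
  exact WeakDbl.vcompCell_congr _ h h' _

variable (A)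

/-- The double category of spans in `A`, i.e. of diagrams in `A` of shape `0 ← 2 → 1`. -/
@[reducible] def Span : WeakDbl where
  Obj := SpanObj A
  V := SpanV
  Cell := SpanCell
  top {X X' Y Y' x y} α := (⟨A.top α.l, A.top α.m, A.top α.r,
    by have := congrArg A.top α.wl; simpa using this,
    by have := congrArg A.top α.wr; simpa using this⟩ : SpanHom X Y)
  bot {X X' Y Y' x y} α := (⟨A.bot α.l, A.bot α.m, A.bot α.r,
    by have := congrArg A.bot α.wl; simpa using this,
    by have := congrArg A.bot α.wr; simpa using this⟩ : SpanHom X' Y')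
  idc x := ⟨A.idc _, A.idc _, A.idc _, by simp, by simp⟩
  comp α β := ⟨α.l ⊚ β.l, α.m ⊚ β.m, α.r ⊚ β.r,
    by rw [← A.assoc', α.wl, A.assoc', β.wl, A.assoc'],
    by rw [← A.assoc', α.wr, A.assoc', β.wr, A.assoc']⟩
  id_comp α := by ext <;> simp
  comp_id α := by ext <;> simp
  assoc' α β γ := by ext <;> simp
  top_idc x := by ext <;> simp
  bot_idc x := by ext <;> simp
  top_comp α β := by ext <;> simp
  bot_comp α β := by ext <;> simp
  vid X := ⟨A.vid _, A.vid _, A.vid _, A.vidCell X.f, A.vidCell X.g,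
    by simp, by simp, by simp, by simp⟩
  vcomp x y := ⟨x.l ⊙ y.l, x.m ⊙ y.m, x.r ⊙ y.r, A.vcompCell x.f y.f (by simp),
    A.vcompCell x.g y.g (by simp), by simp, by simp, by simp, by simp⟩
  vidCell {X Y} a := ⟨A.vidCell (SpanHom.l a), A.vidCell (SpanHom.m a), A.vidCell (SpanHom.r a),
    by rw [← A.vidCell_comp, ← A.vidCell_comp, SpanHom.wl a],
    by rw [← A.vidCell_comp, ← A.vidCell_comp, SpanHom.wr a]⟩
  top_vidCell a := by ext <;> simp
  bot_vidCell a := by ext <;> simp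
  vidCell_id X := by ext <;> simp
  vidCell_comp a b := by ext <;> simp [WeakDbl.vidCell_comp]
  vcompCell α β h := ⟨A.vcompCell α.l β.l (congrArg SpanHom.l h),
    A.vcompCell α.m β.m (congrArg SpanHom.m h), A.vcompCell α.r β.r (congrArg SpanHom.r h),
    vcompCell_square α.wl β.wl _ _ _ _, vcompCell_square α.wr β.wr _ _ _ _⟩
  top_vcompCell α β h := by ext <;> simp
  bot_vcompCell α β h := by ext <;> simp
  vcompCell_id x y h := by ext <;> simp
  vcompCell_comp α α' β β' h h' h'' := by
    ext
    · exact A.vcompCell_comp _ _ _ _ (congrArg SpanHom.l h) (congrArg SpanHom.l h') _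
    · exact A.vcompCell_comp _ _ _ _ (congrArg SpanHom.m h) (congrArg SpanHom.m h') _
    · exact A.vcompCell_comp _ _ _ _ (congrArg SpanHom.r h) (congrArg SpanHom.r h') _
  ass x y t := ⟨A.ass _ _ _, A.ass _ _ _, A.ass _ _ _, A.ass_nat _ _ _ _ _ _ _,
    A.ass_nat _ _ _ _ _ _ _⟩
  assInv x y t := ⟨A.assInv _ _ _, A.assInv _ _ _, A.assInv _ _ _,
    inv_cell_w (A.assInv_ass _ _ _) (A.ass_assInv _ _ _) (A.ass_nat _ _ _ _ _ _ _),
    inv_cell_w (A.assInv_ass _ _ _) (A.ass_assInv _ _ _) (A.ass_nat _ _ _ _ _ _ _)⟩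
  ass_assInv x y t := by ext <;> simp
  assInv_ass x y t := by ext <;> simp
  top_ass x y t := by ext <;> simp
  bot_ass x y t := by ext <;> simp
  ass_nat α β γ h₁ h₂ h₃ h₄ := by
    ext
    · exact A.ass_nat _ _ _ (congrArg SpanHom.l h₁) (congrArg SpanHom.l h₂)
        (congrArg SpanHom.l h₃) (congrArg SpanHom.l h₄)
    · exact A.ass_nat _ _ _ (congrArg SpanHom.m h₁) (congrArg SpanHom.m h₂)
        (congrArg SpanHom.m h₃) (congrArg SpanHom.m h₄)
    · exact A.ass_nat _ _ _ (congrArg SpanHom.r h₁) (congrArg SpanHom.r h₂)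
        (congrArg SpanHom.r h₃) (congrArg SpanHom.r h₄)
  lunit x := ⟨A.lunit _, A.lunit _, A.lunit _,
    by have := A.lunit_nat x.f (by simp); simpa using this,
    by have := A.lunit_nat x.g (by simp); simpa using this⟩
  lunitInv x := ⟨A.lunitInv _, A.lunitInv _, A.lunitInv _,
    inv_cell_w (A.lunitInv_lunit _) (A.lunit_lunitInv _)
      (by have := A.lunit_nat x.f (by simp); simpa using this),
    inv_cell_w (A.lunitInv_lunit _) (A.lunit_lunitInv _)
      (by have := A.lunit_nat x.g (by simp); simpa using this)⟩
  lunit_lunitInv x := by ext <;> simp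
  lunitInv_lunit x := by ext <;> simp
  top_lunit x := by ext <;> simp
  bot_lunit x := by ext <;> simp
  lunit_nat α h := by
    ext
    · exact A.lunit_nat _ (congrArg SpanHom.l h)
    · exact A.lunit_nat _ (congrArg SpanHom.m h)
    · exact A.lunit_nat _ (congrArg SpanHom.r h)
  runit x := ⟨A.runit _, A.runit _, A.runit _,
    by have := A.runit_nat x.f (by simp); simpa using this,
    by have := A.runit_nat x.g (by simp); simpa using this⟩
  runitInv x := ⟨A.runitInv _, A.runitInv _, A.runitInv _,
    inv_cell_w (A.runitInv_runit _) (A.runit_runitInv _)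
      (by have := A.runit_nat x.f (by simp); simpa using this),
    inv_cell_w (A.runitInv_runit _) (A.runit_runitInv _)
      (by have := A.runit_nat x.g (by simp); simpa using this)⟩
  runit_runitInv x := by ext <;> simp
  runitInv_runit x := by ext <;> simp
  top_runit x := by ext <;> simp
  bot_runit x := by ext <;> simp
  runit_nat α h := by
    ext
    · exact A.runit_nat _ (congrArg SpanHom.l h)
    · exact A.runit_nat _ (congrArg SpanHom.m h)
    · exact A.runit_nat _ (congrArg SpanHom.r h)
  pentagon x y t s h h' := by
    ext
    · exact A.pentagon _ _ _ _ (congrArg SpanHom.l h) (congrArg SpanHom.l h')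
    · exact A.pentagon _ _ _ _ (congrArg SpanHom.m h) (congrArg SpanHom.m h')
    · exact A.pentagon _ _ _ _ (congrArg SpanHom.r h) (congrArg SpanHom.r h')
  triangle x y h h' := by
    ext
    · exact A.triangle _ _ (congrArg SpanHom.l h) (congrArg SpanHom.l h')
    · exact A.triangle _ _ (congrArg SpanHom.m h) (congrArg SpanHom.m h')
    · exact A.triangle _ _ (congrArg SpanHom.r h) (congrArg SpanHom.r h')

end Span

section Zig

universe u v w z

variable {A : WeakDbl.{u, v, w, z}}

/-- A composable pair of spans `a₀ ← a₃ → a₁ ← a₄ → a₂` of horizontal arrows. -/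
@[ext] structure ZigObj (A : WeakDbl.{u, v, w, z}) where
  a₀ : A.Obj
  a₃ : A.Obj
  a₁ : A.Obj
  a₄ : A.Obj
  a₂ : A.Obj
  f : a₃ ⟶ a₀
  g : a₃ ⟶ a₁
  h : a₄ ⟶ a₁
  k : a₄ ⟶ a₂

/-- A commutative diagram of horizontal arrows between composable pairs of spans. -/
@[ext] structure ZigHom (X Y : ZigObj A) where
  a₀ : X.a₀ ⟶ Y.a₀
  a₃ : X.a₃ ⟶ Y.a₃
  a₁ : X.a₁ ⟶ Y.a₁
  a₄ : X.a₄ ⟶ Y.a₄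
  a₂ : X.a₂ ⟶ Y.a₂
  wf : X.f ≫ a₀ = a₃ ≫ Y.f
  wg : X.g ≫ a₁ = a₃ ≫ Y.g
  wh : X.h ≫ a₁ = a₄ ≫ Y.h
  wk : X.k ≫ a₂ = a₄ ≫ Y.k

/-- A composable pair of spans of cells between vertical arrows. -/
@[ext] structure ZigV (X Y : ZigObj A) where
  a₀ : A.V X.a₀ Y.a₀
  a₃ : A.V X.a₃ Y.a₃
  a₁ : A.V X.a₁ Y.a₁
  a₄ : A.V X.a₄ Y.a₄
  a₂ : A.V X.a₂ Y.a₂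
  f : A.Cell a₃ a₀
  g : A.Cell a₃ a₁
  h : A.Cell a₄ a₁
  k : A.Cell a₄ a₂
  top_f : A.top f = X.f
  bot_f : A.bot f = Y.f
  top_g : A.top g = X.g
  bot_g : A.bot g = Y.g
  top_h : A.top h = X.h
  bot_h : A.bot h = Y.h
  top_k : A.top k = X.k
  bot_k : A.bot k = Y.k

/-- A commutative diagram of cells between composable pairs of spans of cells. -/
@[ext] structure ZigCell {X Y X' Y' : ZigObj A} (x : ZigV X Y) (y : ZigV X' Y') where
  a₀ : A.Cell x.a₀ y.a₀
  a₃ : A.Cell x.a₃ y.a₃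
  a₁ : A.Cell x.a₁ y.a₁
  a₄ : A.Cell x.a₄ y.a₄
  a₂ : A.Cell x.a₂ y.a₂
  wf : x.f ⊚ a₀ = a₃ ⊚ y.f
  wg : x.g ⊚ a₁ = a₃ ⊚ y.g
  wh : x.h ⊚ a₁ = a₄ ⊚ y.h
  wk : x.k ⊚ a₂ = a₄ ⊚ y.k

attribute [simp] ZigV.top_f ZigV.bot_f ZigV.top_g ZigV.bot_g ZigV.top_h ZigV.bot_h ZigV.top_k ZigV.bot_k

instance : Category (ZigObj A) where
  Hom := ZigHom
  id X := ⟨𝟙 _, 𝟙 _, 𝟙 _, 𝟙 _, 𝟙 _, by simp, by simp, by simp, by simp⟩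
  comp a b := ⟨a.a₀ ≫ b.a₀, a.a₃ ≫ b.a₃, a.a₁ ≫ b.a₁, a.a₄ ≫ b.a₄, a.a₂ ≫ b.a₂,
    by rw [← Category.assoc, a.wf, Category.assoc, b.wf, Category.assoc],
    by rw [← Category.assoc, a.wg, Category.assoc, b.wg, Category.assoc],
    by rw [← Category.assoc, a.wh, Category.assoc, b.wh, Category.assoc],
    by rw [← Category.assoc, a.wk, Category.assoc, b.wk, Category.assoc]⟩
  id_comp a := by apply ZigHom.ext <;> simp
  comp_id a := by apply ZigHom.ext <;> simp
  assoc a b c := by apply ZigHom.ext <;> simp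

@[ext] theorem ZigHom.hom_ext {X Y : ZigObj A} {a b : X ⟶ Y}
    (h₀ : a.a₀ = b.a₀) (h₃ : a.a₃ = b.a₃) (h₁ : a.a₁ = b.a₁) (h₄ : a.a₄ = b.a₄) (h₂ : a.a₂ = b.a₂) :
    a = b := ZigHom.ext h₀ h₃ h₁ h₄ h₂

@[simp] theorem ZigHom.id_a₀ (X : ZigObj A) : ZigHom.a₀ (𝟙 X) = 𝟙 X.a₀ := rfl
@[simp] theorem ZigHom.id_a₃ (X : ZigObj A) : ZigHom.a₃ (𝟙 X) = 𝟙 X.a₃ := rfl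
@[simp] theorem ZigHom.id_a₁ (X : ZigObj A) : ZigHom.a₁ (𝟙 X) = 𝟙 X.a₁ := rfl
@[simp] theorem ZigHom.id_a₄ (X : ZigObj A) : ZigHom.a₄ (𝟙 X) = 𝟙 X.a₄ := rfl
@[simp] theorem ZigHom.id_a₂ (X : ZigObj A) : ZigHom.a₂ (𝟙 X) = 𝟙 X.a₂ := rfl
@[simp] theorem ZigHom.comp_a₀ {X Y Z : ZigObj A} (a : X ⟶ Y) (b : Y ⟶ Z) :
    (a ≫ b).a₀ = a.a₀ ≫ b.a₀ := rfl
@[simp] theorem ZigHom.comp_a₃ {X Y Z : ZigObj A} (a : X ⟶ Y) (b : Y ⟶ Z) :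
    (a ≫ b).a₃ = a.a₃ ≫ b.a₃ := rfl
@[simp] theorem ZigHom.comp_a₁ {X Y Z : ZigObj A} (a : X ⟶ Y) (b : Y ⟶ Z) :
    (a ≫ b).a₁ = a.a₁ ≫ b.a₁ := rfl
@[simp] theorem ZigHom.comp_a₄ {X Y Z : ZigObj A} (a : X ⟶ Y) (b : Y ⟶ Z) :
    (a ≫ b).a₄ = a.a₄ ≫ b.a₄ := rfl
@[simp] theorem ZigHom.comp_a₂ {X Y Z : ZigObj A} (a : X ⟶ Y) (b : Y ⟶ Z) :
    (a ≫ b).a₂ = a.a₂ ≫ b.a₂ := rfl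

variable (A)

/-- The double category of diagrams in `A` of shape `0 ← 3 → 1 ← 4 → 2`. -/
@[reducible] def Zig : WeakDbl where
  Obj := ZigObj A
  V := ZigV
  Cell := ZigCell
  top {X X' Y Y' x y} α := (⟨A.top α.a₀, A.top α.a₃, A.top α.a₁, A.top α.a₄, A.top α.a₂,
    by have := congrArg A.top α.wf; simpa using this,
    by have := congrArg A.top α.wg; simpa using this,
    by have := congrArg A.top α.wh; simpa using this,
    by have := congrArg A.top α.wk; simpa using this⟩ : ZigHom X Y)
  bot {X X' Y Y' x y} α := (⟨A.bot α.a₀, A.bot α.a₃, A.bot α.a₁, A.bot α.a₄, A.bot α.a₂,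
    by have := congrArg A.bot α.wf; simpa using this,
    by have := congrArg A.bot α.wg; simpa using this,
    by have := congrArg A.bot α.wh; simpa using this,
    by have := congrArg A.bot α.wk; simpa using this⟩ : ZigHom X' Y')
  idc x := ⟨A.idc _, A.idc _, A.idc _, A.idc _, A.idc _, by simp, by simp, by simp, by simp⟩
  comp α β := ⟨α.a₀ ⊚ β.a₀, α.a₃ ⊚ β.a₃, α.a₁ ⊚ β.a₁, α.a₄ ⊚ β.a₄, α.a₂ ⊚ β.a₂,
    by rw [← A.assoc', α.wf, A.assoc', β.wf, A.assoc'],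
    by rw [← A.assoc', α.wg, A.assoc', β.wg, A.assoc'],
    by rw [← A.assoc', α.wh, A.assoc', β.wh, A.assoc'],
    by rw [← A.assoc', α.wk, A.assoc', β.wk, A.assoc']⟩
  id_comp α := by ext <;> simp
  comp_id α := by ext <;> simp
  assoc' α β γ := by ext <;> simp
  top_idc x := by ext <;> simp
  bot_idc x := by ext <;> simp
  top_comp α β := by ext <;> simp
  bot_comp α β := by ext <;> simp
  vid X := ⟨A.vid _, A.vid _, A.vid _, A.vid _, A.vid _,
    A.vidCell X.f, A.vidCell X.g, A.vidCell X.h, A.vidCell X.k,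
    by simp, by simp, by simp, by simp, by simp, by simp, by simp, by simp⟩
  vcomp x y := ⟨x.a₀ ⊙ y.a₀, x.a₃ ⊙ y.a₃, x.a₁ ⊙ y.a₁, x.a₄ ⊙ y.a₄, x.a₂ ⊙ y.a₂,
    A.vcompCell x.f y.f (by simp),
    A.vcompCell x.g y.g (by simp),
    A.vcompCell x.h y.h (by simp),
    A.vcompCell x.k y.k (by simp),
    by simp, by simp, by simp, by simp, by simp, by simp, by simp, by simp⟩
  vidCell {X Y} a := ⟨A.vidCell (ZigHom.a₀ a), A.vidCell (ZigHom.a₃ a), A.vidCell (ZigHom.a₁ a), A.vidCell (ZigHom.a₄ a), A.vidCell (ZigHom.a₂ a),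
    by rw [← A.vidCell_comp, ← A.vidCell_comp, ZigHom.wf a],
    by rw [← A.vidCell_comp, ← A.vidCell_comp, ZigHom.wg a],
    by rw [← A.vidCell_comp, ← A.vidCell_comp, ZigHom.wh a],
    by rw [← A.vidCell_comp, ← A.vidCell_comp, ZigHom.wk a]⟩
  top_vidCell a := by ext <;> simp
  bot_vidCell a := by ext <;> simp
  vidCell_id X := by ext <;> simp
  vidCell_comp a b := by ext <;> simp [WeakDbl.vidCell_comp]
  vcompCell α β h := ⟨A.vcompCell α.a₀ β.a₀ (congrArg ZigHom.a₀ h),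
    A.vcompCell α.a₃ β.a₃ (congrArg ZigHom.a₃ h),
    A.vcompCell α.a₁ β.a₁ (congrArg ZigHom.a₁ h),
    A.vcompCell α.a₄ β.a₄ (congrArg ZigHom.a₄ h),
    A.vcompCell α.a₂ β.a₂ (congrArg ZigHom.a₂ h),
    vcompCell_square α.wf β.wf _ _ _ _,
    vcompCell_square α.wg β.wg _ _ _ _,
    vcompCell_square α.wh β.wh _ _ _ _,
    vcompCell_square α.wk β.wk _ _ _ _⟩
  top_vcompCell α β h := by ext <;> simp
  bot_vcompCell α β h := by ext <;> simp
  vcompCell_id x y h := by ext <;> simp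
  vcompCell_comp α α' β β' h h' h'' := by
    ext <;> exact A.vcompCell_comp _ _ _ _ _ _ _
  ass x y t := ⟨A.ass _ _ _, A.ass _ _ _, A.ass _ _ _, A.ass _ _ _, A.ass _ _ _,
    A.ass_nat _ _ _ _ _ _ _,
    A.ass_nat _ _ _ _ _ _ _,
    A.ass_nat _ _ _ _ _ _ _,
    A.ass_nat _ _ _ _ _ _ _⟩
  assInv x y t := ⟨A.assInv _ _ _, A.assInv _ _ _, A.assInv _ _ _, A.assInv _ _ _, A.assInv _ _ _,
    inv_cell_w (A.assInv_ass _ _ _) (A.ass_assInv _ _ _) (A.ass_nat _ _ _ _ _ _ _),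
    inv_cell_w (A.assInv_ass _ _ _) (A.ass_assInv _ _ _) (A.ass_nat _ _ _ _ _ _ _),
    inv_cell_w (A.assInv_ass _ _ _) (A.ass_assInv _ _ _) (A.ass_nat _ _ _ _ _ _ _),
    inv_cell_w (A.assInv_ass _ _ _) (A.ass_assInv _ _ _) (A.ass_nat _ _ _ _ _ _ _)⟩
  ass_assInv x y t := by ext <;> simp
  assInv_ass x y t := by ext <;> simp
  top_ass x y t := by ext <;> simp
  bot_ass x y t := by ext <;> simp
  ass_nat α β γ h₁ h₂ h₃ h₄ := by
    ext <;> exact A.ass_nat _ _ _ _ _ _ _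
  lunit x := ⟨A.lunit _, A.lunit _, A.lunit _, A.lunit _, A.lunit _,
    by have := A.lunit_nat x.f (by simp); simpa using this,
    by have := A.lunit_nat x.g (by simp); simpa using this,
    by have := A.lunit_nat x.h (by simp); simpa using this,
    by have := A.lunit_nat x.k (by simp); simpa using this⟩
  lunitInv x := ⟨A.lunitInv _, A.lunitInv _, A.lunitInv _, A.lunitInv _, A.lunitInv _,
    inv_cell_w (A.lunitInv_lunit _) (A.lunit_lunitInv _)
      (by have := A.lunit_nat x.f (by simp); simpa using this),
    inv_cell_w (A.lunitInv_lunit _) (A.lunit_lunitInv _)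
      (by have := A.lunit_nat x.g (by simp); simpa using this),
    inv_cell_w (A.lunitInv_lunit _) (A.lunit_lunitInv _)
      (by have := A.lunit_nat x.h (by simp); simpa using this),
    inv_cell_w (A.lunitInv_lunit _) (A.lunit_lunitInv _)
      (by have := A.lunit_nat x.k (by simp); simpa using this)⟩
  lunit_lunitInv x := by ext <;> simp
  lunitInv_lunit x := by ext <;> simp
  top_lunit x := by ext <;> simp
  bot_lunit x := by ext <;> simp
  lunit_nat α h := by
    ext
    · exact A.lunit_nat _ (congrArg ZigHom.a₀ h)
    · exact A.lunit_nat _ (congrArg ZigHom.a₃ h)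
    · exact A.lunit_nat _ (congrArg ZigHom.a₁ h)
    · exact A.lunit_nat _ (congrArg ZigHom.a₄ h)
    · exact A.lunit_nat _ (congrArg ZigHom.a₂ h)
  runit x := ⟨A.runit _, A.runit _, A.runit _, A.runit _, A.runit _,
    by have := A.runit_nat x.f (by simp); simpa using this,
    by have := A.runit_nat x.g (by simp); simpa using this,
    by have := A.runit_nat x.h (by simp); simpa using this,
    by have := A.runit_nat x.k (by simp); simpa using this⟩
  runitInv x := ⟨A.runitInv _, A.runitInv _, A.runitInv _, A.runitInv _, A.runitInv _,
    inv_cell_w (A.runitInv_runit _) (A.runit_runitInv _)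
      (by have := A.runit_nat x.f (by simp); simpa using this),
    inv_cell_w (A.runitInv_runit _) (A.runit_runitInv _)
      (by have := A.runit_nat x.g (by simp); simpa using this),
    inv_cell_w (A.runitInv_runit _) (A.runit_runitInv _)
      (by have := A.runit_nat x.h (by simp); simpa using this),
    inv_cell_w (A.runitInv_runit _) (A.runit_runitInv _)
      (by have := A.runit_nat x.k (by simp); simpa using this)⟩
  runit_runitInv x := by ext <;> simp
  runitInv_runit x := by ext <;> simp
  top_runit x := by ext <;> simp
  bot_runit x := by ext <;> simp
  runit_nat α h := by
    ext
    · exact A.runit_nat _ (congrArg ZigHom.a₀ h)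
    · exact A.runit_nat _ (congrArg ZigHom.a₃ h)
    · exact A.runit_nat _ (congrArg ZigHom.a₁ h)
    · exact A.runit_nat _ (congrArg ZigHom.a₄ h)
    · exact A.runit_nat _ (congrArg ZigHom.a₂ h)
  pentagon x y t s h h' := by
    ext <;> exact A.pentagon _ _ _ _ _ _
  triangle x y h h' := by
    ext <;> exact A.triangle _ _ _ _

end Zig

/-! ### The span construction -/

section SpanConstruction

universe u v w z

open WeakDbl

variable (A : WeakDbl.{u, v, w, z})

/-- The strict double functor sending a span to its foot `0`. -/
@[reducible] def spanSrc : StrictFunctor (Span A) A where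
  obj X := SpanObj.l X
  map a := SpanHom.l a
  map_id _ := rfl
  map_comp _ _ := rfl
  mapV x := SpanV.l x
  mapCell α := SpanCell.l α
  top_mapCell _ := rfl
  bot_mapCell _ := rfl
  mapCell_id _ := rfl
  mapCell_comp _ _ := rfl
  eta _ := A.idc _
  mu _ _ := A.idc _
  top_eta _ := by simp
  bot_eta _ := by simp
  top_mu _ _ := by simp
  bot_mu _ _ := by simp
  eta_nat _ := by simp
  mu_nat _ _ _ _ := by simp
  mu_ass _ _ _ _ _ := by simp
  mu_lunit _ _ := by simp
  mu_runit _ _ := by simp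
  eta_id _ := ⟨rfl, rfl, HEq.rfl, rfl⟩
  mu_id _ _ := ⟨rfl, rfl, HEq.rfl, rfl⟩

/-- The strict double functor sending a span to its foot `1`. -/
@[reducible] def spanTgt : StrictFunctor (Span A) A where
  obj X := SpanObj.r X
  map a := SpanHom.r a
  map_id _ := rfl
  map_comp _ _ := rfl
  mapV x := SpanV.r x
  mapCell α := SpanCell.r α
  top_mapCell _ := rfl
  bot_mapCell _ := rfl
  mapCell_id _ := rfl
  mapCell_comp _ _ := rfl
  eta _ := A.idc _
  mu _ _ := A.idc _
  top_eta _ := by simp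
  bot_eta _ := by simp
  top_mu _ _ := by simp
  bot_mu _ _ := by simp
  eta_nat _ := by simp
  mu_nat _ _ _ _ := by simp
  mu_ass _ _ _ _ _ := by simp
  mu_lunit _ _ := by simp
  mu_runit _ _ := by simp
  eta_id _ := ⟨rfl, rfl, HEq.rfl, rfl⟩
  mu_id _ _ := ⟨rfl, rfl, HEq.rfl, rfl⟩

variable {A} in
theorem span_isIdCell {X Y : SpanObj A} {x y : SpanV X Y} (α : SpanCell x y)
    (hl : IsIdCell α.l) (hm : IsIdCell α.m) (hr : IsIdCell α.r) :
    IsIdCell (D := Span A) α := by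
  obtain ⟨xl, xm, xr, xf, xg, _, _, _, _⟩ := x
  obtain ⟨yl, ym, yr, yf, yg, _, _, _, _⟩ := y
  obtain ⟨l, m, r, wl, wr⟩ := α
  obtain ⟨_, _, h₁, rfl⟩ := hl
  obtain ⟨_, _, h₂, rfl⟩ := hm
  obtain ⟨_, _, h₃, rfl⟩ := hr
  cases h₁; cases h₂; cases h₃
  have el : xf = yf := by simpa using wl
  have er : xg = yg := by simpa using wr
  subst el er
  exact ⟨rfl, rfl, HEq.rfl, rfl⟩

variable {A} in
theorem zig_isIdCell {X Y : ZigObj A} {x y : ZigV X Y} (α : ZigCell x y)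
    (h₀ : IsIdCell α.a₀) (h₃ : IsIdCell α.a₃) (h₁ : IsIdCell α.a₁) (h₄ : IsIdCell α.a₄)
    (h₂ : IsIdCell α.a₂) : IsIdCell (D := Zig A) α := by
  obtain ⟨x₀, x₃, x₁, x₄, x₂, xf, xg, xh, xk, _, _, _, _, _, _, _, _⟩ := x
  obtain ⟨y₀, y₃, y₁, y₄, y₂, yf, yg, yh, yk, _, _, _, _, _, _, _, _⟩ := y
  obtain ⟨_, _, _, _, _, wf, wg, wh, wk⟩ := α
  obtain ⟨_, _, e₀, rfl⟩ := h₀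
  obtain ⟨_, _, e₁, rfl⟩ := h₁
  obtain ⟨_, _, e₂, rfl⟩ := h₂
  obtain ⟨_, _, e₃, rfl⟩ := h₃
  obtain ⟨_, _, e₄, rfl⟩ := h₄
  cases e₀; cases e₁; cases e₂; cases e₃; cases e₄
  have ef : xf = yf := by simpa using wf
  have eg : xg = yg := by simpa using wg
  have eh : xh = yh := by simpa using wh
  have ek : xk = yk := by simpa using wk
  subst ef eg eh ek
  exact ⟨rfl, rfl, HEq.rfl, rfl⟩

/-- The strict double functor of constant diagrams (identity spans). -/
@[reducible] def spanUnit : StrictFunctor A (Span A) where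
  obj B := (⟨B, B, B, 𝟙 B, 𝟙 B⟩ : SpanObj A)
  map f := (⟨f, f, f, by simp, by simp⟩ : SpanHom _ _)
  map_id _ := rfl
  map_comp _ _ := rfl
  mapV x := (⟨x, x, x, A.idc x, A.idc x, by simp, by simp, by simp, by simp⟩ : SpanV _ _)
  mapCell α := (⟨α, α, α, by simp, by simp⟩ : SpanCell _ _)
  top_mapCell _ := rfl
  bot_mapCell _ := rfl
  mapCell_id _ := rfl
  mapCell_comp _ _ := rfl
  eta B := (⟨A.idc (A.vid B), A.idc (A.vid B), A.idc (A.vid B), by simp, by simp⟩ : SpanCell _ _)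
  mu x y := (⟨A.idc (x ⊙ y), A.idc (x ⊙ y), A.idc (x ⊙ y), by simp, by simp⟩ : SpanCell _ _)
  top_eta _ := by ext <;> simp
  bot_eta _ := by ext <;> simp
  top_mu _ _ := by ext <;> simp
  bot_mu _ _ := by ext <;> simp
  eta_nat _ := by ext <;> simp
  mu_nat _ _ _ _ := by ext <;> simp
  mu_ass _ _ _ _ _ := by ext <;> simp
  mu_lunit _ _ := by ext <;> simp
  mu_runit _ _ := by ext <;> simp
  eta_id B := by
    exact span_isIdCell _ ⟨rfl, rfl, HEq.rfl, rfl⟩ ⟨rfl, rfl, HEq.rfl, rfl⟩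
      ⟨rfl, rfl, HEq.rfl, rfl⟩
  mu_id x y := by
    exact span_isIdCell _ ⟨rfl, rfl, HEq.rfl, rfl⟩ ⟨rfl, rfl, HEq.rfl, rfl⟩
      ⟨rfl, rfl, HEq.rfl, rfl⟩

/-- The first half of a composable pair of spans. -/
@[reducible] def zigFst : LaxFunctor (Zig A) (Span A) where
  obj X := (⟨X.a₀, X.a₃, X.a₁, X.f, X.g⟩ : SpanObj A)
  map a := (⟨ZigHom.a₀ a, ZigHom.a₃ a, ZigHom.a₁ a, ZigHom.wf a, ZigHom.wg a⟩ : SpanHom _ _)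
  map_id _ := rfl
  map_comp _ _ := rfl
  mapV x := (⟨x.a₀, x.a₃, x.a₁, x.f, x.g, x.top_f, x.bot_f, x.top_g, x.bot_g⟩ : SpanV _ _)
  mapCell α := (⟨α.a₀, α.a₃, α.a₁, α.wf, α.wg⟩ : SpanCell _ _)
  top_mapCell _ := rfl
  bot_mapCell _ := rfl
  mapCell_id _ := rfl
  mapCell_comp _ _ := rfl
  eta _ := (Span A).idc _
  mu _ _ := (Span A).idc _
  top_eta _ := by ext <;> simp
  bot_eta _ := by ext <;> simp
  top_mu _ _ := by ext <;> simp
  bot_mu _ _ := by ext <;> simp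
  eta_nat _ := by ext <;> simp
  mu_nat _ _ _ _ := by ext <;> simp
  mu_ass _ _ _ _ _ := by ext <;> simp
  mu_lunit _ _ := by ext <;> simp
  mu_runit _ _ := by ext <;> simp

/-- The second half of a composable pair of spans. -/
@[reducible] def zigSnd : LaxFunctor (Zig A) (Span A) where
  obj X := (⟨X.a₁, X.a₄, X.a₂, X.h, X.k⟩ : SpanObj A)
  map a := (⟨ZigHom.a₁ a, ZigHom.a₄ a, ZigHom.a₂ a, ZigHom.wh a, ZigHom.wk a⟩ : SpanHom _ _)
  map_id _ := rfl
  map_comp _ _ := rfl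
  mapV x := (⟨x.a₁, x.a₄, x.a₂, x.h, x.k, x.top_h, x.bot_h, x.top_k, x.bot_k⟩ : SpanV _ _)
  mapCell α := (⟨α.a₁, α.a₄, α.a₂, α.wh, α.wk⟩ : SpanCell _ _)
  top_mapCell _ := rfl
  bot_mapCell _ := rfl
  mapCell_id _ := rfl
  mapCell_comp _ _ := rfl
  eta _ := (Span A).idc _
  mu _ _ := (Span A).idc _
  top_eta _ := by ext <;> simp
  bot_eta _ := by ext <;> simp
  top_mu _ _ := by ext <;> simp
  bot_mu _ _ := by ext <;> simp
  eta_nat _ := by ext <;> simp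
  mu_nat _ _ _ _ := by ext <;> simp
  mu_ass _ _ _ _ _ := by ext <;> simp
  mu_lunit _ _ := by ext <;> simp
  mu_runit _ _ := by ext <;> simp

/-- The canonical comparison from composable pairs of spans to the pullback. -/
@[reducible] def zigToPb : LaxFunctor (Zig A) (Pb (spanTgt A) (spanSrc A)) :=
  Pb.lift (zigFst A) (zigSnd A) (by
    refine LaxFunctor.ext_of rfl (heq_of_eq ?_) (heq_of_eq ?_)
    · funext X; simp
    · funext X Y Z x y; simp)

variable {A} in
theorem zig_h_w {p q : PbObj (spanTgt A) (spanSrc A)} (a : PbHom p q) :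
    (p.snd.f ≫ eqToHom p.w.symm) ≫ SpanHom.r a.fst =
      SpanHom.m a.snd ≫ q.snd.f ≫ eqToHom q.w.symm := by
  have h : SpanHom.r a.fst ≫ eqToHom q.w = eqToHom p.w ≫ SpanHom.l a.snd := a.w
  have h' : eqToHom p.w.symm ≫ SpanHom.r a.fst = SpanHom.l a.snd ≫ eqToHom q.w.symm := by
    rw [← cancel_mono (eqToHom q.w), Category.assoc, h]; simp
  rw [Category.assoc, h', ← Category.assoc, SpanHom.wl a.snd, Category.assoc]

variable {A} in
theorem zig_h_wC {p p' q q' : PbObj (spanTgt A) (spanSrc A)} {x : PbV p p'} {y : PbV q q'}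
    (α : PbCell x y) :
    (SpanV.f x.snd ⊚ eqCell p.w.symm p'.w.symm x.w.symm) ⊚ SpanCell.r α.fst =
      SpanCell.m α.snd ⊚ SpanV.f y.snd ⊚ eqCell q.w.symm q'.w.symm y.w.symm := by
  have h : SpanCell.r α.fst ⊚ eqCell q.w q'.w y.w = eqCell p.w p'.w x.w ⊚ SpanCell.l α.snd := α.w
  have h' : eqCell p.w.symm p'.w.symm x.w.symm ⊚ SpanCell.r α.fst =
      SpanCell.l α.snd ⊚ eqCell q.w.symm q'.w.symm y.w.symm := by
    rw [comp_eqCell_eq_iff] at h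
    rw [h]; simp
  rw [A.assoc', h', ← A.assoc', SpanCell.wl α.snd, A.assoc']

variable {A} in
theorem vcompCell_comp_eqCell {A₀ A₁ A₂ B₀ B₁ B₂ C₀ C₁ C₂ : A.Obj} {x : A.V A₀ A₁}
    {y : A.V A₁ A₂} {x' : A.V B₀ B₁} {y' : A.V B₁ B₂} {x'' : A.V C₀ C₁} {y'' : A.V C₁ C₂}
    (α : A.Cell x x') (β : A.Cell y y') (h : A.bot α = A.top β) (e₀ : B₀ = C₀) (e₁ : B₁ = C₁)
    (e₂ : B₂ = C₂) (hx : HEq x' x'') (hy : HEq y' y'')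
    (h' : A.bot (α ⊚ eqCell e₀ e₁ hx) = A.top (β ⊚ eqCell e₁ e₂ hy))
    (hxy : HEq (x' ⊙ y') (x'' ⊙ y'')) :
    A.vcompCell (α ⊚ eqCell e₀ e₁ hx) (β ⊚ eqCell e₁ e₂ hy) h' =
      A.vcompCell α β h ⊚ eqCell e₀ e₂ hxy := by
  subst e₀ e₁ e₂; cases hx; cases hy; simp

/-- The inverse comparison, from the pullback to composable pairs of spans.  The common foot of
the two spans is taken from the first one, and the second span is attached to it along the equality
of the feet. -/
@[reducible] def pbToZig : LaxFunctor (Pb (spanTgt A) (spanSrc A)) (Zig A) where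
  obj p := (⟨p.fst.l, p.fst.m, p.fst.r, p.snd.m, p.snd.r, p.fst.f, p.fst.g,
    p.snd.f ≫ eqToHom p.w.symm, p.snd.g⟩ : ZigObj A)
  map a := (⟨SpanHom.l (PbHom.fst a), SpanHom.m (PbHom.fst a), SpanHom.r (PbHom.fst a),
    SpanHom.m (PbHom.snd a), SpanHom.r (PbHom.snd a), SpanHom.wl (PbHom.fst a),
    SpanHom.wr (PbHom.fst a), zig_h_w a, SpanHom.wr (PbHom.snd a)⟩ : ZigHom _ _)
  map_id _ := rfl
  map_comp _ _ := rfl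
  mapV {p q} x := (⟨SpanV.l x.fst, SpanV.m x.fst, SpanV.r x.fst, SpanV.m x.snd, SpanV.r x.snd,
    SpanV.f x.fst, SpanV.g x.fst, SpanV.f x.snd ⊚ eqCell p.w.symm q.w.symm x.w.symm,
    SpanV.g x.snd, by simp, by simp, by simp, by simp, by simp, by simp, by simp, by simp⟩ :
    ZigV _ _)
  mapCell α := (⟨SpanCell.l α.fst, SpanCell.m α.fst, SpanCell.r α.fst, SpanCell.m α.snd,
    SpanCell.r α.snd, SpanCell.wl α.fst, SpanCell.wr α.fst, by
      rw [zig_h_wC α], SpanCell.wr α.snd⟩ : ZigCell _ _)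
  top_mapCell _ := rfl
  bot_mapCell _ := rfl
  mapCell_id _ := rfl
  mapCell_comp _ _ := rfl
  eta p := (⟨A.idc (A.vid p.fst.l), A.idc (A.vid p.fst.m), A.idc (A.vid p.fst.r),
    A.idc (A.vid p.snd.m), A.idc (A.vid p.snd.r), by simp, by simp,
    by simp [WeakDbl.vidCell_comp], by simp⟩ : ZigCell _ _)
  mu {p q r} x y := (⟨A.idc (SpanV.l x.fst ⊙ SpanV.l y.fst), A.idc (SpanV.m x.fst ⊙ SpanV.m y.fst),
    A.idc (SpanV.r x.fst ⊙ SpanV.r y.fst), A.idc (SpanV.m x.snd ⊙ SpanV.m y.snd),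
    A.idc (SpanV.r x.snd ⊙ SpanV.r y.snd), by simp, by simp,
    (A.comp_id _).trans ((vcompCell_comp_eqCell _ _ _ _ _ _ _ _ _ _).trans (A.id_comp _).symm),
    by simp⟩ : ZigCell _ _)
  top_eta _ := by ext <;> simp
  bot_eta _ := by ext <;> simp
  top_mu _ _ := by ext <;> simp
  bot_mu _ _ := by ext <;> simp
  eta_nat _ := by ext <;> simp
  mu_nat _ _ _ _ := by ext <;> simp
  mu_ass _ _ _ _ _ := by ext <;> simp
  mu_lunit _ _ := by ext <;> simp
  mu_runit _ _ := by ext <;> simp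

variable {A} (P : LaxPullbackChoice A)

/-- The comparison cell `γ` from the composite of the chosen pullbacks of two vertically composable
pairs of cells to the chosen pullback of the composites. -/
noncomputable def LaxPullbackChoice.gamma {X Y Z : ZigObj A} (x : ZigV X Y) (y : ZigV Y Z) :
    A.Cell (P.pbV x.g x.h x.top_g x.top_h x.bot_g x.bot_h ⊙
        P.pbV y.g y.h y.top_g y.top_h y.bot_g y.bot_h)
      (P.pbV (A.vcompCell x.g y.g (by simp)) (A.vcompCell x.h y.h (by simp)) (f := X.g) (g := X.h)
        (f' := Z.g) (g' := Z.h) (by simp) (by simp) (by simp) (by simp)) :=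
  P.liftC _ _ _ _ _ _
    (A.vcompCell (P.fstC x.g x.h x.top_g x.top_h x.bot_g x.bot_h)
      (P.fstC y.g y.h y.top_g y.top_h y.bot_g y.bot_h) (by simp))
    (A.vcompCell (P.sndC x.g x.h x.top_g x.top_h x.bot_g x.bot_h)
      (P.sndC y.g y.h y.top_g y.top_h y.bot_g y.bot_h) (by simp))
    (vcompCell_square (P.wC _ _ _ _ _ _) (P.wC _ _ _ _ _ _) _ _ _ _)

/-- The comparison cell from the vertical identity of a chosen pullback to the chosen pullback
of the vertical identities. -/
noncomputable def LaxPullbackChoice.gammaId (X : ZigObj A) :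
    A.Cell (A.vid (P.pb X.g X.h))
      (P.pbV (A.vidCell X.g) (A.vidCell X.h) (f := X.g) (g := X.h) (f' := X.g) (g' := X.h)
        (by simp) (by simp) (by simp) (by simp)) :=
  P.liftC _ _ _ _ _ _ (A.vidCell (P.fst X.g X.h)) (A.vidCell (P.snd X.g X.h))
    (by rw [← A.vidCell_comp, ← A.vidCell_comp, P.w])

section
variable {B C D B' C' D' E E' : A.Obj} {x : A.V B B'} {y : A.V C C'} {t : A.V D D'} {s : A.V E E'}
    {f : B ⟶ D} {g : C ⟶ D} {f' : B' ⟶ D'} {g' : C' ⟶ D'} (α : A.Cell x t) (β : A.Cell y t)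
    (h₁ : A.top α = f) (h₂ : A.top β = g) (h₃ : A.bot α = f') (h₄ : A.bot β = g')

@[simp] theorem LaxPullbackChoice.top_liftC (γ : A.Cell s x) (δ : A.Cell s y)
    (h : γ ⊚ α = δ ⊚ β) :
    A.top (P.liftC α β h₁ h₂ h₃ h₄ γ δ h) = P.lift f g (A.top γ) (A.top δ) (by
      have := congrArg A.top h; simpa [h₁, h₂] using this) := by
  apply P.hom_ext
  · have := congrArg A.top (P.liftC_fstC α β h₁ h₂ h₃ h₄ γ δ h)
    rw [A.top_comp, P.top_fstC] at this
    rw [this, P.lift_fst]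
  · have := congrArg A.top (P.liftC_sndC α β h₁ h₂ h₃ h₄ γ δ h)
    rw [A.top_comp, P.top_sndC] at this
    rw [this, P.lift_snd]

@[simp] theorem LaxPullbackChoice.bot_liftC (γ : A.Cell s x) (δ : A.Cell s y)
    (h : γ ⊚ α = δ ⊚ β) :
    A.bot (P.liftC α β h₁ h₂ h₃ h₄ γ δ h) = P.lift f' g' (A.bot γ) (A.bot δ) (by
      have := congrArg A.bot h; simpa [h₃, h₄] using this) := by
  apply P.hom_ext
  · have := congrArg A.bot (P.liftC_fstC α β h₁ h₂ h₃ h₄ γ δ h)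
    rw [A.bot_comp, P.bot_fstC] at this
    rw [this, P.lift_fst]
  · have := congrArg A.bot (P.liftC_sndC α β h₁ h₂ h₃ h₄ γ δ h)
    rw [A.bot_comp, P.bot_sndC] at this
    rw [this, P.lift_snd]

@[simp] theorem LaxPullbackChoice.liftC_fstC_assoc (γ : A.Cell s x) (δ : A.Cell s y)
    (h : γ ⊚ α = δ ⊚ β) {F F' : A.Obj} {r : A.V F F'} (ε : A.Cell x r) :
    P.liftC α β h₁ h₂ h₃ h₄ γ δ h ⊚ P.fstC α β h₁ h₂ h₃ h₄ ⊚ ε = γ ⊚ ε := by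
  rw [← A.assoc', P.liftC_fstC]

@[simp] theorem LaxPullbackChoice.liftC_sndC_assoc (γ : A.Cell s x) (δ : A.Cell s y)
    (h : γ ⊚ α = δ ⊚ β) {F F' : A.Obj} {r : A.V F F'} (ε : A.Cell y r) :
    P.liftC α β h₁ h₂ h₃ h₄ γ δ h ⊚ P.sndC α β h₁ h₂ h₃ h₄ ⊚ ε = δ ⊚ ε := by
  rw [← A.assoc', P.liftC_sndC]

end

@[simp] theorem LaxPullbackChoice.lift_fst_assoc {B C D E F : A.Obj} (f : B ⟶ D) (g : C ⟶ D)
    (a : E ⟶ B) (b : E ⟶ C) (h : a ≫ f = b ≫ g) (e : B ⟶ F) :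
    P.lift f g a b h ≫ P.fst f g ≫ e = a ≫ e := by
  rw [← Category.assoc, P.lift_fst]

@[simp] theorem LaxPullbackChoice.lift_snd_assoc {B C D E F : A.Obj} (f : B ⟶ D) (g : C ⟶ D)
    (a : E ⟶ B) (b : E ⟶ C) (h : a ≫ f = b ≫ g) (e : C ⟶ F) :
    P.lift f g a b h ≫ P.snd f g ≫ e = b ≫ e := by
  rw [← Category.assoc, P.lift_snd]

theorem LaxPullbackChoice.lift_w {X Y : ZigObj A} (a : ZigHom X Y) :
    (P.fst X.g X.h ≫ a.a₃) ≫ Y.g = (P.snd X.g X.h ≫ a.a₄) ≫ Y.h := by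
  rw [Category.assoc, ← a.wg, ← Category.assoc, P.w, Category.assoc, a.wh, Category.assoc]

theorem LaxPullbackChoice.liftC_w {X Y X' Y' : ZigObj A} {x : ZigV X Y} {y : ZigV X' Y'}
    (α : ZigCell x y) :
    (P.fstC x.g x.h x.top_g x.top_h x.bot_g x.bot_h ⊚ α.a₃) ⊚ y.g =
      (P.sndC x.g x.h x.top_g x.top_h x.bot_g x.bot_h ⊚ α.a₄) ⊚ y.h := by
  rw [A.assoc', ← α.wg, ← A.assoc', P.wC, A.assoc', α.wh, A.assoc']

theorem WeakDbl.vcompCell_comp_assoc {A₀ B₀ C₀ A' B' C' A'' B'' C'' F F' : A.Obj} {x : A.V A₀ B₀}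
    {y : A.V B₀ C₀} {x' : A.V A' B'} {y' : A.V B' C'} {x'' : A.V A'' B''} {y'' : A.V B'' C''}
    {s : A.V F F'} (α : A.Cell x x') (α' : A.Cell x' x'') (β : A.Cell y y') (β' : A.Cell y' y'')
    (h : A.bot α = A.top β) (h' : A.bot α' = A.top β') (ε : A.Cell (x'' ⊙ y'') s) :
    A.vcompCell α β h ⊚ A.vcompCell α' β' h' ⊚ ε =
      A.vcompCell (α ⊚ α') (β ⊚ β') (by simp [h, h']) ⊚ ε := by
  rw [A.vcompCell_comp α α' β β' h h', A.assoc']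

/-- Composition of spans, by chosen pullbacks: the lax functor from the double category of composable
pairs of spans in `A` to that of spans in `A`. Its comparison cells are the
universally given comparisons `gamma` and `gammaId` of pullbacks. -/
@[reducible] noncomputable def LaxPullbackChoice.spanComp : LaxFunctor (Zig A) (Span A) where
  obj X := (⟨X.a₀, P.pb X.g X.h, X.a₂, P.fst X.g X.h ≫ X.f, P.snd X.g X.h ≫ X.k⟩ : SpanObj A)
  map {X Y} a := (⟨ZigHom.a₀ a, P.lift Y.g Y.h (P.fst X.g X.h ≫ ZigHom.a₃ a)
    (P.snd X.g X.h ≫ ZigHom.a₄ a) (P.lift_w a), ZigHom.a₂ a,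
    by rw [← Category.assoc, P.lift_fst, Category.assoc, Category.assoc, ZigHom.wf a],
    by rw [← Category.assoc, P.lift_snd, Category.assoc, Category.assoc, ZigHom.wk a]⟩ :
    SpanHom _ _)
  map_id X := by
    ext
    · simp
    · apply P.hom_ext <;> simp
    · simp
  map_comp a b := by
    ext
    · simp
    · apply P.hom_ext <;> simp
    · simp
  mapV x := (⟨x.a₀, P.pbV x.g x.h x.top_g x.top_h x.bot_g x.bot_h, x.a₂,
    P.fstC x.g x.h x.top_g x.top_h x.bot_g x.bot_h ⊚ x.f,
    P.sndC x.g x.h x.top_g x.top_h x.bot_g x.bot_h ⊚ x.k, by simp, by simp, by simp, by simp⟩ :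
    SpanV _ _)
  mapCell {X Y X' Y' x y} α := (⟨α.a₀,
    P.liftC y.g y.h y.top_g y.top_h y.bot_g y.bot_h
      (P.fstC x.g x.h x.top_g x.top_h x.bot_g x.bot_h ⊚ α.a₃)
      (P.sndC x.g x.h x.top_g x.top_h x.bot_g x.bot_h ⊚ α.a₄) (P.liftC_w α), α.a₂,
    by rw [P.liftC_fstC_assoc, A.assoc', A.assoc', α.wf],
    by rw [P.liftC_sndC_assoc, A.assoc', A.assoc', α.wk]⟩ : SpanCell _ _)
  top_mapCell _ := by ext <;> simp
  bot_mapCell _ := by ext <;> simp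
  mapCell_id x := by
    ext
    · rfl
    · apply P.cell_ext <;> simp
    · rfl
  mapCell_comp α β := by
    ext
    · rfl
    · apply P.cell_ext <;> simp
    · rfl
  eta X := (⟨A.idc (A.vid X.a₀), P.gammaId X, A.idc (A.vid X.a₂), by
      rw [LaxPullbackChoice.gammaId, P.liftC_fstC_assoc, ← A.vidCell_comp, A.comp_id], by
      rw [LaxPullbackChoice.gammaId, P.liftC_sndC_assoc, ← A.vidCell_comp, A.comp_id]⟩ :
    SpanCell _ _)
  mu {X Y Z} x y := (⟨A.idc (x.a₀ ⊙ y.a₀), P.gamma x y, A.idc (x.a₂ ⊙ y.a₂), by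
      rw [LaxPullbackChoice.gamma, P.liftC_fstC_assoc, A.comp_id, vcompCell_comp_idc], by
      rw [LaxPullbackChoice.gamma, P.liftC_sndC_assoc, A.comp_id, vcompCell_comp_idc]⟩ :
    SpanCell _ _)
  top_eta X := by
    ext
    · simp
    · apply P.hom_ext <;> simp [LaxPullbackChoice.gammaId]
    · simp
  bot_eta X := by
    ext
    · simp
    · apply P.hom_ext <;> simp [LaxPullbackChoice.gammaId]
    · simp
  top_mu x y := by
    ext
    · simp
    · apply P.hom_ext <;> simp [LaxPullbackChoice.gamma]
    · simp
  bot_mu x y := by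
    ext
    · simp
    · apply P.hom_ext <;> simp [LaxPullbackChoice.gamma]
    · simp
  eta_nat a := by
    ext
    · simp
    · apply P.cell_ext <;> simp [LaxPullbackChoice.gammaId, ← WeakDbl.vidCell_comp]
    · simp
  mu_nat α β h h' := by
    ext
    · simp
    · apply P.cell_ext <;> simp [LaxPullbackChoice.gamma, vcompCell_comp_idc]
    · simp
  mu_ass x y t h h' := by
    ext
    · simp
    · apply P.cell_ext
      · have key := A.ass_nat (P.fstC x.g x.h x.top_g x.top_h x.bot_g x.bot_h)
          (P.fstC y.g y.h y.top_g y.top_h y.bot_g y.bot_h)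
          (P.fstC t.g t.h t.top_g t.top_h t.bot_g t.bot_h)
          (by simp) (by simp) (by simp) (by simp)
        simp [LaxPullbackChoice.gamma, WeakDbl.vcompCell_comp_assoc, ← WeakDbl.vcompCell_comp, key]
      · have key := A.ass_nat (P.sndC x.g x.h x.top_g x.top_h x.bot_g x.bot_h)
          (P.sndC y.g y.h y.top_g y.top_h y.bot_g y.bot_h)
          (P.sndC t.g t.h t.top_g t.top_h t.bot_g t.bot_h)
          (by simp) (by simp) (by simp) (by simp)
        simp [LaxPullbackChoice.gamma, WeakDbl.vcompCell_comp_assoc, ← WeakDbl.vcompCell_comp, key]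
    · simp
  mu_lunit x h := by
    ext
    · simp
    · apply P.cell_ext
      · have key := A.lunit_nat (P.fstC x.g x.h x.top_g x.top_h x.bot_g x.bot_h) (by simp)
        simp only [LaxPullbackChoice.top_fstC] at key
        simp [LaxPullbackChoice.gamma, LaxPullbackChoice.gammaId,
          WeakDbl.vcompCell_comp_assoc, key]
      · have key := A.lunit_nat (P.sndC x.g x.h x.top_g x.top_h x.bot_g x.bot_h) (by simp)
        simp only [LaxPullbackChoice.top_sndC] at key
        simp [LaxPullbackChoice.gamma, LaxPullbackChoice.gammaId,
          WeakDbl.vcompCell_comp_assoc, key]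
    · simp
  mu_runit x h := by
    ext
    · simp
    · apply P.cell_ext
      · have key := A.runit_nat (P.fstC x.g x.h x.top_g x.top_h x.bot_g x.bot_h) (by simp)
        simp only [LaxPullbackChoice.bot_fstC] at key
        simp [LaxPullbackChoice.gamma, LaxPullbackChoice.gammaId,
          WeakDbl.vcompCell_comp_assoc, key]
      · have key := A.runit_nat (P.sndC x.g x.h x.top_g x.top_h x.bot_g x.bot_h) (by simp)
        simp only [LaxPullbackChoice.bot_sndC] at key
        simp [LaxPullbackChoice.gamma, LaxPullbackChoice.gammaId,
          WeakDbl.vcompCell_comp_assoc, key]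
    · simp

/-- The arrows part of the span construction: objects `A`, arrows the spans in `A`. -/
@[reducible] noncomputable def spanPre : LxPrecategory (Span A) A where
  src := spanSrc A
  tgt := spanTgt A
  unit := (spanUnit A).toLaxFunctor
  mul := (pbToZig A).comp P.spanComp
  unit_src := by
    refine LaxFunctor.ext_of rfl (heq_of_eq ?_) (heq_of_eq ?_)
    · funext X; simp
    · funext X Y Z x y; simp
  unit_tgt := by
    refine LaxFunctor.ext_of rfl (heq_of_eq ?_) (heq_of_eq ?_)
    · funext X; simp
    · funext X Y Z x y; simp
  mul_src := by
    refine LaxFunctor.ext_of rfl (heq_of_eq ?_) (heq_of_eq ?_)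
    · funext X; simp
    · funext X Y Z x y; simp
  mul_tgt := by
    refine LaxFunctor.ext_of rfl (heq_of_eq ?_) (heq_of_eq ?_)
    · funext X; simp
    · funext X Y Z x y; simp

/-- The projection of the apex of a composite span to the apex of the first span. -/
@[reducible] noncomputable def spanPr₁ (p : (spanPre P).C₂.Obj) :
    SpanObj.m ((spanPre P).mul.obj p) ⟶ SpanObj.m p.fst :=
  P.fst ((pbToZig A).obj p).g ((pbToZig A).obj p).h

/-- The projection of the apex of a composite span to the apex of the second span. -/
@[reducible] noncomputable def spanPr₂ (p : (spanPre P).C₂.Obj) :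
    SpanObj.m ((spanPre P).mul.obj p) ⟶ SpanObj.m p.snd :=
  P.snd ((pbToZig A).obj p).g ((pbToZig A).obj p).h

/-- The projection of the apex of a composite span of cells to the apex of the first one. -/
@[reducible] noncomputable def spanPrC₁ {p q : (spanPre P).C₂.Obj} (x : (spanPre P).C₂.V p q) :
    A.Cell (SpanV.m ((spanPre P).mul.mapV x)) (SpanV.m x.fst) :=
  P.fstC ((pbToZig A).mapV x).g ((pbToZig A).mapV x).h _ _ _ _

/-- The projection of the apex of a composite span of cells to the apex of the second one. -/
@[reducible] noncomputable def spanPrC₂ {p q : (spanPre P).C₂.Obj} (x : (spanPre P).C₂.V p q) :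
    A.Cell (SpanV.m ((spanPre P).mul.mapV x)) (SpanV.m x.snd) :=
  P.sndC ((pbToZig A).mapV x).g ((pbToZig A).mapV x).h _ _ _ _

end SpanConstruction

end SpanDbl

/-! All the content sits on apices. On feet, `mul` and its constraints are built from identities, so
every equation between arrows or cells of spans comes down to an equation between arrows into chosen
pullbacks of `A₀` or between cells into chosen pullbacks of `A₁`. Because the vertical domain and
codomain preserve the choices, the projection cells in `A₁` have the projection arrows in `A₀` as
tops and bottoms, and the two levels fit together. No compatibility of pullbacks with vertical
composition is needed: a lax comparison only has to map into a pullback, and the universal property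
in `A₁` provides such a cell.

The carrying observation is that the two projections of a composite span respect the whole lax
structure. They commute with `mul` on arrows and cells (`mul_map_pr₁`, `mul_mapCell_pr₁`) and with
its comparison cells (`mul_eta_pr₁`, `mul_mu_pr₁`, and the versions for the second projection). The
equations for the comparison cells are at the same time the description of the interchangers `δ` and
`χ`. In the language of `IsApexTrans`, the projections are horizontal transformations on apices.

The projections are also jointly monic. Hence a family of arrows and cells into a composite apex is
a transformation as soon as its two components are (`IsApexTrans.of_comp`, `IsApexTrans.of_pr`). The
components of the associativity constraint are obtained from projections, and the unit constraints
are themselves projections, so all the transformation axioms for them follow without further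
calculation. For associativity the inverse is the rebracketing in the other direction; for the units
it exists because one factor of the pullback has an identity leg.

The pentagon and the triangle compare maps between iterated pullbacks. Both sides have the same
projection to every single factor, so they agree. The pentagon is settled by splitting off one
factor at a time (`pentagon_apex`, `pentagon_tail`, `pentagon_last`).

That the diagrams `0 ← 3 → 1 ← 4 → 2` form the pullback is a matter of bookkeeping. In a pair of the
pullback the two middle feet are only propositionally equal, so `pbToZig` attaches the second span
along that equality; both round trips are then identities, checked component by component. The
interchangers `μ` and `τ` are identities because constant spans form a strict double functor. -/

namespace SpanDbl

open WeakDbl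

/-! ### Invertibility of horizontal transformations from invertible components. -/

section Inverse

universe u₁ v₁ w₁ z₁ u₂ v₂ w₂ z₂

variable {D : WeakDbl.{u₁, v₁, w₁, z₁}} {E : WeakDbl.{u₂, v₂, w₂, z₂}}

/-- A one-sided inverse suffices for cancellation. It lets the axioms of an inverse transformation
be checked after composition with a component of the original one. -/
theorem WeakDbl.cancel_right {A A' B B' C C' : E.Obj} {x : E.V A A'} {y : E.V B B'} {t : E.V C C'}
    {α β : E.Cell x y} {γ : E.Cell y t} {γi : E.Cell t y} (hγ : γ ⊚ γi = E.idc y)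
    (h : α ⊚ γ = β ⊚ γ) : α = β := by
  rw [← E.comp_id α, ← E.comp_id β, ← hγ, ← E.assoc', h, E.assoc']

/-- A horizontal transformation with invertible components is invertible. -/
theorem HTrans.invertible_of_components {G H : LaxFunctor D E} (φ : HTrans G H)
    (app : ∀ A : D.Obj, H.obj A ⟶ G.obj A)
    (cell : ∀ {A B : D.Obj} (x : D.V A B), E.Cell (H.mapV x) (G.mapV x))
    (h₁ : ∀ A, φ.app A ≫ app A = 𝟙 _) (h₂ : ∀ A, app A ≫ φ.app A = 𝟙 _)
    (h₃ : ∀ {A B : D.Obj} (x : D.V A B), φ.cell x ⊚ cell x = E.idc _)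
    (h₄ : ∀ {A B : D.Obj} (x : D.V A B), cell x ⊚ φ.cell x = E.idc _) : φ.Invertible := by
  -- The boundary of the inverse cell need not be assumed: its top is a left inverse of `φ.app A`,
  -- whose right inverse is `app A`, so the two coincide. The same argument gives the bottom.
  have top_cell : ∀ {A B : D.Obj} (x : D.V A B), E.top (cell x) = app A := by
    intro A B x
    have := congrArg E.top (h₄ x)
    rw [E.top_comp, φ.top_cell, E.top_idc] at this
    rw [← Category.comp_id (E.top (cell x)), ← h₁, ← Category.assoc, this, Category.id_comp]
  have bot_cell : ∀ {A B : D.Obj} (x : D.V A B), E.bot (cell x) = app B := by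
    intro A B x
    have := congrArg E.bot (h₄ x)
    rw [E.bot_comp, φ.bot_cell, E.bot_idc] at this
    rw [← Category.comp_id (E.bot (cell x)), ← h₁, ← Category.assoc, this, Category.id_comp]
  -- Each remaining axiom is the corresponding axiom of `φ` conjugated by the inverse components. On
  -- cells, composing on the right with a component of `φ`, which can be cancelled, makes that axiom
  -- applicable.
  refine ⟨⟨app, cell, top_cell, bot_cell, ?_, ?_, ?_, ?_⟩, h₁, h₂, h₃, h₄⟩
  · intro A B f
    rw [← Category.id_comp (H.map f), ← h₂, Category.assoc, Category.assoc,
      ← Category.assoc (φ.app A), ← φ.app_nat, Category.assoc, h₁, Category.comp_id]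
  · intro A A' B B' x y α
    apply cancel_right (h₃ y)
    rw [E.assoc', h₄, E.comp_id, E.assoc', φ.cell_nat, ← E.assoc', h₄, E.id_comp]
  · intro A
    apply cancel_right (h₃ (D.vid A))
    rw [E.assoc', h₄, E.comp_id, E.assoc', φ.cell_eta, ← E.assoc', ← E.vidCell_comp, h₂,
      E.vidCell_id, E.id_comp]
  · intro A B C x y h
    apply cancel_right (h₃ (x ⊙ y))
    have hb : E.bot (φ.cell x) = E.top (φ.cell y) := by rw [φ.bot_cell, φ.top_cell]
    rw [E.assoc', h₄, E.comp_id, E.assoc', φ.cell_mu x y hb, ← E.assoc', vcompCell_comp_idc]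
    -- Interchange has gathered both inverse pairs inside one vertical composite, which is therefore
    -- an identity.
    rw [vcompCell_congr _ (h₄ x) (h₄ y) (by simp), E.vcompCell_id, E.id_comp]

end Inverse

/-! ### Transformations on apices and the universal property of composite spans. -/

section Apex

universe u v w z u' v' w' z'

variable {A : WeakDbl.{u, v, w, z}} {D : WeakDbl.{u', v', w', z'}}

/-- A horizontal transformation between the apices of two families of spans. -/
structure IsApexTrans (G H : LaxFunctor D (Span A))
    (app : ∀ X : D.Obj, (G.obj X).m ⟶ (H.obj X).m)
    (cell : ∀ {X Y : D.Obj} (x : D.V X Y), A.Cell (G.mapV x).m (H.mapV x).m) : Prop where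
  top_cell : ∀ {X Y : D.Obj} (x : D.V X Y), A.top (cell x) = app X
  bot_cell : ∀ {X Y : D.Obj} (x : D.V X Y), A.bot (cell x) = app Y
  app_nat : ∀ {X Y : D.Obj} (f : X ⟶ Y),
    SpanHom.m (G.map f) ≫ app Y = app X ≫ SpanHom.m (H.map f)
  cell_nat : ∀ {X X' Y Y' : D.Obj} {x : D.V X X'} {y : D.V Y Y'} (α : D.Cell x y),
    SpanCell.m (G.mapCell α) ⊚ cell y = cell x ⊚ SpanCell.m (H.mapCell α)
  cell_eta : ∀ X : D.Obj,
    SpanCell.m (G.eta X) ⊚ cell (D.vid X) = A.vidCell (app X) ⊚ SpanCell.m (H.eta X)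
  cell_mu : ∀ {X Y Z : D.Obj} (x : D.V X Y) (y : D.V Y Z),
    SpanCell.m (G.mu x y) ⊚ cell (x ⊙ y) =
      A.vcompCell (cell x) (cell y) ((bot_cell x).trans (top_cell y).symm) ⊚ SpanCell.m (H.mu x y)

namespace IsApexTrans

variable {G H K K' : LaxFunctor D (Span A)}
  {a : ∀ X : D.Obj, (G.obj X).m ⟶ (H.obj X).m}
  {c : ∀ {X Y : D.Obj} (x : D.V X Y), A.Cell (G.mapV x).m (H.mapV x).m}
  {b : ∀ X : D.Obj, (H.obj X).m ⟶ (K.obj X).m}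
  {d : ∀ {X Y : D.Obj} (x : D.V X Y), A.Cell (H.mapV x).m (K.mapV x).m}
  {b' : ∀ X : D.Obj, (H.obj X).m ⟶ (K'.obj X).m}
  {d' : ∀ {X Y : D.Obj} (x : D.V X Y), A.Cell (H.mapV x).m (K'.mapV x).m}

theorem comp (h : IsApexTrans G H a c) (k : IsApexTrans H K b d) :
    IsApexTrans G K (fun X => a X ≫ b X) (fun x => c x ⊚ d x) where
  top_cell x := by rw [A.top_comp, h.top_cell, k.top_cell]
  bot_cell x := by rw [A.bot_comp, h.bot_cell, k.bot_cell]
  app_nat f := by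
    rw [← Category.assoc, h.app_nat, Category.assoc, k.app_nat, Category.assoc]
  cell_nat α := by rw [← A.assoc', h.cell_nat, A.assoc', k.cell_nat, A.assoc']
  cell_eta X := by
    rw [← A.assoc', h.cell_eta, A.assoc', k.cell_eta, A.vidCell_comp, A.assoc']
  cell_mu x y := by
    rw [← A.assoc', h.cell_mu, A.assoc', k.cell_mu, ← A.assoc', vcompCell_comp_idc]

/-- A family of arrows and cells which becomes a transformation after composition with two jointly
monic transformations is a transformation. -/
theorem of_comp (k : IsApexTrans H K b d) (k' : IsApexTrans H K' b' d')
    (ext : ∀ {X : D.Obj} {E : A.Obj} {f g : E ⟶ (H.obj X).m},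
      f ≫ b X = g ≫ b X → f ≫ b' X = g ≫ b' X → f = g)
    (extC : ∀ {X Y : D.Obj} {x : D.V X Y} {E E' : A.Obj} {s : A.V E E'}
      {γ δ : A.Cell s (H.mapV x).m}, γ ⊚ d x = δ ⊚ d x → γ ⊚ d' x = δ ⊚ d' x → γ = δ)
    (h : IsApexTrans G K (fun X => a X ≫ b X) (fun x => c x ⊚ d x))
    (h' : IsApexTrans G K' (fun X => a X ≫ b' X) (fun x => c x ⊚ d' x)) :
    IsApexTrans G H a c := by
  -- The boundaries come before the other axioms, because the vertical composite in the axiom for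
  -- `mu` makes sense only once they are known. They too are tested on the two projections.
  have top_cell : ∀ {X Y : D.Obj} (x : D.V X Y), A.top (c x) = a X := fun {X Y} x => ext
    (by have := h.top_cell x; rwa [A.top_comp, k.top_cell] at this)
    (by have := h'.top_cell x; rwa [A.top_comp, k'.top_cell] at this)
  have bot_cell : ∀ {X Y : D.Obj} (x : D.V X Y), A.bot (c x) = a Y := fun {X Y} x => ext
    (by have := h.bot_cell x; rwa [A.bot_comp, k.bot_cell] at this)
    (by have := h'.bot_cell x; rwa [A.bot_comp, k'.bot_cell] at this)
  refine ⟨top_cell, bot_cell, fun f => ext ?_ ?_, fun α => extC ?_ ?_, fun X => extC ?_ ?_,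
    fun x y => extC ?_ ?_⟩
  -- In each case the axiom of the projected family and the axiom of the projection have a common
  -- side, and comparing them gives the axiom for `a` and `c` after projection.
  · rw [Category.assoc, h.app_nat, Category.assoc, Category.assoc, k.app_nat]
  · rw [Category.assoc, h'.app_nat, Category.assoc, Category.assoc, k'.app_nat]
  · rw [A.assoc', h.cell_nat, A.assoc', A.assoc', k.cell_nat]
  · rw [A.assoc', h'.cell_nat, A.assoc', A.assoc', k'.cell_nat]
  · rw [A.assoc', h.cell_eta, A.assoc', k.cell_eta, A.vidCell_comp, A.assoc']
  · rw [A.assoc', h'.cell_eta, A.assoc', k'.cell_eta, A.vidCell_comp, A.assoc']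
  · rw [A.assoc', h.cell_mu, A.assoc', k.cell_mu, ← A.assoc', vcompCell_comp_idc]
  · rw [A.assoc', h'.cell_mu, A.assoc', k'.cell_mu, ← A.assoc', vcompCell_comp_idc]

end IsApexTrans

variable (P : LaxPullbackChoice A)

/-- The pullback square of the composite. In `pbToZig` the equality of the middle feet is absorbed
into the left leg of the second span; here it is moved to the right leg of the first, the form in
which compatibility conditions arise for iterated composites. -/
theorem spanPr_w (p : (spanPre P).C₂.Obj) :
    spanPr₁ P p ≫ SpanObj.g p.fst ≫ eqToHom p.w = spanPr₂ P p ≫ SpanObj.f p.snd := by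
  have h : spanPr₁ P p ≫ SpanObj.g p.fst = spanPr₂ P p ≫ SpanObj.f p.snd ≫ eqToHom p.w.symm :=
    P.w _ _
  rw [← Category.assoc, h]
  simp

theorem spanPrC_w {p q : (spanPre P).C₂.Obj} (x : (spanPre P).C₂.V p q) :
    spanPrC₁ P x ⊚ SpanV.g x.fst ⊚ eqCell p.w q.w x.w = spanPrC₂ P x ⊚ SpanV.f x.snd := by
  have h : spanPrC₁ P x ⊚ SpanV.g x.fst =
    spanPrC₂ P x ⊚ SpanV.f x.snd ⊚ eqCell p.w.symm q.w.symm x.w.symm := P.wC _ _ _ _ _ _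
  rw [← A.assoc', h]
  simp

/-- The arrow into the apex of a composite span with given components. -/
noncomputable def apexLift (p : (spanPre P).C₂.Obj) {E : A.Obj} (a : E ⟶ SpanObj.m p.fst)
    (b : E ⟶ SpanObj.m p.snd)
    (h : a ≫ SpanObj.g p.fst ≫ eqToHom p.w = b ≫ SpanObj.f p.snd) :
    E ⟶ SpanObj.m ((spanPre P).mul.obj p) :=
  P.lift ((pbToZig A).obj p).g ((pbToZig A).obj p).h a b (by
    -- The chosen pullback is formed over the middle foot of the first span, so the transport
    -- returns to the second leg.
    show a ≫ SpanObj.g p.fst = b ≫ SpanObj.f p.snd ≫ eqToHom p.w.symm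
    rw [← Category.assoc b, ← h]; simp)

/-- The cell into the apex of a composite span of cells with given components. -/
noncomputable def apexLiftC {p q : (spanPre P).C₂.Obj} (x : (spanPre P).C₂.V p q) {E E' : A.Obj}
    {s : A.V E E'} (α : A.Cell s (SpanV.m x.fst)) (β : A.Cell s (SpanV.m x.snd))
    (h : α ⊚ SpanV.g x.fst ⊚ eqCell p.w q.w x.w = β ⊚ SpanV.f x.snd) :
    A.Cell s (SpanV.m ((spanPre P).mul.mapV x)) :=
  P.liftC ((pbToZig A).mapV x).g ((pbToZig A).mapV x).h _ _ _ _ α β (by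
    show α ⊚ SpanV.g x.fst = β ⊚ SpanV.f x.snd ⊚ eqCell p.w.symm q.w.symm x.w.symm
    rw [← A.assoc' β, ← h]; simp)

section
variable {p : (spanPre P).C₂.Obj} {E : A.Obj} (a : E ⟶ SpanObj.m p.fst) (b : E ⟶ SpanObj.m p.snd)
  (h : a ≫ SpanObj.g p.fst ≫ eqToHom p.w = b ≫ SpanObj.f p.snd)

theorem apexLift_pr₁ : apexLift P p a b h ≫ spanPr₁ P p = a := P.lift_fst _ _ _ _ _

theorem apexLift_pr₂ : apexLift P p a b h ≫ spanPr₂ P p = b := P.lift_snd _ _ _ _ _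

/-- Joint monicity of the projections, the uniqueness half of the universal property. Iterated, it
shows that the canonical constraints are determined by their projections. -/
theorem apex_hom_ext {a b : E ⟶ SpanObj.m ((spanPre P).mul.obj p)}
    (h₁ : a ≫ spanPr₁ P p = b ≫ spanPr₁ P p) (h₂ : a ≫ spanPr₂ P p = b ≫ spanPr₂ P p) : a = b :=
  P.hom_ext h₁ h₂

end

section
variable {p q : (spanPre P).C₂.Obj} {x : (spanPre P).C₂.V p q} {E E' : A.Obj} {s : A.V E E'}
  (α : A.Cell s (SpanV.m x.fst)) (β : A.Cell s (SpanV.m x.snd))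
  (h : α ⊚ SpanV.g x.fst ⊚ eqCell p.w q.w x.w = β ⊚ SpanV.f x.snd)

theorem apexLiftC_pr₁ : apexLiftC P x α β h ⊚ spanPrC₁ P x = α := P.liftC_fstC _ _ _ _ _ _ _ _ _

theorem apexLiftC_pr₂ : apexLiftC P x α β h ⊚ spanPrC₂ P x = β := P.liftC_sndC _ _ _ _ _ _ _ _ _

theorem apex_cell_ext {α β : A.Cell s (SpanV.m ((spanPre P).mul.mapV x))}
    (h₁ : α ⊚ spanPrC₁ P x = β ⊚ spanPrC₁ P x) (h₂ : α ⊚ spanPrC₂ P x = β ⊚ spanPrC₂ P x) :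
    α = β :=
  P.cell_ext h₁ h₂

end

/-- On apices `mul` acts by the universal arrow between chosen pullbacks, so this is the defining
equation of that arrow. -/
theorem mul_map_pr₁ {p q : (spanPre P).C₂.Obj} (f : p ⟶ q) :
    SpanHom.m ((spanPre P).mul.map f) ≫ spanPr₁ P q = spanPr₁ P p ≫ SpanHom.m (PbHom.fst f) :=
  P.lift_fst _ _ _ _ _

theorem mul_map_pr₂ {p q : (spanPre P).C₂.Obj} (f : p ⟶ q) :
    SpanHom.m ((spanPre P).mul.map f) ≫ spanPr₂ P q = spanPr₂ P p ≫ SpanHom.m (PbHom.snd f) :=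
  P.lift_snd _ _ _ _ _

section
variable {p q p' q' : (spanPre P).C₂.Obj} {x : (spanPre P).C₂.V p q} {y : (spanPre P).C₂.V p' q'}
  (α : (spanPre P).C₂.Cell x y)

theorem mul_mapCell_pr₁ :
    SpanCell.m ((spanPre P).mul.mapCell α) ⊚ spanPrC₁ P y =
      spanPrC₁ P x ⊚ SpanCell.m (PbCell.fst α) :=
  P.liftC_fstC _ _ _ _ _ _ _ _ _

theorem mul_mapCell_pr₂ :
    SpanCell.m ((spanPre P).mul.mapCell α) ⊚ spanPrC₂ P y =
      spanPrC₂ P x ⊚ SpanCell.m (PbCell.snd α) :=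
  P.liftC_sndC _ _ _ _ _ _ _ _ _

end

/-- This describes the interchanger `δ`. The comparison cell of `mul` is `gammaId` followed by the
image of the comparison cell of `pbToZig`. The latter has identity components, so it disappears
after projection, and what remains is the defining equation of `gammaId`. -/
theorem mul_eta_pr₁ (p : (spanPre P).C₂.Obj) :
    SpanCell.m ((spanPre P).mul.eta p) ⊚ spanPrC₁ P ((spanPre P).C₂.vid p) =
      A.vidCell (spanPr₁ P p) := by
  have h₂ : P.gammaId ((pbToZig A).obj p) ⊚ P.fstC _ _ _ _ _ _ = A.vidCell (spanPr₁ P p) :=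
    P.liftC_fstC _ _ _ _ _ _ _ _ _
  -- This factor is not literally an identity cell: its source and target are pullbacks of
  -- differently presented cells, one with the transport inside `vidCell` and one with it outside.
  -- Only its projections are visibly trivial.
  have h₁ : SpanCell.m (P.spanComp.mapCell ((pbToZig A).eta p)) ⊚
      spanPrC₁ P ((spanPre P).C₂.vid p) = P.fstC _ _ _ _ _ _ ⊚ A.idc _ :=
    P.liftC_fstC _ _ _ _ _ _ _ _ _
  refine (A.assoc' _ _ _).trans ((congrArg (A.comp _) (h₁.trans (A.comp_id _))).trans h₂)

theorem mul_eta_pr₂ (p : (spanPre P).C₂.Obj) :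
    SpanCell.m ((spanPre P).mul.eta p) ⊚ spanPrC₂ P ((spanPre P).C₂.vid p) =
      A.vidCell (spanPr₂ P p) := by
  have h₂ : P.gammaId ((pbToZig A).obj p) ⊚ P.sndC _ _ _ _ _ _ = A.vidCell (spanPr₂ P p) :=
    P.liftC_sndC _ _ _ _ _ _ _ _ _
  have h₁ : SpanCell.m (P.spanComp.mapCell ((pbToZig A).eta p)) ⊚
      spanPrC₂ P ((spanPre P).C₂.vid p) = P.sndC _ _ _ _ _ _ ⊚ A.idc _ :=
    P.liftC_sndC _ _ _ _ _ _ _ _ _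
  refine (A.assoc' _ _ _).trans ((congrArg (A.comp _) (h₁.trans (A.comp_id _))).trans h₂)

section
variable {p q r : (spanPre P).C₂.Obj} (x : (spanPre P).C₂.V p q) (y : (spanPre P).C₂.V q r)

/-- This describes the interchanger `χ`, with `gamma` in the role that `gammaId` has for `δ`. -/
theorem mul_mu_pr₁ (h : A.bot (spanPrC₁ P x) = A.top (spanPrC₁ P y)) :
    SpanCell.m ((spanPre P).mul.mu x y) ⊚ spanPrC₁ P ((spanPre P).C₂.vcomp x y) =
      A.vcompCell (spanPrC₁ P x) (spanPrC₁ P y) h := by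
  have h₂ : P.gamma ((pbToZig A).mapV x) ((pbToZig A).mapV y) ⊚ P.fstC _ _ _ _ _ _ =
      A.vcompCell (spanPrC₁ P x) (spanPrC₁ P y) h :=
    P.liftC_fstC _ _ _ _ _ _ _ _ _
  have h₁ : SpanCell.m (P.spanComp.mapCell ((pbToZig A).mu x y)) ⊚
      spanPrC₁ P ((spanPre P).C₂.vcomp x y) = P.fstC _ _ _ _ _ _ ⊚ A.idc _ :=
    P.liftC_fstC _ _ _ _ _ _ _ _ _
  refine (A.assoc' _ _ _).trans ((congrArg (A.comp _) (h₁.trans (A.comp_id _))).trans h₂)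

theorem mul_mu_pr₂ (h : A.bot (spanPrC₂ P x) = A.top (spanPrC₂ P y)) :
    SpanCell.m ((spanPre P).mul.mu x y) ⊚ spanPrC₂ P ((spanPre P).C₂.vcomp x y) =
      A.vcompCell (spanPrC₂ P x) (spanPrC₂ P y) h := by
  have h₂ : P.gamma ((pbToZig A).mapV x) ((pbToZig A).mapV y) ⊚ P.sndC _ _ _ _ _ _ =
      A.vcompCell (spanPrC₂ P x) (spanPrC₂ P y) h :=
    P.liftC_sndC _ _ _ _ _ _ _ _ _
  have h₁ : SpanCell.m (P.spanComp.mapCell ((pbToZig A).mu x y)) ⊚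
      spanPrC₂ P ((spanPre P).C₂.vcomp x y) = P.sndC _ _ _ _ _ _ ⊚ A.idc _ :=
    P.liftC_sndC _ _ _ _ _ _ _ _ _
  refine (A.assoc' _ _ _).trans ((congrArg (A.comp _) (h₁.trans (A.comp_id _))).trans h₂)

end

/-- The first projection of the composite of two families of spans. -/
theorem isApexTrans_pr₁ (L : LaxFunctor D (spanPre P).C₂) :
    IsApexTrans (L.comp (spanPre P).mul) (L.comp (spanPre P).fst₂)
      (fun X => spanPr₁ P (L.obj X)) (fun x => spanPrC₁ P (L.mapV x)) where
  top_cell x := P.top_fstC _ _ _ _ _ _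
  bot_cell x := P.bot_fstC _ _ _ _ _ _
  app_nat f := mul_map_pr₁ P (L.map f)
  cell_nat α := mul_mapCell_pr₁ P (L.mapCell α)
  cell_eta X := by
    -- The comparison cells of the two composite functors are unfolded. The strict functor `fst₂`
    -- contributes only an identity, and the cell coming from `L` slides past the projection.
    show (SpanCell.m ((spanPre P).mul.eta (L.obj X)) ⊚
      SpanCell.m ((spanPre P).mul.mapCell (L.eta X))) ⊚ _ =
        A.vidCell (spanPr₁ P (L.obj X)) ⊚ A.idc _ ⊚ SpanCell.m (PbCell.fst (L.eta X))
    rw [A.assoc', mul_mapCell_pr₁, ← A.assoc', mul_eta_pr₁, A.id_comp]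
  cell_mu {X Y Z} x y := by
    show (SpanCell.m ((spanPre P).mul.mu (L.mapV x) (L.mapV y)) ⊚
      SpanCell.m ((spanPre P).mul.mapCell (L.mu x y))) ⊚ _ =
        A.vcompCell (spanPrC₁ P (L.mapV x)) (spanPrC₁ P (L.mapV y)) _ ⊚ A.idc _ ⊚
          SpanCell.m (PbCell.fst (L.mu x y))
    rw [A.assoc', mul_mapCell_pr₁, ← A.assoc', mul_mu_pr₁, A.id_comp]

/-- The second projection of the composite of two families of spans. -/
theorem isApexTrans_pr₂ (L : LaxFunctor D (spanPre P).C₂) :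
    IsApexTrans (L.comp (spanPre P).mul) (L.comp (spanPre P).snd₂)
      (fun X => spanPr₂ P (L.obj X)) (fun x => spanPrC₂ P (L.mapV x)) where
  top_cell x := P.top_sndC _ _ _ _ _ _
  bot_cell x := P.bot_sndC _ _ _ _ _ _
  app_nat f := mul_map_pr₂ P (L.map f)
  cell_nat α := mul_mapCell_pr₂ P (L.mapCell α)
  cell_eta X := by
    show (SpanCell.m ((spanPre P).mul.eta (L.obj X)) ⊚
      SpanCell.m ((spanPre P).mul.mapCell (L.eta X))) ⊚ _ =
        A.vidCell (spanPr₂ P (L.obj X)) ⊚ A.idc _ ⊚ SpanCell.m (PbCell.snd (L.eta X))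
    rw [A.assoc', mul_mapCell_pr₂, ← A.assoc', mul_eta_pr₂, A.id_comp]
  cell_mu {X Y Z} x y := by
    show (SpanCell.m ((spanPre P).mul.mu (L.mapV x) (L.mapV y)) ⊚
      SpanCell.m ((spanPre P).mul.mapCell (L.mu x y))) ⊚ _ =
        A.vcompCell (spanPrC₂ P (L.mapV x)) (spanPrC₂ P (L.mapV y)) _ ⊚ A.idc _ ⊚
          SpanCell.m (PbCell.snd (L.mu x y))
    rw [A.assoc', mul_mapCell_pr₂, ← A.assoc', mul_mu_pr₂, A.id_comp]

section
variable (H K : LaxFunctor D (Span A))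
  (h : H.comp (spanTgt A).toLaxFunctor = K.comp (spanSrc A).toLaxFunctor)

/-- The target is `H` itself instead of the lift followed by `fst₂`. The two functors agree by
definition except in their comparison cells, where composition leaves a redundant identity to be
removed. This form lets projections be chained through iterated lifts. -/
theorem isApexTrans_lift_pr₁ :
    IsApexTrans ((Pb.lift H K h).comp (spanPre P).mul) H
      (fun X => spanPr₁ P ((Pb.lift H K h).obj X))
      (fun x => spanPrC₁ P ((Pb.lift H K h).mapV x)) where
  top_cell := (isApexTrans_pr₁ P (Pb.lift H K h)).top_cell
  bot_cell := (isApexTrans_pr₁ P (Pb.lift H K h)).bot_cell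
  app_nat := (isApexTrans_pr₁ P (Pb.lift H K h)).app_nat
  cell_nat := (isApexTrans_pr₁ P (Pb.lift H K h)).cell_nat
  cell_eta X := ((isApexTrans_pr₁ P (Pb.lift H K h)).cell_eta X).trans
    (congrArg (A.comp _) (A.id_comp _))
  cell_mu x y := ((isApexTrans_pr₁ P (Pb.lift H K h)).cell_mu x y).trans
    (congrArg (A.comp _) (A.id_comp _))

theorem isApexTrans_lift_pr₂ :
    IsApexTrans ((Pb.lift H K h).comp (spanPre P).mul) K
      (fun X => spanPr₂ P ((Pb.lift H K h).obj X))
      (fun x => spanPrC₂ P ((Pb.lift H K h).mapV x)) where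
  top_cell := (isApexTrans_pr₂ P (Pb.lift H K h)).top_cell
  bot_cell := (isApexTrans_pr₂ P (Pb.lift H K h)).bot_cell
  app_nat := (isApexTrans_pr₂ P (Pb.lift H K h)).app_nat
  cell_nat := (isApexTrans_pr₂ P (Pb.lift H K h)).cell_nat
  cell_eta X := ((isApexTrans_pr₂ P (Pb.lift H K h)).cell_eta X).trans
    (congrArg (A.comp _) (A.id_comp _))
  cell_mu x y := ((isApexTrans_pr₂ P (Pb.lift H K h)).cell_mu x y).trans
    (congrArg (A.comp _) (A.id_comp _))

variable {H K h} in
/-- A family of arrows and cells into the composite of two families of spans is a transformation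
if its components are. -/
theorem IsApexTrans.of_pr {G : LaxFunctor D (Span A)}
    {a : ∀ X : D.Obj, (G.obj X).m ⟶ (((Pb.lift H K h).comp (spanPre P).mul).obj X).m}
    {c : ∀ {X Y : D.Obj} (x : D.V X Y),
      A.Cell (G.mapV x).m (((Pb.lift H K h).comp (spanPre P).mul).mapV x).m}
    {b : ∀ X : D.Obj, (G.obj X).m ⟶ (H.obj X).m}
    {d : ∀ {X Y : D.Obj} (x : D.V X Y), A.Cell (G.mapV x).m (H.mapV x).m}
    {b' : ∀ X : D.Obj, (G.obj X).m ⟶ (K.obj X).m}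
    {d' : ∀ {X Y : D.Obj} (x : D.V X Y), A.Cell (G.mapV x).m (K.mapV x).m}
    (hb : IsApexTrans G H b d) (hb' : IsApexTrans G K b' d')
    (h₁ : ∀ X, a X ≫ spanPr₁ P ((Pb.lift H K h).obj X) = b X)
    (h₂ : ∀ X, a X ≫ spanPr₂ P ((Pb.lift H K h).obj X) = b' X)
    (h₃ : ∀ {X Y : D.Obj} (x : D.V X Y), c x ⊚ spanPrC₁ P ((Pb.lift H K h).mapV x) = d x)
    (h₄ : ∀ {X Y : D.Obj} (x : D.V X Y), c x ⊚ spanPrC₂ P ((Pb.lift H K h).mapV x) = d' x) :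
    IsApexTrans G ((Pb.lift H K h).comp (spanPre P).mul) a c := by
  -- The given components are replaced by the actual composites with the projections, to which
  -- `of_comp` applies.
  obtain rfl : _ = b := funext h₁
  obtain rfl : _ = b' := funext h₂
  obtain rfl : @_ = @d := funext fun X => funext fun Y => funext fun x => h₃ x
  obtain rfl : @_ = @d' := funext fun X => funext fun Y => funext fun x => h₄ x
  exact (isApexTrans_lift_pr₁ P H K h).of_comp (isApexTrans_lift_pr₂ P H K h)
    (fun e e' => apex_hom_ext P e e') (fun e e' => apex_cell_ext P e e') hb hb'

end

end Apex

/-! ### Rebracketing of iterated pullbacks. -/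

section SpanConstraints

universe u v w z

variable {A : WeakDbl.{u, v, w, z}} (P : LaxPullbackChoice A)

/-! The canonical constraints on apices. -/

/-- The projection of the apex of `(x ∘ y) ∘ z` to the apex of `y ∘ z`. -/
noncomputable def tailApex (p : (spanPre P).C₃.Obj) :
    SpanObj.m ((spanPre P).mul.obj ((spanPre P).mulL.obj p)) ⟶
      SpanObj.m ((spanPre P).mul.obj ((spanPre P).tail₃.obj p)) :=
  apexLift P ((spanPre P).tail₃.obj p)
    (spanPr₁ P ((spanPre P).mulL.obj p) ≫ spanPr₂ P p.fst)
    (spanPr₂ P ((spanPre P).mulL.obj p)) (by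
      -- The right leg of `x ∘ y` is the second projection followed by the right leg of `y`, so the
      -- outer pullback square over the foot shared with `z` is already the condition required.
      have h : spanPr₁ P ((spanPre P).mulL.obj p) ≫
        (spanPr₂ P p.fst ≫ SpanObj.g p.fst.snd) ≫ eqToHom p.w = _ :=
          spanPr_w P ((spanPre P).mulL.obj p)
      rw [Category.assoc] at h ⊢
      exact h)

theorem tailApex_pr₁ (p : (spanPre P).C₃.Obj) : tailApex P p ≫ spanPr₁ P ((spanPre P).tail₃.obj p) =
    spanPr₁ P ((spanPre P).mulL.obj p) ≫ spanPr₂ P p.fst :=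
  apexLift_pr₁ P (p := (spanPre P).tail₃.obj p) _ _ _

theorem tailApex_pr₂ (p : (spanPre P).C₃.Obj) : tailApex P p ≫ spanPr₂ P ((spanPre P).tail₃.obj p) =
    spanPr₂ P ((spanPre P).mulL.obj p) :=
  apexLift_pr₂ P (p := (spanPre P).tail₃.obj p) _ _ _

/-- The projection of the apex of `(x ∘ y) ∘ z` to the apex of `y ∘ z`, for spans of cells. -/
noncomputable def tailApexC {p q : (spanPre P).C₃.Obj} (x : (spanPre P).C₃.V p q) :
    A.Cell (SpanV.m ((spanPre P).mul.mapV ((spanPre P).mulL.mapV x)))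
      (SpanV.m ((spanPre P).mul.mapV ((spanPre P).tail₃.mapV x))) :=
  apexLiftC P ((spanPre P).tail₃.mapV x)
    (spanPrC₁ P ((spanPre P).mulL.mapV x) ⊚ spanPrC₂ P x.fst)
    (spanPrC₂ P ((spanPre P).mulL.mapV x)) (by
      have h : spanPrC₁ P ((spanPre P).mulL.mapV x) ⊚
        (spanPrC₂ P x.fst ⊚ SpanV.g x.fst.snd) ⊚ eqCell p.w q.w x.w = _ :=
          spanPrC_w P ((spanPre P).mulL.mapV x)
      rw [A.assoc'] at h ⊢
      exact h)

theorem tailApexC_pr₁ {p q : (spanPre P).C₃.Obj} (x : (spanPre P).C₃.V p q) :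
    tailApexC P x ⊚ spanPrC₁ P ((spanPre P).tail₃.mapV x) =
    spanPrC₁ P ((spanPre P).mulL.mapV x) ⊚ spanPrC₂ P x.fst :=
  apexLiftC_pr₁ P (x := (spanPre P).tail₃.mapV x) _ _ _

theorem tailApexC_pr₂ {p q : (spanPre P).C₃.Obj} (x : (spanPre P).C₃.V p q) :
    tailApexC P x ⊚ spanPrC₂ P ((spanPre P).tail₃.mapV x) =
    spanPrC₂ P ((spanPre P).mulL.mapV x) :=
  apexLiftC_pr₂ P (x := (spanPre P).tail₃.mapV x) _ _ _

/-- The associativity constraint on apices. -/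
noncomputable def assocApex (p : (spanPre P).C₃.Obj) :
    SpanObj.m ((spanPre P).mul.obj ((spanPre P).mulL.obj p)) ⟶
      SpanObj.m ((spanPre P).mul.obj ((spanPre P).mulR.obj p)) :=
  apexLift P ((spanPre P).mulR.obj p)
    (spanPr₁ P ((spanPre P).mulL.obj p) ≫ spanPr₁ P p.fst) (tailApex P p) (by
      show (spanPr₁ P ((spanPre P).mulL.obj p) ≫ spanPr₁ P p.fst) ≫ SpanObj.g p.fst.fst ≫
        eqToHom p.fst.w = tailApex P p ≫ spanPr₁ P ((spanPre P).tail₃.obj p) ≫ SpanObj.f p.fst.snd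
      -- The inner pullback square of `x ∘ y` replaces the leg of `x` by the leg of `y`; both sides
      -- then factor through the projection to `y`, where `tailApex_pr₁` compares them.
      rw [Category.assoc, spanPr_w, ← Category.assoc, ← Category.assoc]
      exact congrArg (· ≫ SpanObj.f p.fst.snd) (tailApex_pr₁ P p).symm)

theorem assocApex_pr₁ (p : (spanPre P).C₃.Obj) :
    assocApex P p ≫ spanPr₁ P ((spanPre P).mulR.obj p) =
    spanPr₁ P ((spanPre P).mulL.obj p) ≫ spanPr₁ P p.fst :=
  apexLift_pr₁ P (p := (spanPre P).mulR.obj p) _ _ _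

theorem assocApex_pr₂ (p : (spanPre P).C₃.Obj) :
    assocApex P p ≫ spanPr₂ P ((spanPre P).mulR.obj p) = tailApex P p :=
  apexLift_pr₂ P (p := (spanPre P).mulR.obj p) _ _ _

/-- The associativity constraint on apices of spans of cells. -/
noncomputable def assocApexC {p q : (spanPre P).C₃.Obj} (x : (spanPre P).C₃.V p q) :
    A.Cell (SpanV.m ((spanPre P).mul.mapV ((spanPre P).mulL.mapV x)))
      (SpanV.m ((spanPre P).mul.mapV ((spanPre P).mulR.mapV x))) :=
  apexLiftC P ((spanPre P).mulR.mapV x)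
    (spanPrC₁ P ((spanPre P).mulL.mapV x) ⊚ spanPrC₁ P x.fst) (tailApexC P x) (by
      show (spanPrC₁ P ((spanPre P).mulL.mapV x) ⊚ spanPrC₁ P x.fst) ⊚ SpanV.g x.fst.fst ⊚
        eqCell p.fst.w q.fst.w x.fst.w =
          tailApexC P x ⊚ spanPrC₁ P ((spanPre P).tail₃.mapV x) ⊚ SpanV.f x.fst.snd
      rw [A.assoc', spanPrC_w, ← A.assoc', ← A.assoc']
      exact congrArg (A.comp · (SpanV.f x.fst.snd)) (tailApexC_pr₁ P x).symm)

theorem assocApexC_pr₁ {p q : (spanPre P).C₃.Obj} (x : (spanPre P).C₃.V p q) :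
    assocApexC P x ⊚ spanPrC₁ P ((spanPre P).mulR.mapV x) =
    spanPrC₁ P ((spanPre P).mulL.mapV x) ⊚ spanPrC₁ P x.fst :=
  apexLiftC_pr₁ P (x := (spanPre P).mulR.mapV x) _ _ _

theorem assocApexC_pr₂ {p q : (spanPre P).C₃.Obj} (x : (spanPre P).C₃.V p q) :
    assocApexC P x ⊚ spanPrC₂ P ((spanPre P).mulR.mapV x) = tailApexC P x :=
  apexLiftC_pr₂ P (x := (spanPre P).mulR.mapV x) _ _ _

/-- The projection of the apex of `x ∘ (y ∘ z)` to the apex of `x ∘ y`. -/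
noncomputable def initApex (p : (spanPre P).C₃.Obj) :
    SpanObj.m ((spanPre P).mul.obj ((spanPre P).mulR.obj p)) ⟶
      SpanObj.m ((spanPre P).mul.obj p.fst) :=
  apexLift P p.fst (spanPr₁ P ((spanPre P).mulR.obj p))
    (spanPr₂ P ((spanPre P).mulR.obj p) ≫ spanPr₁ P ((spanPre P).tail₃.obj p)) (by
      rw [Category.assoc]
      -- The left leg of `y ∘ z` passes through `y`, so the outer square of `x ∘ (y ∘ z)` is the
      -- square needed for `x ∘ y`.
      exact spanPr_w P ((spanPre P).mulR.obj p))

theorem initApex_pr₁ (p : (spanPre P).C₃.Obj) :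
    initApex P p ≫ spanPr₁ P p.fst = spanPr₁ P ((spanPre P).mulR.obj p) :=
  apexLift_pr₁ P (p := p.fst) _ _ _

theorem initApex_pr₂ (p : (spanPre P).C₃.Obj) : initApex P p ≫ spanPr₂ P p.fst =
    spanPr₂ P ((spanPre P).mulR.obj p) ≫ spanPr₁ P ((spanPre P).tail₃.obj p) :=
  apexLift_pr₂ P (p := p.fst) _ _ _

/-- The projection of the apex of `x ∘ (y ∘ z)` to the apex of `x ∘ y`, for spans of cells. -/
noncomputable def initApexC {p q : (spanPre P).C₃.Obj} (x : (spanPre P).C₃.V p q) :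
    A.Cell (SpanV.m ((spanPre P).mul.mapV ((spanPre P).mulR.mapV x)))
      (SpanV.m ((spanPre P).mul.mapV x.fst)) :=
  apexLiftC P x.fst (spanPrC₁ P ((spanPre P).mulR.mapV x))
    (spanPrC₂ P ((spanPre P).mulR.mapV x) ⊚ spanPrC₁ P ((spanPre P).tail₃.mapV x)) (by
      rw [A.assoc']
      exact spanPrC_w P ((spanPre P).mulR.mapV x))

theorem initApexC_pr₁ {p q : (spanPre P).C₃.Obj} (x : (spanPre P).C₃.V p q) :
    initApexC P x ⊚ spanPrC₁ P x.fst = spanPrC₁ P ((spanPre P).mulR.mapV x) :=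
  apexLiftC_pr₁ P (x := x.fst) _ _ _

theorem initApexC_pr₂ {p q : (spanPre P).C₃.Obj} (x : (spanPre P).C₃.V p q) :
    initApexC P x ⊚ spanPrC₂ P x.fst =
    spanPrC₂ P ((spanPre P).mulR.mapV x) ⊚ spanPrC₁ P ((spanPre P).tail₃.mapV x) :=
  apexLiftC_pr₂ P (x := x.fst) _ _ _

/-- The inverse of the associativity constraint on apices. -/
noncomputable def assocInvApex (p : (spanPre P).C₃.Obj) :
    SpanObj.m ((spanPre P).mul.obj ((spanPre P).mulR.obj p)) ⟶
      SpanObj.m ((spanPre P).mul.obj ((spanPre P).mulL.obj p)) :=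
  apexLift P ((spanPre P).mulL.obj p) (initApex P p)
    (spanPr₂ P ((spanPre P).mulR.obj p) ≫ spanPr₂ P ((spanPre P).tail₃.obj p)) (by
      show initApex P p ≫ (spanPr₂ P p.fst ≫ SpanObj.g p.fst.snd) ≫ eqToHom p.w = _
      -- Dually to `assocApex`, the condition over the foot between `y` and `z` comes from the inner
      -- square of `y ∘ z`.
      have h : spanPr₁ P ((spanPre P).tail₃.obj p) ≫ SpanObj.g p.fst.snd ≫ eqToHom p.w =
        spanPr₂ P ((spanPre P).tail₃.obj p) ≫ SpanObj.f p.snd :=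
          spanPr_w P ((spanPre P).tail₃.obj p)
      rw [Category.assoc, Category.assoc, ← h, ← Category.assoc, ← Category.assoc (spanPr₂ P _)]
      exact congrArg (· ≫ SpanObj.g p.fst.snd ≫ eqToHom p.w) (initApex_pr₂ P p))

theorem assocInvApex_pr₁ (p : (spanPre P).C₃.Obj) :
    assocInvApex P p ≫ spanPr₁ P ((spanPre P).mulL.obj p) = initApex P p :=
  apexLift_pr₁ P (p := (spanPre P).mulL.obj p) _ _ _

theorem assocInvApex_pr₂ (p : (spanPre P).C₃.Obj) :
    assocInvApex P p ≫ spanPr₂ P ((spanPre P).mulL.obj p) =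
    spanPr₂ P ((spanPre P).mulR.obj p) ≫ spanPr₂ P ((spanPre P).tail₃.obj p) :=
  apexLift_pr₂ P (p := (spanPre P).mulL.obj p) _ _ _

/-- The inverse of the associativity constraint on apices of spans of cells. -/
noncomputable def assocInvApexC {p q : (spanPre P).C₃.Obj} (x : (spanPre P).C₃.V p q) :
    A.Cell (SpanV.m ((spanPre P).mul.mapV ((spanPre P).mulR.mapV x)))
      (SpanV.m ((spanPre P).mul.mapV ((spanPre P).mulL.mapV x))) :=
  apexLiftC P ((spanPre P).mulL.mapV x) (initApexC P x)
    (spanPrC₂ P ((spanPre P).mulR.mapV x) ⊚ spanPrC₂ P ((spanPre P).tail₃.mapV x)) (by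
      show initApexC P x ⊚ (spanPrC₂ P x.fst ⊚ SpanV.g x.fst.snd) ⊚ eqCell p.w q.w x.w = _
      have h : spanPrC₁ P ((spanPre P).tail₃.mapV x) ⊚ SpanV.g x.fst.snd ⊚ eqCell p.w q.w x.w =
        spanPrC₂ P ((spanPre P).tail₃.mapV x) ⊚ SpanV.f x.snd :=
          spanPrC_w P ((spanPre P).tail₃.mapV x)
      rw [A.assoc', A.assoc', ← h, ← A.assoc', ← A.assoc' (spanPrC₂ P _)]
      exact congrArg (A.comp · (SpanV.g x.fst.snd ⊚ eqCell p.w q.w x.w)) (initApexC_pr₂ P x))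

theorem assocInvApexC_pr₁ {p q : (spanPre P).C₃.Obj} (x : (spanPre P).C₃.V p q) :
    assocInvApexC P x ⊚ spanPrC₁ P ((spanPre P).mulL.mapV x) = initApexC P x :=
  apexLiftC_pr₁ P (x := (spanPre P).mulL.mapV x) _ _ _

theorem assocInvApexC_pr₂ {p q : (spanPre P).C₃.Obj} (x : (spanPre P).C₃.V p q) :
    assocInvApexC P x ⊚ spanPrC₂ P ((spanPre P).mulL.mapV x) =
    spanPrC₂ P ((spanPre P).mulR.mapV x) ⊚ spanPrC₂ P ((spanPre P).tail₃.mapV x) :=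
  apexLiftC_pr₂ P (x := (spanPre P).mulL.mapV x) _ _ _

section
variable (p : (spanPre P).C₃.Obj)

/-- One half of an inverse law. When `assocInvApex` followed by `assocApex` is projected to `y ∘ z`,
this composite appears; it is determined by its projections to `y` and to `z`. -/
theorem assocInvApex_tailApex :
    assocInvApex P p ≫ tailApex P p = spanPr₂ P ((spanPre P).mulR.obj p) := by
  apply apex_hom_ext P (p := (spanPre P).tail₃.obj p)
  · rw [Category.assoc, tailApex_pr₁, ← Category.assoc, assocInvApex_pr₁]
    exact initApex_pr₂ P p
  · rw [Category.assoc, tailApex_pr₂]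
    exact assocInvApex_pr₂ P p

/-- The mirror image, needed for the other inverse law: here the test is on the projections to `x`
and to `y`. -/
theorem assocApex_initApex :
    assocApex P p ≫ initApex P p = spanPr₁ P ((spanPre P).mulL.obj p) := by
  apply apex_hom_ext P (p := p.fst)
  · rw [Category.assoc, initApex_pr₁]
    exact assocApex_pr₁ P p
  · rw [Category.assoc, initApex_pr₂, ← Category.assoc, assocApex_pr₂]
    exact tailApex_pr₁ P p

theorem assocApex_assocInvApex : assocApex P p ≫ assocInvApex P p = 𝟙 _ := by
  apply apex_hom_ext P (p := (spanPre P).mulL.obj p)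
  · rw [Category.assoc, assocInvApex_pr₁, Category.id_comp]
    exact assocApex_initApex P p
  · rw [Category.assoc, assocInvApex_pr₂, ← Category.assoc, assocApex_pr₂, Category.id_comp]
    exact tailApex_pr₂ P p

theorem assocInvApex_assocApex : assocInvApex P p ≫ assocApex P p = 𝟙 _ := by
  apply apex_hom_ext P (p := (spanPre P).mulR.obj p)
  · rw [Category.assoc, assocApex_pr₁, ← Category.assoc, assocInvApex_pr₁, Category.id_comp]
    exact initApex_pr₁ P p
  · rw [Category.assoc, assocApex_pr₂, Category.id_comp]
    exact assocInvApex_tailApex P p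

end

section
variable {p q : (spanPre P).C₃.Obj} (x : (spanPre P).C₃.V p q)

theorem assocInvApexC_tailApexC :
    assocInvApexC P x ⊚ tailApexC P x = spanPrC₂ P ((spanPre P).mulR.mapV x) := by
  apply apex_cell_ext P (x := (spanPre P).tail₃.mapV x)
  · rw [A.assoc', tailApexC_pr₁, ← A.assoc', assocInvApexC_pr₁]
    exact initApexC_pr₂ P x
  · rw [A.assoc', tailApexC_pr₂]
    exact assocInvApexC_pr₂ P x

theorem assocApexC_initApexC :
    assocApexC P x ⊚ initApexC P x = spanPrC₁ P ((spanPre P).mulL.mapV x) := by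
  apply apex_cell_ext P (x := x.fst)
  · rw [A.assoc', initApexC_pr₁]
    exact assocApexC_pr₁ P x
  · rw [A.assoc', initApexC_pr₂, ← A.assoc', assocApexC_pr₂]
    exact tailApexC_pr₁ P x

theorem assocApexC_assocInvApexC : assocApexC P x ⊚ assocInvApexC P x = A.idc _ := by
  apply apex_cell_ext P (x := (spanPre P).mulL.mapV x)
  · rw [A.assoc', assocInvApexC_pr₁, A.id_comp]
    exact assocApexC_initApexC P x
  · rw [A.assoc', assocInvApexC_pr₂, ← A.assoc', assocApexC_pr₂, A.id_comp]
    exact tailApexC_pr₂ P x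

theorem assocInvApexC_assocApexC : assocInvApexC P x ⊚ assocApexC P x = A.idc _ := by
  apply apex_cell_ext P (x := (spanPre P).mulR.mapV x)
  · rw [A.assoc', assocApexC_pr₁, ← A.assoc', assocInvApexC_pr₁, A.id_comp]
    exact initApexC_pr₁ P x
  · rw [A.assoc', assocApexC_pr₂, A.id_comp]
    exact assocInvApexC_tailApexC P x

end

/-- Its components are the projections to `y`, a composite of two projections, and to `z`. Both are
transformations, so joint monicity does the rest. -/
theorem isApexTrans_tailApex :
    IsApexTrans ((spanPre P).mulL.comp (spanPre P).mul) ((spanPre P).tail₃.comp (spanPre P).mul)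
      (tailApex P) (tailApexC P) :=
  IsApexTrans.of_pr P
    ((isApexTrans_lift_pr₁ P _ _ _).comp (isApexTrans_pr₂ P (spanPre P).init₃))
    (isApexTrans_lift_pr₂ P _ _ _) (tailApex_pr₁ P) (tailApex_pr₂ P)
    (tailApexC_pr₁ P) (tailApexC_pr₂ P)

/-- The components are the projections to `x` and to `y ∘ z`, the second being `tailApex`. This
contains the naturality of the associativity constraint and its compatibility with the interchangers
`χ` and `δ`. -/
theorem isApexTrans_assocApex :
    IsApexTrans ((spanPre P).mulL.comp (spanPre P).mul) ((spanPre P).mulR.comp (spanPre P).mul)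
      (assocApex P) (assocApexC P) :=
  IsApexTrans.of_pr P
    ((isApexTrans_lift_pr₁ P _ _ _).comp (isApexTrans_pr₁ P (spanPre P).init₃))
    (isApexTrans_tailApex P) (assocApex_pr₁ P) (assocApex_pr₂ P)
    (assocApexC_pr₁ P) (assocApexC_pr₂ P)

end SpanConstraints

/-! ### Associativity and unit constraints as invertible transformations. -/

section SpanPseudocategory

universe u v w z

variable {A : WeakDbl.{u, v, w, z}} (P : LaxPullbackChoice A)

/-- The associativity constraint of the composition of spans. -/
noncomputable def spanAssoc : HTrans ((spanPre P).mulL.comp (spanPre P).mul)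
    ((spanPre P).mulR.comp (spanPre P).mul) where
  -- Both bracketings have the same outer feet by definition, so identities can be used there. The
  -- proofs check the two legs, which factor through the projections to `x` and to `z`.
  app p := (⟨𝟙 (SpanObj.l p.fst.fst), assocApex P p, 𝟙 (SpanObj.r p.snd), by
      show (spanPr₁ P ((spanPre P).mulL.obj p) ≫ spanPr₁ P p.fst ≫ SpanObj.f p.fst.fst) ≫ 𝟙 _ =
        assocApex P p ≫ spanPr₁ P ((spanPre P).mulR.obj p) ≫ SpanObj.f p.fst.fst
      rw [← Category.assoc (assocApex P p), assocApex_pr₁, Category.comp_id, Category.assoc], by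
      show (spanPr₂ P ((spanPre P).mulL.obj p) ≫ SpanObj.g p.snd) ≫ 𝟙 _ =
        assocApex P p ≫ spanPr₂ P ((spanPre P).mulR.obj p) ≫
          spanPr₂ P ((spanPre P).tail₃.obj p) ≫ SpanObj.g p.snd
      rw [← Category.assoc (assocApex P p), assocApex_pr₂, ← Category.assoc (tailApex P p),
        tailApex_pr₂, Category.comp_id]⟩ : SpanHom
      ((spanPre P).mul.obj ((spanPre P).mulL.obj p))
      ((spanPre P).mul.obj ((spanPre P).mulR.obj p)))
  cell x := (⟨A.idc (SpanV.l x.fst.fst), assocApexC P x, A.idc (SpanV.r x.snd), by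
      show (spanPrC₁ P ((spanPre P).mulL.mapV x) ⊚ spanPrC₁ P x.fst ⊚ SpanV.f x.fst.fst) ⊚
          A.idc _ =
        assocApexC P x ⊚ spanPrC₁ P ((spanPre P).mulR.mapV x) ⊚ SpanV.f x.fst.fst
      rw [← A.assoc' (assocApexC P x), assocApexC_pr₁, A.comp_id, A.assoc'], by
      show (spanPrC₂ P ((spanPre P).mulL.mapV x) ⊚ SpanV.g x.snd) ⊚ A.idc _ =
        assocApexC P x ⊚ spanPrC₂ P ((spanPre P).mulR.mapV x) ⊚
          spanPrC₂ P ((spanPre P).tail₃.mapV x) ⊚ SpanV.g x.snd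
      rw [← A.assoc' (assocApexC P x), assocApexC_pr₂, ← A.assoc' (tailApexC P x),
        tailApexC_pr₂, A.comp_id]⟩ : SpanCell
      ((spanPre P).mul.mapV ((spanPre P).mulL.mapV x))
      ((spanPre P).mul.mapV ((spanPre P).mulR.mapV x)))
  top_cell x := by
    -- In this axiom and the following ones, the apex component is an axiom of `IsApexTrans`, and
    -- the feet involve only identities and equal composites.
    refine SpanHom.ext ?_ ((isApexTrans_assocApex P).top_cell x) ?_ <;> simp
  bot_cell x := by
    refine SpanHom.ext ?_ ((isApexTrans_assocApex P).bot_cell x) ?_ <;> simp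
  app_nat f := by
    refine SpanHom.ext ?_ ((isApexTrans_assocApex P).app_nat f) ?_ <;> simp
  cell_nat α := by
    refine SpanCell.ext ?_ ((isApexTrans_assocApex P).cell_nat α) ?_ <;> simp
  cell_eta p := by
    refine SpanCell.ext ?_ ((isApexTrans_assocApex P).cell_eta p) ?_ <;> simp
  cell_mu x y h := by
    refine SpanCell.ext ?_ ((isApexTrans_assocApex P).cell_mu x y) ?_ <;> simp

theorem spanAssoc_invertible : (spanAssoc P).Invertible := by
  refine HTrans.invertible_of_components _
    (fun p => (⟨𝟙 _, assocInvApex P p, 𝟙 _, ?_, ?_⟩ : SpanHom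
      ((spanPre P).mul.obj ((spanPre P).mulR.obj p))
      ((spanPre P).mul.obj ((spanPre P).mulL.obj p))))
    (fun x => (⟨A.idc _, assocInvApexC P x, A.idc _, ?_, ?_⟩ : SpanCell
      ((spanPre P).mul.mapV ((spanPre P).mulR.mapV x))
      ((spanPre P).mul.mapV ((spanPre P).mulL.mapV x))))
    (fun p => SpanHom.ext (Category.id_comp _) (assocApex_assocInvApex P p) (Category.id_comp _))
    (fun p => SpanHom.ext (Category.id_comp _) (assocInvApex_assocApex P p) (Category.id_comp _))
    (fun x => SpanCell.ext (A.id_comp _) (assocApexC_assocInvApexC P x) (A.id_comp _))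
    (fun x => SpanCell.ext (A.id_comp _) (assocInvApexC_assocApexC P x) (A.id_comp _))
  -- It remains to see that the inverse on apices respects the legs: the left one through `x` and
  -- the right one through `z`, first for arrows and then for cells.
  · show (spanPr₁ P ((spanPre P).mulR.obj p) ≫ SpanObj.f p.fst.fst) ≫ 𝟙 _ =
      assocInvApex P p ≫ spanPr₁ P ((spanPre P).mulL.obj p) ≫ spanPr₁ P p.fst ≫ SpanObj.f p.fst.fst
    rw [← Category.assoc (assocInvApex P p), assocInvApex_pr₁, ← Category.assoc (initApex P p),
        initApex_pr₁, Category.comp_id]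
  · show (spanPr₂ P ((spanPre P).mulR.obj p) ≫ spanPr₂ P ((spanPre P).tail₃.obj p) ≫
      SpanObj.g p.snd) ≫ 𝟙 _ = assocInvApex P p ≫ spanPr₂ P ((spanPre P).mulL.obj p) ≫
        SpanObj.g p.snd
    rw [← Category.assoc (assocInvApex P p), assocInvApex_pr₂, Category.comp_id, Category.assoc]
  · show (spanPrC₁ P ((spanPre P).mulR.mapV x) ⊚ SpanV.f x.fst.fst) ⊚ A.idc _ =
      assocInvApexC P x ⊚ spanPrC₁ P ((spanPre P).mulL.mapV x) ⊚ spanPrC₁ P x.fst ⊚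
        SpanV.f x.fst.fst
    rw [← A.assoc' (assocInvApexC P x), assocInvApexC_pr₁, ← A.assoc' (initApexC P x),
        initApexC_pr₁, A.comp_id]
  · show (spanPrC₂ P ((spanPre P).mulR.mapV x) ⊚ spanPrC₂ P ((spanPre P).tail₃.mapV x) ⊚
      SpanV.g x.snd) ⊚ A.idc _ = assocInvApexC P x ⊚ spanPrC₂ P ((spanPre P).mulL.mapV x) ⊚
        SpanV.g x.snd
    rw [← A.assoc' (assocInvApexC P x), assocInvApexC_pr₂, A.comp_id, A.assoc']

/-- The first factor is an identity span, so the pullback square determines the first projection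
from the second. This is why the second projection is invertible. In `h`, one identity is the leg of
the constant span and the other is the transport between the middle feet. -/
theorem unitL_w (s : SpanObj A) :
    spanPr₁ P ((spanPre P).unitL.obj s) = spanPr₂ P ((spanPre P).unitL.obj s) ≫ s.f := by
  have h : _ ≫ 𝟙 s.l ≫ 𝟙 s.l = _ := spanPr_w P ((spanPre P).unitL.obj s)
  rwa [Category.comp_id, Category.comp_id] at h

theorem unitLC_w {s t : SpanObj A} (x : SpanV s t) :
    spanPrC₁ P ((spanPre P).unitL.mapV x) = spanPrC₂ P ((spanPre P).unitL.mapV x) ⊚ x.f := by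
  have h : _ ⊚ A.idc x.l ⊚ A.idc x.l = _ := spanPrC_w P ((spanPre P).unitL.mapV x)
  rwa [A.comp_id, A.comp_id] at h

/-- Symmetrically, the identity span is now the second factor, and the first projection determines
the second. -/
theorem unitR_w (s : SpanObj A) :
    spanPr₁ P ((spanPre P).unitR.obj s) ≫ s.g = spanPr₂ P ((spanPre P).unitR.obj s) := by
  have h : _ ≫ s.g ≫ 𝟙 s.r = _ ≫ 𝟙 s.r := spanPr_w P ((spanPre P).unitR.obj s)
  rwa [Category.comp_id, Category.comp_id] at h

theorem unitRC_w {s t : SpanObj A} (x : SpanV s t) :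
    spanPrC₁ P ((spanPre P).unitR.mapV x) ⊚ x.g = spanPrC₂ P ((spanPre P).unitR.mapV x) := by
  have h : _ ⊚ x.g ⊚ A.idc x.r = _ ⊚ A.idc x.r := spanPrC_w P ((spanPre P).unitR.mapV x)
  rwa [A.comp_id, A.comp_id] at h

/-- The inverse of the left unit constraint on apices. -/
noncomputable def unitLInv (s : SpanObj A) :
    s.m ⟶ SpanObj.m ((spanPre P).mul.obj ((spanPre P).unitL.obj s)) :=
  apexLift P ((spanPre P).unitL.obj s) s.f (𝟙 s.m) (by
    show s.f ≫ 𝟙 _ ≫ 𝟙 _ = 𝟙 _ ≫ s.f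
    simp)

/-- The inverse of the left unit constraint on apices of spans of cells. -/
noncomputable def unitLInvC {s t : SpanObj A} (x : SpanV s t) :
    A.Cell x.m (SpanV.m ((spanPre P).mul.mapV ((spanPre P).unitL.mapV x))) :=
  apexLiftC P ((spanPre P).unitL.mapV x) x.f (A.idc x.m) (by
    show x.f ⊚ A.idc _ ⊚ A.idc _ = A.idc _ ⊚ x.f
    simp)

/-- The inverse of the right unit constraint on apices. -/
noncomputable def unitRInv (s : SpanObj A) :
    s.m ⟶ SpanObj.m ((spanPre P).mul.obj ((spanPre P).unitR.obj s)) :=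
  apexLift P ((spanPre P).unitR.obj s) (𝟙 s.m) s.g (by
    show 𝟙 _ ≫ s.g ≫ 𝟙 _ = s.g ≫ 𝟙 _
    simp)

/-- The inverse of the right unit constraint on apices of spans of cells. -/
noncomputable def unitRInvC {s t : SpanObj A} (x : SpanV s t) :
    A.Cell x.m (SpanV.m ((spanPre P).mul.mapV ((spanPre P).unitR.mapV x))) :=
  apexLiftC P ((spanPre P).unitR.mapV x) (A.idc x.m) x.g (by
    show A.idc _ ⊚ x.g ⊚ A.idc _ = x.g ⊚ A.idc _
    simp)

section
variable (s : SpanObj A)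

theorem unitLInv_pr₁ : unitLInv P s ≫ spanPr₁ P ((spanPre P).unitL.obj s) = s.f :=
  apexLift_pr₁ P (p := (spanPre P).unitL.obj s) _ _ _

theorem unitLInv_pr₂ : unitLInv P s ≫ spanPr₂ P ((spanPre P).unitL.obj s) = 𝟙 s.m :=
  apexLift_pr₂ P (p := (spanPre P).unitL.obj s) _ _ _

theorem unitRInv_pr₁ : unitRInv P s ≫ spanPr₁ P ((spanPre P).unitR.obj s) = 𝟙 s.m :=
  apexLift_pr₁ P (p := (spanPre P).unitR.obj s) _ _ _

theorem unitRInv_pr₂ : unitRInv P s ≫ spanPr₂ P ((spanPre P).unitR.obj s) = s.g :=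
  apexLift_pr₂ P (p := (spanPre P).unitR.obj s) _ _ _

/-- Only this inverse law needs an argument, and it rests on `unitL_w`; the other one is
`unitLInv_pr₂`, true by construction. -/
theorem pr_unitLInv : spanPr₂ P ((spanPre P).unitL.obj s) ≫ unitLInv P s = 𝟙 _ := by
  apply apex_hom_ext P (p := (spanPre P).unitL.obj s)
  · rw [Category.assoc, unitLInv_pr₁, Category.id_comp, unitL_w]
  · rw [Category.assoc, unitLInv_pr₂, Category.id_comp]
    exact Category.comp_id _

theorem pr_unitRInv : spanPr₁ P ((spanPre P).unitR.obj s) ≫ unitRInv P s = 𝟙 _ := by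
  apply apex_hom_ext P (p := (spanPre P).unitR.obj s)
  · rw [Category.assoc, unitRInv_pr₁, Category.id_comp]
    exact Category.comp_id _
  · rw [Category.assoc, unitRInv_pr₂, Category.id_comp, unitR_w]

end

section
variable {s t : SpanObj A} (x : SpanV s t)

theorem unitLInvC_pr₁ : unitLInvC P x ⊚ spanPrC₁ P ((spanPre P).unitL.mapV x) = x.f :=
  apexLiftC_pr₁ P (x := (spanPre P).unitL.mapV x) _ _ _

theorem unitLInvC_pr₂ : unitLInvC P x ⊚ spanPrC₂ P ((spanPre P).unitL.mapV x) = A.idc x.m :=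
  apexLiftC_pr₂ P (x := (spanPre P).unitL.mapV x) _ _ _

theorem unitRInvC_pr₁ : unitRInvC P x ⊚ spanPrC₁ P ((spanPre P).unitR.mapV x) = A.idc x.m :=
  apexLiftC_pr₁ P (x := (spanPre P).unitR.mapV x) _ _ _

theorem unitRInvC_pr₂ : unitRInvC P x ⊚ spanPrC₂ P ((spanPre P).unitR.mapV x) = x.g :=
  apexLiftC_pr₂ P (x := (spanPre P).unitR.mapV x) _ _ _

theorem prC_unitLInvC : spanPrC₂ P ((spanPre P).unitL.mapV x) ⊚ unitLInvC P x = A.idc _ := by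
  apply apex_cell_ext P (x := (spanPre P).unitL.mapV x)
  · rw [A.assoc', unitLInvC_pr₁, A.id_comp, unitLC_w]
  · rw [A.assoc', unitLInvC_pr₂, A.id_comp]
    exact A.comp_id _

theorem prC_unitRInvC : spanPrC₁ P ((spanPre P).unitR.mapV x) ⊚ unitRInvC P x = A.idc _ := by
  apply apex_cell_ext P (x := (spanPre P).unitR.mapV x)
  · rw [A.assoc', unitRInvC_pr₁, A.id_comp]
    exact A.comp_id _
  · rw [A.assoc', unitRInvC_pr₂, A.id_comp, unitRC_w]

end

/-- The left unit constraint of the composition of spans. -/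
noncomputable def spanLeft :
    HTrans ((spanPre P).unitL.comp (spanPre P).mul) (LaxFunctor.id (Span A)) where
  app s := (⟨𝟙 (SpanObj.l s), spanPr₂ P ((spanPre P).unitL.obj s), 𝟙 (SpanObj.r s), by
      show (spanPr₁ P ((spanPre P).unitL.obj s) ≫ 𝟙 (SpanObj.l s)) ≫ 𝟙 (SpanObj.l s) = _
      rw [Category.comp_id, Category.comp_id, unitL_w], Category.comp_id _⟩ : SpanHom
      ((spanPre P).mul.obj ((spanPre P).unitL.obj s))
      s)
  cell x := (⟨A.idc (SpanV.l x), spanPrC₂ P ((spanPre P).unitL.mapV x), A.idc (SpanV.r x), by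
      show (spanPrC₁ P ((spanPre P).unitL.mapV x) ⊚ A.idc (SpanV.l x)) ⊚ A.idc (SpanV.l x) = _
      rw [A.comp_id, A.comp_id, unitLC_w], A.comp_id _⟩ : SpanCell
      ((spanPre P).mul.mapV ((spanPre P).unitL.mapV x))
      x)
  top_cell x := by
    -- The second component of `unitL` is the identity functor, so the second projection is already
    -- a transformation with the required target.
    refine SpanHom.ext ?_ ((isApexTrans_lift_pr₂ P _ _ _).top_cell x) ?_ <;> simp
  bot_cell x := by
    refine SpanHom.ext ?_ ((isApexTrans_lift_pr₂ P _ _ _).bot_cell x) ?_ <;> simp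
  app_nat f := by
    refine SpanHom.ext ?_ ((isApexTrans_lift_pr₂ P _ _ _).app_nat f) ?_ <;> simp
  cell_nat α := by
    refine SpanCell.ext ?_ ((isApexTrans_lift_pr₂ P _ _ _).cell_nat α) ?_ <;> simp
  cell_eta p := by
    refine SpanCell.ext ?_ ((isApexTrans_lift_pr₂ P _ _ _).cell_eta p) ?_ <;> simp
  cell_mu x y h := by
    refine SpanCell.ext ?_ ((isApexTrans_lift_pr₂ P _ _ _).cell_mu x y) ?_ <;> simp

theorem spanLeft_invertible : (spanLeft P).Invertible := by
  refine HTrans.invertible_of_components _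
    (fun s => (⟨𝟙 (SpanObj.l s), unitLInv P s, 𝟙 (SpanObj.r s), ?_, ?_⟩ : SpanHom
      s ((spanPre P).mul.obj ((spanPre P).unitL.obj s))))
    (fun x => (⟨A.idc (SpanV.l x), unitLInvC P x, A.idc (SpanV.r x), ?_, ?_⟩ : SpanCell
      x ((spanPre P).mul.mapV ((spanPre P).unitL.mapV x))))
    (fun s => SpanHom.ext (Category.id_comp _) (pr_unitLInv P s) (Category.id_comp _))
    (fun s => SpanHom.ext (Category.id_comp _) (unitLInv_pr₂ P s) (Category.id_comp _))
    (fun x => SpanCell.ext (A.id_comp _) (prC_unitLInvC P x) (A.id_comp _))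
    (fun x => SpanCell.ext (A.id_comp _) (unitLInvC_pr₂ P x) (A.id_comp _))
  · show SpanObj.f s ≫ 𝟙 _ = unitLInv P s ≫ spanPr₁ P ((spanPre P).unitL.obj s) ≫ 𝟙 (SpanObj.l s)
    rw [← Category.assoc, unitLInv_pr₁]
  · show SpanObj.g s ≫ 𝟙 _ = unitLInv P s ≫ spanPr₂ P ((spanPre P).unitL.obj s) ≫ SpanObj.g s
    rw [← Category.assoc, unitLInv_pr₂, Category.comp_id, Category.id_comp]
  · show SpanV.f x ⊚ A.idc _ = unitLInvC P x ⊚ spanPrC₁ P ((spanPre P).unitL.mapV x) ⊚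
      A.idc (SpanV.l x)
    rw [← A.assoc', unitLInvC_pr₁]
  · show SpanV.g x ⊚ A.idc _ = unitLInvC P x ⊚ spanPrC₂ P ((spanPre P).unitL.mapV x) ⊚ SpanV.g x
    rw [← A.assoc', unitLInvC_pr₂, A.comp_id, A.id_comp]

/-- The right unit constraint of the composition of spans. -/
noncomputable def spanRight :
    HTrans ((spanPre P).unitR.comp (spanPre P).mul) (LaxFunctor.id (Span A)) where
  app s := (⟨𝟙 (SpanObj.l s), spanPr₁ P ((spanPre P).unitR.obj s), 𝟙 (SpanObj.r s),
      Category.comp_id _, by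
      show (spanPr₂ P ((spanPre P).unitR.obj s) ≫ 𝟙 (SpanObj.r s)) ≫ 𝟙 (SpanObj.r s) = _
      rw [Category.comp_id, Category.comp_id, ← unitR_w]⟩ : SpanHom
      ((spanPre P).mul.obj ((spanPre P).unitR.obj s))
      s)
  cell x := (⟨A.idc (SpanV.l x), spanPrC₁ P ((spanPre P).unitR.mapV x), A.idc (SpanV.r x),
      A.comp_id _, by
      show (spanPrC₂ P ((spanPre P).unitR.mapV x) ⊚ A.idc (SpanV.r x)) ⊚ A.idc (SpanV.r x) = _
      rw [A.comp_id, A.comp_id, ← unitRC_w]⟩ : SpanCell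
      ((spanPre P).mul.mapV ((spanPre P).unitR.mapV x))
      x)
  top_cell x := by
    refine SpanHom.ext ?_ ((isApexTrans_lift_pr₁ P _ _ _).top_cell x) ?_ <;> simp
  bot_cell x := by
    refine SpanHom.ext ?_ ((isApexTrans_lift_pr₁ P _ _ _).bot_cell x) ?_ <;> simp
  app_nat f := by
    refine SpanHom.ext ?_ ((isApexTrans_lift_pr₁ P _ _ _).app_nat f) ?_ <;> simp
  cell_nat α := by
    refine SpanCell.ext ?_ ((isApexTrans_lift_pr₁ P _ _ _).cell_nat α) ?_ <;> simp
  cell_eta p := by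
    refine SpanCell.ext ?_ ((isApexTrans_lift_pr₁ P _ _ _).cell_eta p) ?_ <;> simp
  cell_mu x y h := by
    refine SpanCell.ext ?_ ((isApexTrans_lift_pr₁ P _ _ _).cell_mu x y) ?_ <;> simp

theorem spanRight_invertible : (spanRight P).Invertible := by
  refine HTrans.invertible_of_components _
    (fun s => (⟨𝟙 (SpanObj.l s), unitRInv P s, 𝟙 (SpanObj.r s), ?_, ?_⟩ : SpanHom
      s ((spanPre P).mul.obj ((spanPre P).unitR.obj s))))
    (fun x => (⟨A.idc (SpanV.l x), unitRInvC P x, A.idc (SpanV.r x), ?_, ?_⟩ : SpanCell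
      x ((spanPre P).mul.mapV ((spanPre P).unitR.mapV x))))
    (fun s => SpanHom.ext (Category.id_comp _) (pr_unitRInv P s) (Category.id_comp _))
    (fun s => SpanHom.ext (Category.id_comp _) (unitRInv_pr₁ P s) (Category.id_comp _))
    (fun x => SpanCell.ext (A.id_comp _) (prC_unitRInvC P x) (A.id_comp _))
    (fun x => SpanCell.ext (A.id_comp _) (unitRInvC_pr₁ P x) (A.id_comp _))
  · show SpanObj.f s ≫ 𝟙 _ = unitRInv P s ≫ spanPr₁ P ((spanPre P).unitR.obj s) ≫ SpanObj.f s
    rw [← Category.assoc, unitRInv_pr₁, Category.comp_id, Category.id_comp]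
  · show SpanObj.g s ≫ 𝟙 _ = unitRInv P s ≫ spanPr₂ P ((spanPre P).unitR.obj s) ≫ 𝟙 (SpanObj.r s)
    rw [← Category.assoc, unitRInv_pr₂]
  · show SpanV.f x ⊚ A.idc _ = unitRInvC P x ⊚ spanPrC₁ P ((spanPre P).unitR.mapV x) ⊚ SpanV.f x
    rw [← A.assoc', unitRInvC_pr₁, A.comp_id, A.id_comp]
  · show SpanV.g x ⊚ A.idc _ = unitRInvC P x ⊚ spanPrC₂ P ((spanPre P).unitR.mapV x) ⊚
      A.idc (SpanV.r x)
    rw [← A.assoc', unitRInvC_pr₂]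

/-- The constraints of the composition of spans. -/
noncomputable def spanConstraints : LxConstraints (spanPre P) where
  assoc := spanAssoc P
  left := spanLeft P
  right := spanRight P
  assoc_inv := spanAssoc_invertible P
  left_inv := spanLeft_invertible P
  right_inv := spanRight_invertible P
  -- All three constraints have literal identities on both feet.
  src_assoc _ := IsIdHom_id _
  tgt_assoc _ := IsIdHom_id _
  src_assoc_cell _ := IsIdCell_id _
  tgt_assoc_cell _ := IsIdCell_id _
  src_left _ := IsIdHom_id _
  tgt_left _ := IsIdHom_id _
  src_left_cell _ := IsIdCell_id _
  tgt_left_cell _ := IsIdCell_id _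
  src_right _ := IsIdHom_id _
  tgt_right _ := IsIdHom_id _
  src_right_cell _ := IsIdCell_id _
  tgt_right_cell _ := IsIdCell_id _

end SpanPseudocategory

/-! ### Pentagon and triangle, on arrows and on cells. -/

section SpanCoherence

universe u v w z

variable {A : WeakDbl.{u, v, w, z}} (P : LaxPullbackChoice A)

section
variable (p : (spanPre P).C₄.Obj)

/-- A constraint applied to one factor appears only after the projection to that factor; the other
projection does not see it. The next three statements are the remaining cases, and together they
supply the rewriting rules for the pentagon. -/
theorem assocOne_pr₁ :
    SpanHom.m ((spanPre P).mul.map ((spanConstraints P).assocOne p)) ≫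
        spanPr₁ P ((spanPre P).mulL.obj ((spanPre P).mul₂₃.obj p)) =
      spanPr₁ P ((spanPre P).mulL.obj ((spanPre P).mul₁₂.obj p)) ≫ assocApex P p.fst :=
  mul_map_pr₁ P ((spanConstraints P).assocOne p)

theorem assocOne_pr₂ :
    SpanHom.m ((spanPre P).mul.map ((spanConstraints P).assocOne p)) ≫
        spanPr₂ P ((spanPre P).mulL.obj ((spanPre P).mul₂₃.obj p)) =
      spanPr₂ P ((spanPre P).mulL.obj ((spanPre P).mul₁₂.obj p)) :=
  (mul_map_pr₂ P ((spanConstraints P).assocOne p)).trans (Category.comp_id _)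

theorem oneAssoc_pr₁ :
    SpanHom.m ((spanPre P).mul.map ((spanConstraints P).oneAssoc p)) ≫
        spanPr₁ P ((spanPre P).mulR.obj ((spanPre P).mul₃₄.obj p)) =
      spanPr₁ P ((spanPre P).mulR.obj ((spanPre P).mul₂₃.obj p)) :=
  (mul_map_pr₁ P ((spanConstraints P).oneAssoc p)).trans (Category.comp_id _)

theorem oneAssoc_pr₂ :
    SpanHom.m ((spanPre P).mul.map ((spanConstraints P).oneAssoc p)) ≫
        spanPr₂ P ((spanPre P).mulR.obj ((spanPre P).mul₃₄.obj p)) =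
      spanPr₂ P ((spanPre P).mulR.obj ((spanPre P).mul₂₃.obj p)) ≫
        assocApex P ((spanPre P).tail₄.obj p) :=
  mul_map_pr₂ P ((spanConstraints P).oneAssoc p)

/-- The pentagon, after projection to the composite of the last two spans. -/
theorem pentagon_last :
    SpanHom.m ((spanPre P).mul.map ((spanConstraints P).assocOne p)) ≫
        tailApex P ((spanPre P).mul₂₃.obj p) ≫ tailApex P ((spanPre P).tail₄.obj p) =
      tailApex P ((spanPre P).mul₁₂.obj p) := by
  apply apex_hom_ext P (p := (spanPre P).tail₃.obj ((spanPre P).tail₄.obj p))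
  -- Projection to `z`, the third factor. On the left it passes through `x ∘ (y ∘ z)`, and `h₅`,
  -- `h₄` undo the inner rebracketing.
  · have h₁ := tailApex_pr₁ P ((spanPre P).mul₂₃.obj p)
    have h₂ := tailApex_pr₁ P ((spanPre P).mul₁₂.obj p)
    have h₃ := tailApex_pr₁ P ((spanPre P).tail₄.obj p)
    have h₄ := tailApex_pr₂ P p.fst
    have h₅ := assocApex_pr₂ P p.fst
    rw [Category.assoc, Category.assoc, h₃]
    rw [← Category.assoc (tailApex P ((spanPre P).mul₂₃.obj p))]
    erw [h₁, h₂]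
    rw [Category.assoc, ← Category.assoc (SpanHom.m _)]
    erw [assocOne_pr₁]
    rw [Category.assoc, ← Category.assoc (assocApex _ _)]
    erw [h₅, h₄]
  -- Projection to `w`, the last factor, which `assocOne` leaves untouched.
  · have h₁ := tailApex_pr₂ P ((spanPre P).mul₂₃.obj p)
    have h₂ := tailApex_pr₂ P ((spanPre P).mul₁₂.obj p)
    have h₃ := tailApex_pr₂ P ((spanPre P).tail₄.obj p)
    rw [Category.assoc, Category.assoc, h₃]
    erw [h₁, h₂, assocOne_pr₂]

/-- The pentagon, after projection to the composite of the last three spans. -/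
theorem pentagon_tail :
    SpanHom.m ((spanPre P).mul.map ((spanConstraints P).assocOne p)) ≫
        tailApex P ((spanPre P).mul₂₃.obj p) ≫ assocApex P ((spanPre P).tail₄.obj p) =
      assocApex P ((spanPre P).mul₁₂.obj p) ≫ tailApex P ((spanPre P).mul₃₄.obj p) := by
  apply apex_hom_ext P (p := (spanPre P).mulR.obj ((spanPre P).tail₄.obj p))
  -- Projection to `y`. Both sides become the projection through `((x ∘ y) ∘ z)` and then `x ∘ y` to
  -- `y`.
  · have h₁ := tailApex_pr₁ P ((spanPre P).mul₂₃.obj p)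
    have h₂ := tailApex_pr₁ P ((spanPre P).mul₃₄.obj p)
    have h₃ := assocApex_pr₁ P ((spanPre P).tail₄.obj p)
    have h₄ := assocApex_pr₁ P ((spanPre P).mul₁₂.obj p)
    have h₅ := assocApex_pr₂ P p.fst
    have h₆ := tailApex_pr₁ P p.fst
    rw [Category.assoc, Category.assoc, Category.assoc, h₃,
      ← Category.assoc (tailApex P ((spanPre P).mul₂₃.obj p))]
    erw [h₁, h₂]
    rw [Category.assoc, ← Category.assoc (SpanHom.m _), ← Category.assoc (assocApex _ _)]
    erw [assocOne_pr₁, h₄]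
    rw [Category.assoc, Category.assoc, ← Category.assoc (assocApex _ _)]
    erw [h₅, h₆]
  · have h₁ := tailApex_pr₂ P ((spanPre P).mul₃₄.obj p)
    have h₂ := assocApex_pr₂ P ((spanPre P).tail₄.obj p)
    have h₃ := assocApex_pr₂ P ((spanPre P).mul₁₂.obj p)
    rw [Category.assoc, Category.assoc, Category.assoc, h₂]
    erw [h₁, h₃]
    -- On the right side the two rebracketings have collapsed to `tailApex` of `((x ∘ y), z, w)`, so
    -- what remains concerns `z ∘ w` only.
    exact pentagon_last P p

/-- The target is the apex of `x ∘ (y ∘ (z ∘ w))`. On its first projection both sides are the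
projection to `x`; on its second they agree by `pentagon_tail`, which in turn splits off `y` and
leaves `z ∘ w`. -/
theorem pentagon_apex :
    SpanHom.m ((spanPre P).mul.map ((spanConstraints P).assocOne p)) ≫
        assocApex P ((spanPre P).mul₂₃.obj p) ≫
          SpanHom.m ((spanPre P).mul.map ((spanConstraints P).oneAssoc p)) =
      assocApex P ((spanPre P).mul₁₂.obj p) ≫ assocApex P ((spanPre P).mul₃₄.obj p) := by
  apply apex_hom_ext P (p := (spanPre P).mulR.obj ((spanPre P).mul₃₄.obj p))
  · have h₁ := assocApex_pr₁ P ((spanPre P).mul₂₃.obj p)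
    have h₂ := assocApex_pr₁ P ((spanPre P).mul₃₄.obj p)
    have h₃ := assocApex_pr₁ P ((spanPre P).mul₁₂.obj p)
    have h₄ := assocApex_pr₁ P p.fst
    rw [Category.assoc, Category.assoc, Category.assoc, oneAssoc_pr₁]
    erw [h₁, h₂]
    rw [← Category.assoc, ← Category.assoc]
    erw [assocOne_pr₁, h₃]
    rw [Category.assoc, Category.assoc]
    erw [h₄]
  · have h₁ := assocApex_pr₂ P ((spanPre P).mul₂₃.obj p)
    have h₂ := assocApex_pr₂ P ((spanPre P).mul₃₄.obj p)
    rw [Category.assoc, Category.assoc, Category.assoc, oneAssoc_pr₂,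
      ← Category.assoc (assocApex P ((spanPre P).mul₂₃.obj p))]
    erw [h₁, h₂]
    exact pentagon_tail P p

end

section
variable (p : (spanPre P).C₂.Obj)

/-- Both sides go from the apex of `(x ∘ id) ∘ y` to that of `x ∘ y`, and both have the evident
projections to `x` and to `y`; the middle factor is forgotten. -/
theorem triangle_apex :
    assocApex P ((spanPre P).ins.obj p) ≫
        SpanHom.m ((spanPre P).mul.map ((spanConstraints P).oneLeft p)) =
      SpanHom.m ((spanPre P).mul.map ((spanConstraints P).rightOne p)) := by
  apply apex_hom_ext P (p := p)
  · have h₁ := assocApex_pr₁ P ((spanPre P).ins.obj p)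
    have h₂ : SpanHom.m ((spanPre P).mul.map ((spanConstraints P).oneLeft p)) ≫ spanPr₁ P p =
        spanPr₁ P ((spanPre P).mulR.obj ((spanPre P).ins.obj p)) :=
      (mul_map_pr₁ P ((spanConstraints P).oneLeft p)).trans (Category.comp_id _)
    -- The identity span on the middle foot is read once from `y` and once from `x`. Exchanging the
    -- readings is the identity on the factor `x`, so the first projection does not notice it.
    have h₃ : SpanHom.m ((spanPre P).mul.map ((spanPre P).swapUnit p)) ≫
        spanPr₁ P ((spanPre P).unitR.obj p.fst) =
          spanPr₁ P ((spanPre P).init₃.obj ((spanPre P).ins.obj p)) :=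
      (mul_map_pr₁ P ((spanPre P).swapUnit p)).trans (Category.comp_id _)
    have h₄ : SpanHom.m ((spanPre P).mul.map ((spanConstraints P).rightOne p)) ≫ spanPr₁ P p =
        spanPr₁ P ((spanPre P).mulL.obj ((spanPre P).ins.obj p)) ≫
          SpanHom.m ((spanPre P).mul.map ((spanPre P).swapUnit p)) ≫
            spanPr₁ P ((spanPre P).unitR.obj p.fst) :=
      mul_map_pr₁ P ((spanConstraints P).rightOne p)
    rw [Category.assoc, h₂, h₄, h₃]
    exact h₁
  · have h₁ := assocApex_pr₂ P ((spanPre P).ins.obj p)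
    have h₂ : SpanHom.m ((spanPre P).mul.map ((spanConstraints P).oneLeft p)) ≫ spanPr₂ P p =
        spanPr₂ P ((spanPre P).mulR.obj ((spanPre P).ins.obj p)) ≫
          spanPr₂ P ((spanPre P).tail₃.obj ((spanPre P).ins.obj p)) :=
      mul_map_pr₂ P ((spanConstraints P).oneLeft p)
    have h₃ := tailApex_pr₂ P ((spanPre P).ins.obj p)
    have h₄ : SpanHom.m ((spanPre P).mul.map ((spanConstraints P).rightOne p)) ≫ spanPr₂ P p =
        spanPr₂ P ((spanPre P).mulL.obj ((spanPre P).ins.obj p)) :=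
      (mul_map_pr₂ P ((spanConstraints P).rightOne p)).trans (Category.comp_id _)
    rw [Category.assoc, h₂, h₄, ← Category.assoc]
    erw [h₁]
    exact h₃

end

section
variable {p q : (spanPre P).C₄.Obj} (x : (spanPre P).C₄.V p q)

/-- Coherence is also required on cells, which have their own pullbacks in `A₁`. From here on the
arguments for arrows are repeated with the projections and universal property of `A₁`. -/
theorem assocOneCell_pr₁ :
    SpanCell.m ((spanPre P).mul.mapCell ((spanConstraints P).assocOneCell x)) ⊚
        spanPrC₁ P ((spanPre P).mulL.mapV ((spanPre P).mul₂₃.mapV x)) =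
      spanPrC₁ P ((spanPre P).mulL.mapV ((spanPre P).mul₁₂.mapV x)) ⊚ assocApexC P x.fst :=
  mul_mapCell_pr₁ P ((spanConstraints P).assocOneCell x)

theorem assocOneCell_pr₂ :
    SpanCell.m ((spanPre P).mul.mapCell ((spanConstraints P).assocOneCell x)) ⊚
        spanPrC₂ P ((spanPre P).mulL.mapV ((spanPre P).mul₂₃.mapV x)) =
      spanPrC₂ P ((spanPre P).mulL.mapV ((spanPre P).mul₁₂.mapV x)) :=
  (mul_mapCell_pr₂ P ((spanConstraints P).assocOneCell x)).trans (A.comp_id _)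

theorem oneAssocCell_pr₁ :
    SpanCell.m ((spanPre P).mul.mapCell ((spanConstraints P).oneAssocCell x)) ⊚
        spanPrC₁ P ((spanPre P).mulR.mapV ((spanPre P).mul₃₄.mapV x)) =
      spanPrC₁ P ((spanPre P).mulR.mapV ((spanPre P).mul₂₃.mapV x)) :=
  (mul_mapCell_pr₁ P ((spanConstraints P).oneAssocCell x)).trans (A.comp_id _)

theorem oneAssocCell_pr₂ :
    SpanCell.m ((spanPre P).mul.mapCell ((spanConstraints P).oneAssocCell x)) ⊚
        spanPrC₂ P ((spanPre P).mulR.mapV ((spanPre P).mul₃₄.mapV x)) =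
      spanPrC₂ P ((spanPre P).mulR.mapV ((spanPre P).mul₂₃.mapV x)) ⊚
        assocApexC P ((spanPre P).tail₄.mapV x) :=
  mul_mapCell_pr₂ P ((spanConstraints P).oneAssocCell x)

/-- The pentagon on cells, after projection to the composite of the last two spans. -/
theorem pentagon_lastC :
    SpanCell.m ((spanPre P).mul.mapCell ((spanConstraints P).assocOneCell x)) ⊚
        tailApexC P ((spanPre P).mul₂₃.mapV x) ⊚ tailApexC P ((spanPre P).tail₄.mapV x) =
      tailApexC P ((spanPre P).mul₁₂.mapV x) := by
  apply apex_cell_ext P (x := (spanPre P).tail₃.mapV ((spanPre P).tail₄.mapV x))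
  · have h₁ := tailApexC_pr₁ P ((spanPre P).mul₂₃.mapV x)
    have h₂ := tailApexC_pr₁ P ((spanPre P).mul₁₂.mapV x)
    have h₃ := tailApexC_pr₁ P ((spanPre P).tail₄.mapV x)
    have h₄ := tailApexC_pr₂ P x.fst
    have h₅ := assocApexC_pr₂ P x.fst
    rw [A.assoc', A.assoc', h₃]
    rw [← A.assoc' (tailApexC P ((spanPre P).mul₂₃.mapV x))]
    erw [h₁, h₂]
    rw [A.assoc', ← A.assoc' (SpanCell.m _)]
    erw [assocOneCell_pr₁]
    rw [A.assoc', ← A.assoc' (assocApexC _ _)]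
    erw [h₅, h₄]
  · have h₁ := tailApexC_pr₂ P ((spanPre P).mul₂₃.mapV x)
    have h₂ := tailApexC_pr₂ P ((spanPre P).mul₁₂.mapV x)
    have h₃ := tailApexC_pr₂ P ((spanPre P).tail₄.mapV x)
    rw [A.assoc', A.assoc', h₃]
    erw [h₁, h₂, assocOneCell_pr₂]

/-- The pentagon on cells, after projection to the composite of the last three spans. -/
theorem pentagon_tailC :
    SpanCell.m ((spanPre P).mul.mapCell ((spanConstraints P).assocOneCell x)) ⊚
        tailApexC P ((spanPre P).mul₂₃.mapV x) ⊚ assocApexC P ((spanPre P).tail₄.mapV x) =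
      assocApexC P ((spanPre P).mul₁₂.mapV x) ⊚ tailApexC P ((spanPre P).mul₃₄.mapV x) := by
  apply apex_cell_ext P (x := (spanPre P).mulR.mapV ((spanPre P).tail₄.mapV x))
  · have h₁ := tailApexC_pr₁ P ((spanPre P).mul₂₃.mapV x)
    have h₂ := tailApexC_pr₁ P ((spanPre P).mul₃₄.mapV x)
    have h₃ := assocApexC_pr₁ P ((spanPre P).tail₄.mapV x)
    have h₄ := assocApexC_pr₁ P ((spanPre P).mul₁₂.mapV x)
    have h₅ := assocApexC_pr₂ P x.fst
    have h₆ := tailApexC_pr₁ P x.fst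
    rw [A.assoc', A.assoc', A.assoc', h₃,
      ← A.assoc' (tailApexC P ((spanPre P).mul₂₃.mapV x))]
    erw [h₁, h₂]
    rw [A.assoc', ← A.assoc' (SpanCell.m _), ← A.assoc' (assocApexC _ _)]
    erw [assocOneCell_pr₁, h₄]
    rw [A.assoc', A.assoc', ← A.assoc' (assocApexC _ _)]
    erw [h₅, h₆]
  · have h₁ := tailApexC_pr₂ P ((spanPre P).mul₃₄.mapV x)
    have h₂ := assocApexC_pr₂ P ((spanPre P).tail₄.mapV x)
    have h₃ := assocApexC_pr₂ P ((spanPre P).mul₁₂.mapV x)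
    rw [A.assoc', A.assoc', A.assoc', h₂]
    erw [h₁, h₃]
    exact pentagon_lastC P x

/-- As for arrows, the projection to `x` is direct and the rest is `pentagon_tailC`. -/
theorem pentagon_apexC :
    SpanCell.m ((spanPre P).mul.mapCell ((spanConstraints P).assocOneCell x)) ⊚
        assocApexC P ((spanPre P).mul₂₃.mapV x) ⊚
          SpanCell.m ((spanPre P).mul.mapCell ((spanConstraints P).oneAssocCell x)) =
      assocApexC P ((spanPre P).mul₁₂.mapV x) ⊚ assocApexC P ((spanPre P).mul₃₄.mapV x) := by
  apply apex_cell_ext P (x := (spanPre P).mulR.mapV ((spanPre P).mul₃₄.mapV x))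
  · have h₁ := assocApexC_pr₁ P ((spanPre P).mul₂₃.mapV x)
    have h₂ := assocApexC_pr₁ P ((spanPre P).mul₃₄.mapV x)
    have h₃ := assocApexC_pr₁ P ((spanPre P).mul₁₂.mapV x)
    have h₄ := assocApexC_pr₁ P x.fst
    rw [A.assoc', A.assoc', A.assoc', oneAssocCell_pr₁]
    erw [h₁, h₂]
    rw [← A.assoc', ← A.assoc']
    erw [assocOneCell_pr₁, h₃]
    rw [A.assoc', A.assoc']
    erw [h₄]
  · have h₁ := assocApexC_pr₂ P ((spanPre P).mul₂₃.mapV x)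
    have h₂ := assocApexC_pr₂ P ((spanPre P).mul₃₄.mapV x)
    rw [A.assoc', A.assoc', A.assoc', oneAssocCell_pr₂,
      ← A.assoc' (assocApexC P ((spanPre P).mul₂₃.mapV x))]
    erw [h₁, h₂]
    exact pentagon_tailC P x

end

section
variable {p q : (spanPre P).C₂.Obj} (x : (spanPre P).C₂.V p q)

theorem triangle_apexC :
    assocApexC P ((spanPre P).ins.mapV x) ⊚
        SpanCell.m ((spanPre P).mul.mapCell ((spanConstraints P).oneLeftCell x)) =
      SpanCell.m ((spanPre P).mul.mapCell ((spanConstraints P).rightOneCell x)) := by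
  apply apex_cell_ext P (x := x)
  · have h₁ := assocApexC_pr₁ P ((spanPre P).ins.mapV x)
    have h₂ : SpanCell.m ((spanPre P).mul.mapCell ((spanConstraints P).oneLeftCell x)) ⊚
        spanPrC₁ P x =
        spanPrC₁ P ((spanPre P).mulR.mapV ((spanPre P).ins.mapV x)) :=
      (mul_mapCell_pr₁ P ((spanConstraints P).oneLeftCell x)).trans (A.comp_id _)
    have h₃ : SpanCell.m ((spanPre P).mul.mapCell ((spanPre P).swapUnitCell x)) ⊚
        spanPrC₁ P ((spanPre P).unitR.mapV x.fst) =
          spanPrC₁ P ((spanPre P).init₃.mapV ((spanPre P).ins.mapV x)) :=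
      (mul_mapCell_pr₁ P ((spanPre P).swapUnitCell x)).trans (A.comp_id _)
    have h₄ : SpanCell.m ((spanPre P).mul.mapCell ((spanConstraints P).rightOneCell x)) ⊚
        spanPrC₁ P x =
        spanPrC₁ P ((spanPre P).mulL.mapV ((spanPre P).ins.mapV x)) ⊚
          SpanCell.m ((spanPre P).mul.mapCell ((spanPre P).swapUnitCell x)) ⊚
            spanPrC₁ P ((spanPre P).unitR.mapV x.fst) :=
      mul_mapCell_pr₁ P ((spanConstraints P).rightOneCell x)
    rw [A.assoc', h₂, h₄, h₃]
    exact h₁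
  · have h₁ := assocApexC_pr₂ P ((spanPre P).ins.mapV x)
    have h₂ : SpanCell.m ((spanPre P).mul.mapCell ((spanConstraints P).oneLeftCell x)) ⊚
        spanPrC₂ P x =
        spanPrC₂ P ((spanPre P).mulR.mapV ((spanPre P).ins.mapV x)) ⊚
          spanPrC₂ P ((spanPre P).tail₃.mapV ((spanPre P).ins.mapV x)) :=
      mul_mapCell_pr₂ P ((spanConstraints P).oneLeftCell x)
    have h₃ := tailApexC_pr₂ P ((spanPre P).ins.mapV x)
    have h₄ : SpanCell.m ((spanPre P).mul.mapCell ((spanConstraints P).rightOneCell x)) ⊚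
        spanPrC₂ P x =
        spanPrC₂ P ((spanPre P).mulL.mapV ((spanPre P).ins.mapV x)) :=
      (mul_mapCell_pr₂ P ((spanConstraints P).rightOneCell x)).trans (A.comp_id _)
    rw [A.assoc', h₂, h₄, ← A.assoc']
    erw [h₁]
    exact h₃

end

/-- The pseudocategory of spans. -/
noncomputable def spanPseudocategory : LxPseudocategory (spanPre P) where
  toLxConstraints := spanConstraints P
  pentagon p := by
    refine SpanHom.ext ?_ (pentagon_apex P p) ?_
    -- On the feet every constraint, also after application of `mul`, is an identity, so coherence
    -- there is trivial.
    · show 𝟙 _ ≫ 𝟙 _ ≫ 𝟙 _ = 𝟙 _ ≫ 𝟙 _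
      simp
    · show 𝟙 _ ≫ 𝟙 _ ≫ 𝟙 _ = 𝟙 _ ≫ 𝟙 _
      simp
  pentagon_cell x := by
    refine SpanCell.ext ?_ (pentagon_apexC P x) ?_
    · show A.idc _ ⊚ A.idc _ ⊚ A.idc _ = A.idc _ ⊚ A.idc _
      simp
    · show A.idc _ ⊚ A.idc _ ⊚ A.idc _ = A.idc _ ⊚ A.idc _
      simp
  triangle p := by
    refine SpanHom.ext ?_ (triangle_apex P p) ?_
    -- The two identities on the right come from `swapUnit` and from the right unit constraint. On
    -- the other foot `rightOne` contributes a single identity.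
    · show 𝟙 _ ≫ 𝟙 _ = 𝟙 _ ≫ 𝟙 _
      rfl
    · show 𝟙 _ ≫ 𝟙 _ = 𝟙 _
      simp
  triangle_cell x := by
    refine SpanCell.ext ?_ (triangle_apexC P x) ?_
    · show A.idc _ ⊚ A.idc _ = A.idc _ ⊚ A.idc _
      rfl
    · show A.idc _ ⊚ A.idc _ = A.idc _
      simp

end SpanCoherence

/-! ### Composable pairs of spans as a pullback of double categories. -/

section Comparison

universe u v w z u₁ v₁ w₁ z₁ u₂ v₂ w₂ z₂

variable {A : WeakDbl.{u, v, w, z}}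

/-- The cell version of `comp_eqToHom_heq`. It identifies the leg transported by `pbToZig` with the
original leg. -/
theorem WeakDbl.comp_eqCell_heq {B B' C C' D D' : A.Obj} {x : A.V B B'} {y : A.V C C'}
    {t : A.V D D'} (α : A.Cell x y) (h : C = D) (h' : C' = D') (e : HEq y t) :
    HEq (α ⊚ eqCell h h' e) α := by
  subst h h'; cases e; simp

section Components

/-- The round trips preserve objects only up to propositional equality, so vertical arrows must be
compared heterogeneously; this reduces the comparison to components. -/
theorem SpanV.heq {X Y X' Y' : SpanObj A} (hX : X = X') (hY : Y = Y') {x : SpanV X Y}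
    {x' : SpanV X' Y'} (hl : HEq x.l x'.l) (hm : HEq x.m x'.m) (hr : HEq x.r x'.r)
    (hf : HEq x.f x'.f) (hg : HEq x.g x'.g) : HEq x x' := by
  subst hX hY
  exact heq_of_eq (SpanV.ext (eq_of_heq hl) (eq_of_heq hm) (eq_of_heq hr) hf hg)

theorem ZigV.heq {X Y X' Y' : ZigObj A} (hX : X = X') (hY : Y = Y') {x : ZigV X Y}
    {x' : ZigV X' Y'} (h₀ : HEq x.a₀ x'.a₀) (h₃ : HEq x.a₃ x'.a₃) (h₁ : HEq x.a₁ x'.a₁)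
    (h₄ : HEq x.a₄ x'.a₄) (h₂ : HEq x.a₂ x'.a₂) (hf : HEq x.f x'.f) (hg : HEq x.g x'.g)
    (hh : HEq x.h x'.h) (hk : HEq x.k x'.k) : HEq x x' := by
  subst hX hY
  exact heq_of_eq (ZigV.ext (eq_of_heq h₀) (eq_of_heq h₃) (eq_of_heq h₁) (eq_of_heq h₄)
    (eq_of_heq h₂) hf hg hh hk)

/-- Transport along an equality of diagrams is componentwise. This and the similar statements below,
for each vertex of each shape, turn the equations required by `LaxFunctor.ext_full` into equations
in `A`. -/
theorem SpanHom.eqToHom_l {X Y : SpanObj A} (h : X = Y) :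
    SpanHom.l (eqToHom h) = eqToHom (congrArg SpanObj.l h) := by
  subst h; rfl

theorem SpanV.l_heq {X Y X' Y' : SpanObj A} (h : X = Y) (h' : X' = Y') {x : SpanV X X'}
    {y : SpanV Y Y'} (e : HEq x y) : HEq x.l y.l := by
  subst h h'; cases e; rfl

theorem SpanCell.eqCell_l {X Y X' Y' : SpanObj A} (h : X = Y) (h' : X' = Y') {x : SpanV X X'}
    {y : SpanV Y Y'} (e : HEq x y) : SpanCell.l (eqCell (D := Span A) h h' e) =
      eqCell (congrArg SpanObj.l h) (congrArg SpanObj.l h') (SpanV.l_heq h h' e) := by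
  subst h h'; cases e; rfl

theorem SpanHom.eqToHom_m {X Y : SpanObj A} (h : X = Y) :
    SpanHom.m (eqToHom h) = eqToHom (congrArg SpanObj.m h) := by
  subst h; rfl

theorem SpanV.m_heq {X Y X' Y' : SpanObj A} (h : X = Y) (h' : X' = Y') {x : SpanV X X'}
    {y : SpanV Y Y'} (e : HEq x y) : HEq x.m y.m := by
  subst h h'; cases e; rfl

theorem SpanCell.eqCell_m {X Y X' Y' : SpanObj A} (h : X = Y) (h' : X' = Y') {x : SpanV X X'}
    {y : SpanV Y Y'} (e : HEq x y) : SpanCell.m (eqCell (D := Span A) h h' e) =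
      eqCell (congrArg SpanObj.m h) (congrArg SpanObj.m h') (SpanV.m_heq h h' e) := by
  subst h h'; cases e; rfl

theorem SpanHom.eqToHom_r {X Y : SpanObj A} (h : X = Y) :
    SpanHom.r (eqToHom h) = eqToHom (congrArg SpanObj.r h) := by
  subst h; rfl

theorem SpanV.r_heq {X Y X' Y' : SpanObj A} (h : X = Y) (h' : X' = Y') {x : SpanV X X'}
    {y : SpanV Y Y'} (e : HEq x y) : HEq x.r y.r := by
  subst h h'; cases e; rfl

theorem SpanCell.eqCell_r {X Y X' Y' : SpanObj A} (h : X = Y) (h' : X' = Y') {x : SpanV X X'}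
    {y : SpanV Y Y'} (e : HEq x y) : SpanCell.r (eqCell (D := Span A) h h' e) =
      eqCell (congrArg SpanObj.r h) (congrArg SpanObj.r h') (SpanV.r_heq h h' e) := by
  subst h h'; cases e; rfl

theorem ZigHom.eqToHom_a₀ {X Y : ZigObj A} (h : X = Y) :
    ZigHom.a₀ (eqToHom h) = eqToHom (congrArg ZigObj.a₀ h) := by
  subst h; rfl

theorem ZigV.a₀_heq {X Y X' Y' : ZigObj A} (h : X = Y) (h' : X' = Y') {x : ZigV X X'}
    {y : ZigV Y Y'} (e : HEq x y) : HEq x.a₀ y.a₀ := by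
  subst h h'; cases e; rfl

theorem ZigCell.eqCell_a₀ {X Y X' Y' : ZigObj A} (h : X = Y) (h' : X' = Y') {x : ZigV X X'}
    {y : ZigV Y Y'} (e : HEq x y) : ZigCell.a₀ (eqCell (D := Zig A) h h' e) =
      eqCell (congrArg ZigObj.a₀ h) (congrArg ZigObj.a₀ h') (ZigV.a₀_heq h h' e) := by
  subst h h'; cases e; rfl

theorem ZigHom.eqToHom_a₃ {X Y : ZigObj A} (h : X = Y) :
    ZigHom.a₃ (eqToHom h) = eqToHom (congrArg ZigObj.a₃ h) := by
  subst h; rfl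

theorem ZigV.a₃_heq {X Y X' Y' : ZigObj A} (h : X = Y) (h' : X' = Y') {x : ZigV X X'}
    {y : ZigV Y Y'} (e : HEq x y) : HEq x.a₃ y.a₃ := by
  subst h h'; cases e; rfl

theorem ZigCell.eqCell_a₃ {X Y X' Y' : ZigObj A} (h : X = Y) (h' : X' = Y') {x : ZigV X X'}
    {y : ZigV Y Y'} (e : HEq x y) : ZigCell.a₃ (eqCell (D := Zig A) h h' e) =
      eqCell (congrArg ZigObj.a₃ h) (congrArg ZigObj.a₃ h') (ZigV.a₃_heq h h' e) := by
  subst h h'; cases e; rfl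

theorem ZigHom.eqToHom_a₁ {X Y : ZigObj A} (h : X = Y) :
    ZigHom.a₁ (eqToHom h) = eqToHom (congrArg ZigObj.a₁ h) := by
  subst h; rfl

theorem ZigV.a₁_heq {X Y X' Y' : ZigObj A} (h : X = Y) (h' : X' = Y') {x : ZigV X X'}
    {y : ZigV Y Y'} (e : HEq x y) : HEq x.a₁ y.a₁ := by
  subst h h'; cases e; rfl

theorem ZigCell.eqCell_a₁ {X Y X' Y' : ZigObj A} (h : X = Y) (h' : X' = Y') {x : ZigV X X'}
    {y : ZigV Y Y'} (e : HEq x y) : ZigCell.a₁ (eqCell (D := Zig A) h h' e) =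
      eqCell (congrArg ZigObj.a₁ h) (congrArg ZigObj.a₁ h') (ZigV.a₁_heq h h' e) := by
  subst h h'; cases e; rfl

theorem ZigHom.eqToHom_a₄ {X Y : ZigObj A} (h : X = Y) :
    ZigHom.a₄ (eqToHom h) = eqToHom (congrArg ZigObj.a₄ h) := by
  subst h; rfl

theorem ZigV.a₄_heq {X Y X' Y' : ZigObj A} (h : X = Y) (h' : X' = Y') {x : ZigV X X'}
    {y : ZigV Y Y'} (e : HEq x y) : HEq x.a₄ y.a₄ := by
  subst h h'; cases e; rfl

theorem ZigCell.eqCell_a₄ {X Y X' Y' : ZigObj A} (h : X = Y) (h' : X' = Y') {x : ZigV X X'}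
    {y : ZigV Y Y'} (e : HEq x y) : ZigCell.a₄ (eqCell (D := Zig A) h h' e) =
      eqCell (congrArg ZigObj.a₄ h) (congrArg ZigObj.a₄ h') (ZigV.a₄_heq h h' e) := by
  subst h h'; cases e; rfl

theorem ZigHom.eqToHom_a₂ {X Y : ZigObj A} (h : X = Y) :
    ZigHom.a₂ (eqToHom h) = eqToHom (congrArg ZigObj.a₂ h) := by
  subst h; rfl

theorem ZigV.a₂_heq {X Y X' Y' : ZigObj A} (h : X = Y) (h' : X' = Y') {x : ZigV X X'}
    {y : ZigV Y Y'} (e : HEq x y) : HEq x.a₂ y.a₂ := by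
  subst h h'; cases e; rfl

theorem ZigCell.eqCell_a₂ {X Y X' Y' : ZigObj A} (h : X = Y) (h' : X' = Y') {x : ZigV X X'}
    {y : ZigV Y Y'} (e : HEq x y) : ZigCell.a₂ (eqCell (D := Zig A) h h' e) =
      eqCell (congrArg ZigObj.a₂ h) (congrArg ZigObj.a₂ h') (ZigV.a₂_heq h h' e) := by
  subst h h'; cases e; rfl

variable {B : WeakDbl.{u₁, v₁, w₁, z₁}} {C : WeakDbl.{u₂, v₂, w₂, z₂}} {F : StrictFunctor B A}
  {G : StrictFunctor C A}

theorem PbV.heq {X Y X' Y' : PbObj F G} (hX : X = X') (hY : Y = Y') {x : PbV X Y}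
    {x' : PbV X' Y'} (h₁ : HEq x.fst x'.fst) (h₂ : HEq x.snd x'.snd) : HEq x x' := by
  subst hX hY
  exact heq_of_eq (PbV.ext (eq_of_heq h₁) (eq_of_heq h₂))

theorem PbHom.eqToHom_fst {X Y : PbObj F G} (h : X = Y) :
    PbHom.fst (eqToHom h) = eqToHom (congrArg PbObj.fst h) := by
  subst h; rfl

theorem PbV.fst_heq {X Y X' Y' : PbObj F G} (h : X = Y) (h' : X' = Y') {x : PbV X X'}
    {y : PbV Y Y'} (e : HEq x y) : HEq x.fst y.fst := by
  subst h h'; cases e; rfl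

theorem PbCell.eqCell_fst {X Y X' Y' : PbObj F G} (h : X = Y) (h' : X' = Y') {x : PbV X X'}
    {y : PbV Y Y'} (e : HEq x y) : PbCell.fst (eqCell (D := Pb F G) h h' e) =
      eqCell (congrArg PbObj.fst h) (congrArg PbObj.fst h') (PbV.fst_heq h h' e) := by
  subst h h'; cases e; rfl

theorem PbHom.eqToHom_snd {X Y : PbObj F G} (h : X = Y) :
    PbHom.snd (eqToHom h) = eqToHom (congrArg PbObj.snd h) := by
  subst h; rfl

theorem PbV.snd_heq {X Y X' Y' : PbObj F G} (h : X = Y) (h' : X' = Y') {x : PbV X X'}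
    {y : PbV Y Y'} (e : HEq x y) : HEq x.snd y.snd := by
  subst h h'; cases e; rfl

theorem PbCell.eqCell_snd {X Y X' Y' : PbObj F G} (h : X = Y) (h' : X' = Y') {x : PbV X X'}
    {y : PbV Y Y'} (e : HEq x y) : PbCell.snd (eqCell (D := Pb F G) h h' e) =
      eqCell (congrArg PbObj.snd h) (congrArg PbObj.snd h') (PbV.snd_heq h h' e) := by
  subst h h'; cases e; rfl

end Components

/-- Starting from a diagram, the middle feet coincide by definition, so the round trip only composes
the leg `h` with an identity. This is an equality but not a definitional one, hence the transports.
-/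
theorem zigToPb_pbToZig :
    (zigToPb A).comp (pbToZig A) = LaxFunctor.id _ := by
  have ho : ∀ X : ZigObj A, ((zigToPb A).comp (pbToZig A)).obj X = X := fun X =>
    ZigObj.ext rfl rfl rfl rfl rfl HEq.rfl HEq.rfl (heq_of_eq (Category.comp_id _)) HEq.rfl
  refine LaxFunctor.ext_full ho (fun a => ?_)
    (fun x => ZigV.heq (ho _) (ho _) HEq.rfl HEq.rfl HEq.rfl HEq.rfl HEq.rfl HEq.rfl HEq.rfl
      (heq_of_eq (A.comp_id _)) HEq.rfl) (fun α => ?_) (fun X => ?_) (fun x y => ?_)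
  · apply ZigHom.ext
    -- At each of the five vertices the transport is along an equality that holds by definition, and
    -- it reduces to an identity.
    all_goals
      dsimp only [ZigHom.comp_a₀, ZigHom.comp_a₃, ZigHom.comp_a₁, ZigHom.comp_a₄, ZigHom.comp_a₂]
      first
      | erw [ZigHom.eqToHom_a₀ (ho _), ZigHom.eqToHom_a₀ (ho _)]
      | erw [ZigHom.eqToHom_a₃ (ho _), ZigHom.eqToHom_a₃ (ho _)]
      | erw [ZigHom.eqToHom_a₁ (ho _), ZigHom.eqToHom_a₁ (ho _)]
      | erw [ZigHom.eqToHom_a₄ (ho _), ZigHom.eqToHom_a₄ (ho _)]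
      | erw [ZigHom.eqToHom_a₂ (ho _), ZigHom.eqToHom_a₂ (ho _)]
      simp
  all_goals
    apply ZigCell.ext
    all_goals
      dsimp only
      first
      | erw [ZigCell.eqCell_a₀ (ho _) (ho _), ZigCell.eqCell_a₀ (ho _) (ho _)]
      | erw [ZigCell.eqCell_a₃ (ho _) (ho _), ZigCell.eqCell_a₃ (ho _) (ho _)]
      | erw [ZigCell.eqCell_a₁ (ho _) (ho _), ZigCell.eqCell_a₁ (ho _) (ho _)]
      | erw [ZigCell.eqCell_a₄ (ho _) (ho _), ZigCell.eqCell_a₄ (ho _) (ho _)]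
      | erw [ZigCell.eqCell_a₂ (ho _) (ho _), ZigCell.eqCell_a₂ (ho _) (ho _)]
      simp

/-- The first span is unchanged. In the second, the left foot is replaced by the right foot of the
first span, equal to it by `p.w`, and the left leg is transported accordingly. -/
theorem pbToZig_zigToPb :
    (pbToZig A).comp (zigToPb A) = LaxFunctor.id _ := by
  have hs : ∀ p : PbObj (spanTgt A) (spanSrc A),
      (((pbToZig A).comp (zigToPb A)).obj p).snd = p.snd := fun p =>
    SpanObj.ext p.w rfl rfl (comp_eqToHom_heq _ _) HEq.rfl
  have ho : ∀ p : PbObj (spanTgt A) (spanSrc A), ((pbToZig A).comp (zigToPb A)).obj p = p :=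
    fun p => PbObj.ext rfl (hs p)
  refine LaxFunctor.ext_full ho (fun a => ?_)
    (fun x => PbV.heq (ho _) (ho _) HEq.rfl (SpanV.heq (hs _) (hs _) x.w HEq.rfl HEq.rfl
      (comp_eqCell_heq _ _ _ _) HEq.rfl)) (fun α => ?_) (fun p => ?_) (fun x y => ?_)
  · apply PbHom.ext
    · simp only [PbHom.comp_fst, PbHom.eqToHom_fst, eqToHom_refl, Category.comp_id,
        Category.id_comp]
      rfl
    · apply SpanHom.ext
      -- At the replaced foot the map is now the one of the first span; that it matches the original
      -- map of the second is the compatibility defining arrows of the pullback.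
      · simpa [PbHom.eqToHom_snd, SpanHom.eqToHom_l] using PbHom.w a
      · simp [PbHom.eqToHom_snd, SpanHom.eqToHom_m]
      · simp [PbHom.eqToHom_snd, SpanHom.eqToHom_r]
  · apply PbCell.ext
    · simp [PbCell.eqCell_fst]
    · apply SpanCell.ext
      -- The same at the level of cells.
      · simpa [PbCell.eqCell_snd, SpanCell.eqCell_l] using PbCell.w α
      · simp [PbCell.eqCell_snd, SpanCell.eqCell_m]
      · simp [PbCell.eqCell_snd, SpanCell.eqCell_r]
  all_goals
    apply PbCell.ext
    · simp [PbCell.eqCell_fst]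
    · apply SpanCell.ext <;> simp [PbCell.eqCell_snd, SpanCell.eqCell_l, SpanCell.eqCell_m,
        SpanCell.eqCell_r]

end Comparison

end SpanDbl

/-! ### The main theorem. -/

theorem mainTheorem6 (A : SpanDbl.WeakDbl) (P : SpanDbl.LaxPullbackChoice A) :
    -- the diagrams `0 ← 3 → 1 ← 4 → 2` are the pullback of the feet of spans
    ((SpanDbl.zigToPb A).comp (SpanDbl.pbToZig A) = SpanDbl.LaxFunctor.id _ ∧
      (SpanDbl.pbToZig A).comp (SpanDbl.zigToPb A) = SpanDbl.LaxFunctor.id _) ∧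
    -- the pseudocategory, with the canonical constraints
    (∃ c : SpanDbl.LxPseudocategory (SpanDbl.spanPre P),
      (∀ p : (SpanDbl.spanPre P).C₃.Obj,
        SpanDbl.SpanHom.m (c.assoc.app p) ≫ SpanDbl.spanPr₁ P ((SpanDbl.spanPre P).mulR.obj p) =
          SpanDbl.spanPr₁ P ((SpanDbl.spanPre P).mulL.obj p) ≫ SpanDbl.spanPr₁ P p.fst ∧
        SpanDbl.SpanHom.m (c.assoc.app p) ≫ SpanDbl.spanPr₂ P ((SpanDbl.spanPre P).mulR.obj p) ≫
            SpanDbl.spanPr₁ P ((SpanDbl.spanPre P).tail₃.obj p) =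
          SpanDbl.spanPr₁ P ((SpanDbl.spanPre P).mulL.obj p) ≫ SpanDbl.spanPr₂ P p.fst ∧
        SpanDbl.SpanHom.m (c.assoc.app p) ≫ SpanDbl.spanPr₂ P ((SpanDbl.spanPre P).mulR.obj p) ≫
            SpanDbl.spanPr₂ P ((SpanDbl.spanPre P).tail₃.obj p) =
          SpanDbl.spanPr₂ P ((SpanDbl.spanPre P).mulL.obj p)) ∧
      (∀ {p q : (SpanDbl.spanPre P).C₃.Obj} (x : (SpanDbl.spanPre P).C₃.V p q),
        A.comp (SpanDbl.SpanCell.m (c.assoc.cell x))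
            (SpanDbl.spanPrC₁ P ((SpanDbl.spanPre P).mulR.mapV x)) =
          A.comp (SpanDbl.spanPrC₁ P ((SpanDbl.spanPre P).mulL.mapV x))
            (SpanDbl.spanPrC₁ P x.fst) ∧
        A.comp (SpanDbl.SpanCell.m (c.assoc.cell x))
            (A.comp (SpanDbl.spanPrC₂ P ((SpanDbl.spanPre P).mulR.mapV x))
              (SpanDbl.spanPrC₁ P ((SpanDbl.spanPre P).tail₃.mapV x))) =
          A.comp (SpanDbl.spanPrC₁ P ((SpanDbl.spanPre P).mulL.mapV x))
            (SpanDbl.spanPrC₂ P x.fst) ∧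
        A.comp (SpanDbl.SpanCell.m (c.assoc.cell x))
            (A.comp (SpanDbl.spanPrC₂ P ((SpanDbl.spanPre P).mulR.mapV x))
              (SpanDbl.spanPrC₂ P ((SpanDbl.spanPre P).tail₃.mapV x))) =
          SpanDbl.spanPrC₂ P ((SpanDbl.spanPre P).mulL.mapV x)) ∧
      (∀ s : SpanDbl.SpanObj A,
        SpanDbl.SpanHom.m (c.left.app s) =
          SpanDbl.spanPr₂ P ((SpanDbl.spanPre P).unitL.obj s) ∧
        SpanDbl.SpanHom.m (c.right.app s) =
          SpanDbl.spanPr₁ P ((SpanDbl.spanPre P).unitR.obj s)) ∧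
      (∀ {s t : SpanDbl.SpanObj A} (x : SpanDbl.SpanV s t),
        SpanDbl.SpanCell.m (c.left.cell x) =
          SpanDbl.spanPrC₂ P ((SpanDbl.spanPre P).unitL.mapV x) ∧
        SpanDbl.SpanCell.m (c.right.cell x) =
          SpanDbl.spanPrC₁ P ((SpanDbl.spanPre P).unitR.mapV x))) ∧
    -- `χ` is the comparison of pullbacks with vertical composition
    (∀ {p q r : (SpanDbl.spanPre P).C₂.Obj} (x : (SpanDbl.spanPre P).C₂.V p q)
        (y : (SpanDbl.spanPre P).C₂.V q r),
      SpanDbl.WeakDbl.IsIdCell (SpanDbl.SpanCell.l ((SpanDbl.spanPre P).mul.mu x y)) ∧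
      SpanDbl.WeakDbl.IsIdCell (SpanDbl.SpanCell.r ((SpanDbl.spanPre P).mul.mu x y)) ∧
      A.comp (SpanDbl.SpanCell.m ((SpanDbl.spanPre P).mul.mu x y))
          (SpanDbl.spanPrC₁ P ((SpanDbl.spanPre P).C₂.vcomp x y)) =
        A.vcompCell (SpanDbl.spanPrC₁ P x) (SpanDbl.spanPrC₁ P y) (by simp) ∧
      A.comp (SpanDbl.SpanCell.m ((SpanDbl.spanPre P).mul.mu x y))
          (SpanDbl.spanPrC₂ P ((SpanDbl.spanPre P).C₂.vcomp x y)) =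
        A.vcompCell (SpanDbl.spanPrC₂ P x) (SpanDbl.spanPrC₂ P y) (by simp)) ∧
    -- `δ` is the comparison of pullbacks with vertical identities
    (∀ p : (SpanDbl.spanPre P).C₂.Obj,
      SpanDbl.WeakDbl.IsIdCell (SpanDbl.SpanCell.l ((SpanDbl.spanPre P).mul.eta p)) ∧
      SpanDbl.WeakDbl.IsIdCell (SpanDbl.SpanCell.r ((SpanDbl.spanPre P).mul.eta p)) ∧
      A.comp (SpanDbl.SpanCell.m ((SpanDbl.spanPre P).mul.eta p))
          (SpanDbl.spanPrC₁ P ((SpanDbl.spanPre P).C₂.vid p)) =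
        A.vidCell (SpanDbl.spanPr₁ P p) ∧
      A.comp (SpanDbl.SpanCell.m ((SpanDbl.spanPre P).mul.eta p))
          (SpanDbl.spanPrC₂ P ((SpanDbl.spanPre P).C₂.vid p)) =
        A.vidCell (SpanDbl.spanPr₂ P p)) ∧
    -- `μ` and `τ` are identities
    (∀ {B C D : A.Obj} (x : A.V B C) (y : A.V C D),
      SpanDbl.WeakDbl.IsIdCell (D := SpanDbl.Span A) ((SpanDbl.spanPre P).unit.mu x y)) ∧
    (∀ B : A.Obj,
      SpanDbl.WeakDbl.IsIdCell (D := SpanDbl.Span A) ((SpanDbl.spanPre P).unit.eta B)) := by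
  refine ⟨⟨SpanDbl.zigToPb_pbToZig, SpanDbl.pbToZig_zigToPb⟩,
    ⟨SpanDbl.spanPseudocategory P, fun p => ⟨SpanDbl.assocApex_pr₁ P p, ?_, ?_⟩,
      fun x => ⟨SpanDbl.assocApexC_pr₁ P x, ?_, ?_⟩, fun s => ⟨rfl, rfl⟩, fun x => ⟨rfl, rfl⟩⟩,
    fun x y => ⟨?_, ?_, SpanDbl.mul_mu_pr₁ P x y _, SpanDbl.mul_mu_pr₂ P x y _⟩,
    fun p => ⟨?_, ?_, SpanDbl.mul_eta_pr₁ P p, SpanDbl.mul_eta_pr₂ P p⟩,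
    fun x y => (SpanDbl.spanUnit A).mu_id x y, fun B => (SpanDbl.spanUnit A).eta_id B⟩
  -- The projections of the associativity constraint to `y` and `z` factor through `tailApex`, the
  -- component at `y ∘ z`.
  · show SpanDbl.assocApex P p ≫ _ = _
    rw [← Category.assoc, SpanDbl.assocApex_pr₂]
    exact SpanDbl.tailApex_pr₁ P p
  · show SpanDbl.assocApex P p ≫ _ = _
    rw [← Category.assoc, SpanDbl.assocApex_pr₂]
    exact SpanDbl.tailApex_pr₂ P p
  · show A.comp (SpanDbl.assocApexC P x) _ = _
    rw [← A.assoc', SpanDbl.assocApexC_pr₂]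
    exact SpanDbl.tailApexC_pr₁ P x
  · show A.comp (SpanDbl.assocApexC P x) _ = _
    rw [← A.assoc', SpanDbl.assocApexC_pr₂]
    exact SpanDbl.tailApexC_pr₂ P x
  -- On a foot, each interchanger is the composite of two identity cells, one from `spanComp` and
  -- one from `pbToZig`.
  all_goals exact SpanDbl.IsIdCell_comp (SpanDbl.IsIdCell_id _) (SpanDbl.IsIdCell_id _)
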